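/- Let $\mathbb H=\mathbb R^3$ be the Heisenberg group with left-invariant fields $X=\partial_{x_1}+2x_2\partial_{x_3}$, $Y=\partial_{x_2}-2x_1\partial_{x_3}$, $T=[X,Y]=-4\partial_{x_3}$, and write points of $\mathbb H\times(0,\infty)$ as $(x,y)$. Put $\nabla_{\mathbb H}u=(Xu,Yu)$, $\widehat\nabla u=(Xu,Yu,u_y)$, $Hu=\begin{pmatrix}XXu&YXu\\XYu&YYu\end{pmatrix}$, where norms and inner products are the Euclidean ones of the components, and $B_R^+=\{(x,y): |x|^2+y^2<R^2,\ y>0\}$. Where $\nabla_{\mathbb H}u\ne0$ let $$\nu=\frac{\nabla_{\mathbb H}u}{|\nabla_{\mathbb H}u|},\quad v=\frac{(Yu,-Xu)}{|\nabla_{\mathbb H}u|},\quad h=X\nu_1+Y\nu_2,\quad p=-\frac{Tu}{|\nabla_{\mathbb H}u|},\quad T\nu=(T\nu_1,T\nu_2).$$ Let $s\in(0,1)$, $a=1-2s$, $\gamma>\max\{0,1-2s\}$, and let $f\in C^{1,\gamma}(\mathbb R)$ (that is, $f\in C^1$ with locally $\gamma$-Hölder continuous derivative). Call $\xi$ admissible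 if it is bounded and locally Lipschitz on $\mathbb H\times(0,\infty)$, vanishes outside some $B_R^+$, and $y^a|\widehat\nabla\xi|^2\in L^1(B_R^+)$ for all $R>0$. Let $u\in C^2(\mathbb H\times(0,\infty))$ be bounded, and suppose: 1. ($u$ is a weak solution of $\operatorname{div}(y^a\widehat\nabla u)=0$ in $\mathbb H\times(0,\infty)$, $-y^au_y=f(u)$ on $\mathbb H\times\{0\}$.) For all $R>0$, $y^a|\widehat\nabla u|^2\in L^1(B_R^+)$; and for every admissible $\xi$, $\int_{\mathbb H\times(0,\infty)}y^a\langle\widehat\nabla u,\widehat\nabla\xi\rangle=\int_{\mathbb H}f(u)\,\xi$, where on $\mathbb H=\mathbb H\times\{0\}$ the values of $u$ and $\xi$ are their limits as $y\to0^+$, which exist almost everywhere. 2. ($u$ is stable.) $\int_{\mathbb H\times(0,\infty)}y^a|\widehat\nabla\xi|^2-\int_{\mathbb H}f'(u)\,\xi^2\ge0$ for every admissible $\xi$. 3. $|\nabla_{\mathbb H}u|$ is bounded on $B_R^+$ for every $R>0$. 4. $\langle T\nu,v\rangle\ge0$ at every $(x,y)$, $y>0$, with $\nabla_{\mathbb H}u(x,y)\ne0$.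 5. With $B(0,\tau)=\{(x,y): y>0,\ \big(((x_1^2+x_2^2)^2+x_3^2)^{1/2}+y^2\big)^{1/2}<\tau\}$ and $\eta(\tau)=\int_{B(0,\tau)}4y^a|\nabla_{\mathbb H}u|^2(x_1^2+x_2^2+y^2)\,dx\,dy$, $$\liminf_{R\to+\infty}\frac{\int_{\sqrt R}^R\frac{\eta(\tau)}{\tau^5}\,d\tau+\frac{\eta(R)}{R^4}}{\log^2R}=0.$$ Then for every $y>0$ and $c\in\mathbb R$, on the regular part $\{x\in\mathbb H: u(x,y)=c,\ \nabla_{\mathbb H}u(x,y)\ne0\}$ of the level set, one has $h\equiv0$ (it is a minimal surface in $\mathbb H$) and $$p=-\frac{\langle Hu\,v,\nu\rangle}{|\nabla_{\mathbb H}u|}.$$ -/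

import Mathlib

open MeasureTheory Filter Topology Set
open scoped NNReal ENNReal

noncomputable section

namespace Heisenberg

/-- The Heisenberg group `ℍ = ℝ³`, in the coordinates `(x₁, x₂, x₃)`. Only its left-invariant
vector fields and its Haar measure (Lebesgue measure) are used below. -/
abbrev Heis : Type := ℝ × ℝ × ℝ

/-- The open half-space `ℝ⁴₊ = ℍ × (0, ∞)`, as a subset of `ℍ × ℝ`; its points are `Z = (x, y)`. -/
def halfSpace : Set (Heis × ℝ) := {Z | 0 < Z.2}

/-- The Euclidean half-ball `B_R⁺ = B_R ∩ ℝ⁴₊`. -/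
def halfBall (R : ℝ) : Set (Heis × ℝ) :=
  {Z | 0 < Z.2 ∧ Z.1.1 ^ 2 + Z.1.2.1 ^ 2 + Z.1.2.2 ^ 2 + Z.2 ^ 2 < R ^ 2}

/-! ### Horizontal differential calculus -/

/-- The vector field `X = ∂₁ + 2 x₂ ∂₃`, acting on functions on `ℍ × ℝ`. -/
def X (u : Heis × ℝ → ℝ) (Z : Heis × ℝ) : ℝ :=
  fderiv ℝ u Z ((1, 0, 2 * Z.1.2.1), 0)

/-- The vector field `Y = ∂₂ - 2 x₁ ∂₃`, acting on functions on `ℍ × ℝ`. -/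
def Y (u : Heis × ℝ → ℝ) (Z : Heis × ℝ) : ℝ :=
  fderiv ℝ u Z ((0, 1, -2 * Z.1.1), 0)

/-- The vector field `T = [X, Y] = -4 ∂₃`, acting on functions on `ℍ × ℝ`. -/
def T (u : Heis × ℝ → ℝ) (Z : Heis × ℝ) : ℝ :=
  fderiv ℝ u Z ((0, 0, -4), 0)

/-- The derivative `∂_y` in the extension variable. -/
def Dy (u : Heis × ℝ → ℝ) (Z : Heis × ℝ) : ℝ :=
  fderiv ℝ u Z (0, 1)

/-- The intrinsic gradient `∇_ℍ u = (Xu, Yu)`, in the orthonormal frame `(X, Y)`. -/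
def gradH (u : Heis × ℝ → ℝ) (Z : Heis × ℝ) : EuclideanSpace ℝ (Fin 2) :=
  !₂[X u Z, Y u Z]

/-- The gradient `(Xu, Yu, u_y)` on `ℍ × (0, ∞)`. -/
def gradHbar (u : Heis × ℝ → ℝ) (Z : Heis × ℝ) : EuclideanSpace ℝ (Fin 3) :=
  !₂[X u Z, Y u Z, Dy u Z]

/-- The horizontal intrinsic Hessian, with rows `∇_ℍ (Xu)` and `∇_ℍ (Yu)`. -/
def hessH (u : Heis × ℝ → ℝ) (Z : Heis × ℝ) : Matrix (Fin 2) (Fin 2) ℝ :=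
  !![X (X u) Z, Y (X u) Z;
     X (Y u) Z, Y (Y u) Z]

/-! ### Geometry of the level sets `{x | u (x, y) = c}` -/

/-- The regular part `L` of the level set `S = {x | u (x, y) = c}`. -/
def regularLevelSet (u : Heis × ℝ → ℝ) (y c : ℝ) : Set Heis :=
  {x | u (x, y) = c ∧ gradH u (x, y) ≠ 0}

/-- The intrinsic normal `ν = ∇_ℍ u / |∇_ℍ u|`. -/
def normal (u : Heis × ℝ → ℝ) (Z : Heis × ℝ) : EuclideanSpace ℝ (Fin 2) :=
  ‖gradH u Z‖⁻¹ • gradH u Z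

/-- The intrinsic unit tangent `v = (Yu, -Xu) / |∇_ℍ u|`. -/
def tangent (u : Heis × ℝ → ℝ) (Z : Heis × ℝ) : EuclideanSpace ℝ (Fin 2) :=
  ‖gradH u Z‖⁻¹ • !₂[Y u Z, -X u Z]

/-- The intrinsic mean curvature `h = div_ℍ ν = X ν₁ + Y ν₂`. -/
def meanCurvature (u : Heis × ℝ → ℝ) (Z : Heis × ℝ) : ℝ :=
  X (fun W => normal u W 0) Z + Y (fun W => normal u W 1) Z

/-- The imaginary curvature `p = -Tu / |∇_ℍ u|`. -/
def imagCurvature (u : Heis × ℝ → ℝ) (Z : Heis × ℝ) : ℝ :=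
  -T u Z / ‖gradH u Z‖

/-- The derivative `Tν = (T ν₁, T ν₂)` of the intrinsic normal. -/
def Tnormal (u : Heis × ℝ → ℝ) (Z : Heis × ℝ) : EuclideanSpace ℝ (Fin 2) :=
  !₂[T (fun W => normal u W 0) Z, T (fun W => normal u W 1) Z]

/-- The vector `(Hu) v`. -/
def hessTangent (u : Heis × ℝ → ℝ) (Z : Heis × ℝ) : EuclideanSpace ℝ (Fin 2) :=
  WithLp.toLp 2 (Matrix.mulVec (hessH u Z) (tangent u Z).ofLp)

/-! ### Stable weak solutions of the boundary reaction problem -/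

/-- The boundary values `x ↦ u (x, 0⁺)` on `ℍ × {0}`. If `u` is locally Lipschitz in the open
half-space and `y^a |u_y|²` is integrable on every half-ball, where `a < 1`, then
`∫₀¹ |u_y (x, y)| dy < ∞` for almost every `x`, so that the limit exists for almost every `x`. -/
def bdry (u : Heis × ℝ → ℝ) (x : Heis) : ℝ :=
  limUnder (𝓝[>] (0 : ℝ)) (fun y => u (x, y))

/-- Admissible test functions: bounded and locally Lipschitz in the open half-space, vanishing
outside some ball, with locally finite weighted energy. (By Rademacher's theorem such a function
is differentiable almost everywhere.) -/
structure IsTestFunction (a : ℝ) (ξ : Heis × ℝ → ℝ) : Prop where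
  bounded : ∃ M : ℝ, ∀ Z ∈ halfSpace, |ξ Z| ≤ M
  locallyLipschitz : LocallyLipschitzOn halfSpace ξ
  vanish : ∃ R > 0, ∀ Z ∈ halfSpace, Z ∉ halfBall R → ξ Z = 0
  energy : ∀ R > 0, IntegrableOn (fun Z => Z.2 ^ a * ‖gradHbar ξ Z‖ ^ 2) (halfBall R)

/-- Weak solutions of `div (y^a ∇u) = 0` in `ℍ × (0, ∞)`, `-y^a u_y = f(u)` on `ℍ × {0}`, for
functions `u` of class `C¹` in the open half-space (whose weak gradient is the classical one). -/
structure IsWeakSolution (a : ℝ) (f : ℝ → ℝ) (u : Heis × ℝ → ℝ) : Prop where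
  locallyBounded : ∀ R > 0, MemLp u ∞ (volume.restrict (halfBall R))
  energy : ∀ R > 0, IntegrableOn (fun Z => Z.2 ^ a * ‖gradHbar u Z‖ ^ 2) (halfBall R)
  weak : ∀ ξ : Heis × ℝ → ℝ, IsTestFunction a ξ →
    ∫ Z in halfSpace, Z.2 ^ a * inner ℝ (gradHbar u Z) (gradHbar ξ Z) =
      ∫ x : Heis, f (bdry u x) * bdry ξ x

/-- Stability of a weak solution: the second variation is nonnegative. -/
def IsStable (a : ℝ) (f : ℝ → ℝ) (u : Heis × ℝ → ℝ) : Prop :=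
  ∀ ξ : Heis × ℝ → ℝ, IsTestFunction a ξ →
    0 ≤ (∫ Z in halfSpace, Z.2 ^ a * ‖gradHbar ξ Z‖ ^ 2) -
      ∫ x : Heis, deriv f (bdry u x) * bdry ξ x ^ 2

/-- The class `C^{1,γ}(ℝ)`: continuously differentiable, with locally `γ`-Hölder derivative. -/
def IsC1Holder (γ : ℝ≥0) (f : ℝ → ℝ) : Prop :=
  ContDiff ℝ 1 f ∧ ∀ M : ℝ, ∃ C : ℝ≥0, HolderOnWith C γ (deriv f) (Icc (-M) M)

/-! ### The weighted energy -/

/-- The gauge norm `|x| = ((x₁² + x₂²)² + x₃²)^{1/4}` on `ℍ`. -/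
def gauge (x : Heis) : ℝ :=
  ((x.1 ^ 2 + x.2.1 ^ 2) ^ 2 + x.2.2 ^ 2) ^ (1 / 4 : ℝ)

/-- The ball of radius `τ` in `ℍ × (0, ∞)` for the norm `|(x, y)| = (|x|² + y²)^{1/2}`. -/
def gaugeBall (τ : ℝ) : Set (Heis × ℝ) :=
  {Z | 0 < Z.2 ∧ Real.sqrt (gauge Z.1 ^ 2 + Z.2 ^ 2) < τ}

/-- The weighted energy `η(τ)`. -/
def weightedEnergy (a : ℝ) (u : Heis × ℝ → ℝ) (τ : ℝ) : ℝ :=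
  ∫ Z in gaugeBall τ,
    4 * Z.2 ^ a * ‖gradH u Z‖ ^ 2 * (Z.1.1 ^ 2 + Z.1.2.1 ^ 2 + Z.2 ^ 2)

end Heisenberg

end

open Heisenberg

namespace Heisenberg

noncomputable section

/-! ### Affine vector fields and derivatives along them -/

/-- The derivative of `u` along a vector field `V`. -/
def along (V : Heis × ℝ → Heis × ℝ) (u : Heis × ℝ → ℝ) (Z : Heis × ℝ) : ℝ :=
  fderiv ℝ u Z (V Z)

/-- The affine vector field `b + (α x₁ + β x₂) ∂₃`. -/
def affineField (b : Heis × ℝ) (α β : ℝ) (Z : Heis × ℝ) : Heis × ℝ :=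
  ((b.1.1, b.1.2.1, b.1.2.2 + α * Z.1.1 + β * Z.1.2.1), b.2)

/-- The frame `(X, Y, ∂_y)`. -/
def frame : Fin 3 → Heis × ℝ → Heis × ℝ :=
  ![affineField ((1, 0, 0), 0) 0 2, affineField ((0, 1, 0), 0) (-2) 0,
    affineField ((0, 0, 0), 1) 0 0]

/-- The derivatives `X, Y, ∂_y`. -/
def D (i : Fin 3) (u : Heis × ℝ → ℝ) : Heis × ℝ → ℝ := along (frame i) u

/-- The right-invariant vector field with value `q` at the origin. -/
def rightField (q : Heis) : Heis × ℝ → Heis × ℝ :=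
  affineField (q, 0) (2 * q.2.1) (-2 * q.1)

/-- The derivative along a right-invariant field. -/
def R (q : Heis) (u : Heis × ℝ → ℝ) : Heis × ℝ → ℝ := along (rightField q) u

/-- The flow of a right-invariant field, that is, the left translation by `t q`. -/
def flow (q : Heis) (t : ℝ) (Z : Heis × ℝ) : Heis × ℝ := Z + t • rightField q Z

/-- The difference quotient of `u` along the flow of a right-invariant field. -/
def quot (q : Heis) (t : ℝ) (u : Heis × ℝ → ℝ) (Z : Heis × ℝ) : ℝ :=
  t⁻¹ * (u (flow q t Z) - u Z)

lemma D_zero (u : Heis × ℝ → ℝ) : D 0 u = X u := by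
  funext Z; simp [D, along, frame, affineField, X]

lemma D_one (u : Heis × ℝ → ℝ) : D 1 u = Y u := by
  funext Z; simp [D, along, frame, affineField, Y]

lemma D_two (u : Heis × ℝ → ℝ) : D 2 u = Dy u := by
  funext Z; simp [D, along, frame, affineField, Dy]; rfl

lemma R_center (u : Heis × ℝ → ℝ) : R (0, 0, -4) u = T u := by
  funext Z; simp [R, along, rightField, affineField, T]

lemma isOpen_halfSpace : IsOpen halfSpace := isOpen_lt continuous_const continuous_snd

lemma measurableSet_halfSpace : MeasurableSet halfSpace := isOpen_halfSpace.measurableSet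

lemma isOpen_halfBall (r : ℝ) : IsOpen (halfBall r) :=
  (isOpen_lt continuous_const continuous_snd).inter
    (isOpen_lt (f := fun Z : Heis × ℝ => Z.1.1 ^ 2 + Z.1.2.1 ^ 2 + Z.1.2.2 ^ 2 + Z.2 ^ 2)
      (by fun_prop) continuous_const)

lemma measurableSet_halfBall (r : ℝ) : MeasurableSet (halfBall r) :=
  (isOpen_halfBall r).measurableSet

lemma halfBall_subset (r : ℝ) : halfBall r ⊆ halfSpace := fun _ h => h.1

lemma halfBall_mono {r r' : ℝ} (hr : 0 ≤ r) (h : r ≤ r') : halfBall r ⊆ halfBall r' :=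
  fun _ hZ => ⟨hZ.1, hZ.2.trans_le (by gcongr)⟩

/-- The linear part of `affineField`. -/
def affineFieldDeriv (α β : ℝ) : Heis × ℝ →L[ℝ] Heis × ℝ :=
  ((0 : Heis × ℝ →L[ℝ] ℝ).prod ((0 : Heis × ℝ →L[ℝ] ℝ).prod
    (α • (ContinuousLinearMap.fst ℝ ℝ (ℝ × ℝ)).comp (ContinuousLinearMap.fst ℝ Heis ℝ) +
      β • (ContinuousLinearMap.fst ℝ ℝ ℝ).comp ((ContinuousLinearMap.snd ℝ ℝ (ℝ × ℝ)).comp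
        (ContinuousLinearMap.fst ℝ Heis ℝ))))).prod 0

lemma affineField_eq (b : Heis × ℝ) (α β : ℝ) :
    affineField b α β = fun Z => b + affineFieldDeriv α β Z := by
  funext Z
  ext <;> simp [affineField, affineFieldDeriv]
  ring

lemma contDiff_affineField {n : WithTop ℕ∞} (b : Heis × ℝ) (α β : ℝ) :
    ContDiff ℝ n (affineField b α β) := by
  rw [affineField_eq]
  exact contDiff_const.add (affineFieldDeriv α β).contDiff

lemma hasFDerivAt_affineField (b : Heis × ℝ) (α β : ℝ) (Z : Heis × ℝ) :
    HasFDerivAt (affineField b α β) (affineFieldDeriv α β) Z := by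
  rw [affineField_eq]
  exact (affineFieldDeriv α β).hasFDerivAt.const_add b

lemma affineFieldDeriv_apply (α β : ℝ) (Z : Heis × ℝ) :
    affineFieldDeriv α β Z = ((0, 0, α * Z.1.1 + β * Z.1.2.1), 0) := by
  simp [affineFieldDeriv]

lemma contDiff_frame {n : WithTop ℕ∞} (i : Fin 3) : ContDiff ℝ n (frame i) := by
  fin_cases i <;> exact contDiff_affineField _ _ _

lemma contDiff_rightField {n : WithTop ℕ∞} (q : Heis) : ContDiff ℝ n (rightField q) :=
  contDiff_affineField _ _ _

section Regularity

variable {u w : Heis × ℝ → ℝ} {V W : Heis × ℝ → Heis × ℝ} {Z : Heis × ℝ} {n : WithTop ℕ∞}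

lemma contDiffAt_of_mem (hu : ContDiffOn ℝ n u halfSpace) (hZ : Z ∈ halfSpace) :
    ContDiffAt ℝ n u Z := hu.contDiffAt (isOpen_halfSpace.mem_nhds hZ)

lemma differentiableAt_of_mem (hu : ContDiffOn ℝ 1 u halfSpace) (hZ : Z ∈ halfSpace) :
    DifferentiableAt ℝ u Z := (contDiffAt_of_mem hu hZ).differentiableAt one_ne_zero

lemma continuousOn_along (hu : ContDiffOn ℝ 1 u halfSpace) (hV : Continuous V) :
    ContinuousOn (along V u) halfSpace :=
  (hu.continuousOn_fderiv_of_isOpen isOpen_halfSpace le_rfl).clm_apply hV.continuousOn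

lemma contDiffOn_along (hu : ContDiffOn ℝ 2 u halfSpace) (hV : ContDiff ℝ 1 V) :
    ContDiffOn ℝ 1 (along V u) halfSpace :=
  (hu.fderiv_of_isOpen isOpen_halfSpace (m := 1) (by norm_num)).clm_apply hV.contDiffOn

lemma continuousOn_D (hu : ContDiffOn ℝ 1 u halfSpace) (i : Fin 3) :
    ContinuousOn (D i u) halfSpace := continuousOn_along hu (contDiff_frame (n := 1) i).continuous

lemma contDiffOn_D (hu : ContDiffOn ℝ 2 u halfSpace) (i : Fin 3) :
    ContDiffOn ℝ 1 (D i u) halfSpace := contDiffOn_along hu (contDiff_frame i)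

lemma contDiffOn_R (hu : ContDiffOn ℝ 2 u halfSpace) (q : Heis) :
    ContDiffOn ℝ 1 (R q u) halfSpace := contDiffOn_along hu (contDiff_rightField q)

lemma continuousOn_R (hu : ContDiffOn ℝ 1 u halfSpace) (q : Heis) :
    ContinuousOn (R q u) halfSpace :=
  continuousOn_along hu (contDiff_rightField (n := 1) q).continuous

lemma along_add (hu : DifferentiableAt ℝ u Z) (hw : DifferentiableAt ℝ w Z) :
    along V (fun Z => u Z + w Z) Z = along V u Z + along V w Z := by
  simp [along, fderiv_fun_add hu hw]

lemma along_sub (hu : DifferentiableAt ℝ u Z) (hw : DifferentiableAt ℝ w Z) :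
    along V (fun Z => u Z - w Z) Z = along V u Z - along V w Z := by
  simp [along, fderiv_fun_sub hu hw]

lemma along_mul (hu : DifferentiableAt ℝ u Z) (hw : DifferentiableAt ℝ w Z) :
    along V (fun Z => u Z * w Z) Z = u Z * along V w Z + along V u Z * w Z := by
  simp [along, fderiv_fun_mul hu hw]; ring

lemma along_const_mul (c : ℝ) (hu : DifferentiableAt ℝ u Z) :
    along V (fun Z => c * u Z) Z = c * along V u Z := by
  simp [along, fderiv_const_mul hu]

lemma along_comp {g : ℝ → ℝ} {g' : ℝ} (hg : HasDerivAt g g' (u Z))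
    (hu : DifferentiableAt ℝ u Z) :
    along V (fun Z => g (u Z)) Z = g' * along V u Z := by
  have := (hg.hasFDerivAt.comp Z hu.hasFDerivAt).fderiv
  simp only [along]
  rw [show (fun Z => g (u Z)) = g ∘ u from rfl, this]
  simp [mul_comm]

lemma along_congr (h : u =ᶠ[𝓝 Z] w) : along V u Z = along V w Z := by
  simp [along, h.fderiv_eq]

lemma along_eq_zero_of_eqOn {U : Set (Heis × ℝ)} (hU : IsOpen U) (h : ∀ Z ∈ U, u Z = 0)
    (hZ : Z ∈ U) : along V u Z = 0 := by
  have : u =ᶠ[𝓝 Z] fun _ => (0 : ℝ) := by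
    filter_upwards [hU.mem_nhds hZ] with Z' hZ' using h Z' hZ'
  rw [along_congr this]; simp [along]

/-- The commutator of the derivatives along two affine fields. -/
lemma along_comm (hu : ContDiffOn ℝ 2 u halfSpace) (hZ : Z ∈ halfSpace)
    (b b' : Heis × ℝ) (α β α' β' : ℝ) :
    along (affineField b α β) (along (affineField b' α' β') u) Z -
      along (affineField b' α' β') (along (affineField b α β) u) Z =
    (α' * b.1.1 + β' * b.1.2.1 - α * b'.1.1 - β * b'.1.2.1) *
      fderiv ℝ u Z ((0, 0, 1), 0) := by
  have h := VectorField.fderiv_apply_lieBracket (contDiffAt_of_mem hu hZ) (by simp)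
    (hasFDerivAt_affineField b' α' β' Z).differentiableAt
    (hasFDerivAt_affineField b α β Z).differentiableAt
  unfold along
  rw [← h, VectorField.lieBracket, (hasFDerivAt_affineField b α β Z).fderiv,
    (hasFDerivAt_affineField b' α' β' Z).fderiv, ← smul_eq_mul, ← map_smul]
  congr 1
  simp only [affineFieldDeriv_apply, affineField]
  ext <;> simp
  ring

lemma D_R_comm (hu : ContDiffOn ℝ 2 u halfSpace) (hZ : Z ∈ halfSpace) (q : Heis) (i : Fin 3) :
    D i (R q u) Z = R q (D i u) Z := by
  have key : ∀ b α β, (2 * q.2.1 * b.1.1 + -2 * q.1 * b.1.2.1 - α * q.1 - β * q.2.1 = 0) →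
      along (affineField b α β) (R q u) Z = R q (along (affineField b α β) u) Z := by
    intro b α β h
    have := along_comm hu hZ b (q, 0) α β (2 * q.2.1) (-2 * q.1)
    simp only [h, zero_mul] at this
    exact sub_eq_zero.1 this
  fin_cases i
  · exact key _ _ _ (by simp)
  · exact key _ _ _ (by simp)
  · exact key _ _ _ (by simp)

lemma commutator_X_Y (hu : ContDiffOn ℝ 2 u halfSpace) (hZ : Z ∈ halfSpace) :
    D 0 (D 1 u) Z - D 1 (D 0 u) Z = R (0, 0, -4) u Z := by
  have := along_comm hu hZ ((1, 0, 0), 0) ((0, 1, 0), 0) 0 2 (-2) 0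
  refine this.trans ?_
  rw [R_center, T, ← smul_eq_mul, ← map_smul]
  congr 1
  ext <;> simp
  norm_num

end Regularity

/-! ### Left translations -/

lemma flow_eq (q : Heis) (t : ℝ) (Z : Heis × ℝ) :
    flow q t Z = ((Z.1.1 + t * q.1, Z.1.2.1 + t * q.2.1,
      Z.1.2.2 + t * (q.2.2 + 2 * q.2.1 * Z.1.1 + -2 * q.1 * Z.1.2.1)), Z.2) := by
  ext <;> simp [flow, rightField, affineField]

lemma flow_snd (q : Heis) (t : ℝ) (Z : Heis × ℝ) : (flow q t Z).2 = Z.2 := by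
  simp [flow_eq]

lemma flow_mem_halfSpace {q : Heis} {t : ℝ} {Z : Heis × ℝ} :
    flow q t Z ∈ halfSpace ↔ Z ∈ halfSpace := by
  simp [halfSpace, flow_snd]

lemma flow_add (q : Heis) (s t : ℝ) (Z : Heis × ℝ) :
    flow q s (flow q t Z) = flow q (s + t) Z := by
  simp only [flow_eq]
  ext <;> simp <;> ring

lemma flow_zero (q : Heis) (Z : Heis × ℝ) : flow q 0 Z = Z := by simp [flow]

lemma flow_neg_flow (q : Heis) (t : ℝ) (Z : Heis × ℝ) : flow q (-t) (flow q t Z) = Z := by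
  rw [flow_add, neg_add_cancel, flow_zero]

lemma flow_flow_neg (q : Heis) (t : ℝ) (Z : Heis × ℝ) : flow q t (flow q (-t) Z) = Z := by
  rw [flow_add, add_neg_cancel, flow_zero]

lemma continuous_flow_uncurry (q : Heis) :
    Continuous (fun p : ℝ × (Heis × ℝ) => flow q p.1 p.2) := by
  simp only [flow_eq]; fun_prop

lemma contDiff_flow {n : WithTop ℕ∞} (q : Heis) (t : ℝ) : ContDiff ℝ n (flow q t) :=
  contDiff_id.add ((contDiff_rightField q).const_smul t)

lemma hasFDerivAt_flow (q : Heis) (t : ℝ) (Z : Heis × ℝ) :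
    HasFDerivAt (flow q t) (ContinuousLinearMap.id ℝ (Heis × ℝ) +
      t • affineFieldDeriv (2 * q.2.1) (-2 * q.1)) Z :=
  (hasFDerivAt_id Z).add ((hasFDerivAt_affineField _ _ _ Z).const_smul t)

lemma contDiffOn_comp_flow {n : WithTop ℕ∞} {u : Heis × ℝ → ℝ} (hu : ContDiffOn ℝ n u halfSpace)
    (q : Heis) (t : ℝ) : ContDiffOn ℝ n (fun Z => u (flow q t Z)) halfSpace :=
  hu.comp (contDiff_flow q t).contDiffOn (fun _ hZ => flow_mem_halfSpace.2 hZ)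

lemma continuousOn_comp_flow {u : Heis × ℝ → ℝ} (hu : ContinuousOn u halfSpace)
    (q : Heis) (t : ℝ) : ContinuousOn (fun Z => u (flow q t Z)) halfSpace :=
  hu.comp (contDiff_flow (n := 0) q t).continuous.continuousOn
    (fun _ hZ => flow_mem_halfSpace.2 hZ)

lemma D_comp_flow {u : Heis × ℝ → ℝ} (hu : ContDiffOn ℝ 1 u halfSpace) (q : Heis) (t : ℝ)
    {Z : Heis × ℝ} (hZ : Z ∈ halfSpace) (i : Fin 3) :
    D i (fun Z => u (flow q t Z)) Z = D i u (flow q t Z) := by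
  have h := ((differentiableAt_of_mem hu (flow_mem_halfSpace.2 hZ)).hasFDerivAt.comp Z
    (hasFDerivAt_flow q t Z)).fderiv
  unfold D along
  rw [show (fun Z => u (flow q t Z)) = u ∘ flow q t from rfl, h, ContinuousLinearMap.comp_apply]
  congr 1
  fin_cases i <;>
    simp [frame, affineField, flow_eq, affineFieldDeriv_apply] <;> ring

lemma hasDerivAt_flow {u : Heis × ℝ → ℝ} (hu : ContDiffOn ℝ 1 u halfSpace) (q : Heis) (t : ℝ)
    {Z : Heis × ℝ} (hZ : Z ∈ halfSpace) :
    HasDerivAt (fun s => u (flow q s Z)) (R q u (flow q t Z)) t := by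
  have h1 : HasDerivAt (fun s => flow q s Z) (rightField q (flow q t Z)) t := by
    have : HasDerivAt (fun s : ℝ => Z + s • rightField q Z) ((1 : ℝ) • rightField q Z) t :=
      ((hasDerivAt_id t).smul_const _).const_add Z
    refine this.congr_deriv ?_
    rw [one_smul, flow_eq]
    ext <;> simp [rightField, affineField]
    ring
  exact (differentiableAt_of_mem hu (flow_mem_halfSpace.2 hZ)).hasFDerivAt.comp_hasDerivAt t h1

lemma contDiffOn_quot {n : WithTop ℕ∞} {u : Heis × ℝ → ℝ} (hu : ContDiffOn ℝ n u halfSpace)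
    (q : Heis) (t : ℝ) : ContDiffOn ℝ n (quot q t u) halfSpace :=
  contDiffOn_const.mul ((contDiffOn_comp_flow hu q t).sub hu)

lemma D_quot {u : Heis × ℝ → ℝ} (hu : ContDiffOn ℝ 1 u halfSpace) (q : Heis) (t : ℝ)
    {Z : Heis × ℝ} (hZ : Z ∈ halfSpace) (i : Fin 3) :
    D i (quot q t u) Z = quot q t (D i u) Z := by
  have h1 := differentiableAt_of_mem (contDiffOn_comp_flow hu q t) hZ
  have h2 := differentiableAt_of_mem hu hZ
  rw [D, show quot q t u = fun Z => t⁻¹ * (u (flow q t Z) - u Z) from rfl,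
    along_const_mul _ (by exact h1.sub h2), along_sub h1 h2]
  change t⁻¹ * (D i (fun Z => u (flow q t Z)) Z - D i u Z) = _
  rw [D_comp_flow hu q t hZ, quot]

lemma quot_eq_integral {u : Heis × ℝ → ℝ} (hu : ContDiffOn ℝ 1 u halfSpace) (q : Heis) (t : ℝ)
    {Z : Heis × ℝ} (hZ : Z ∈ halfSpace) :
    quot q t u Z = t⁻¹ * ∫ s in (0 : ℝ)..t, R q u (flow q s Z) := by
  rw [intervalIntegral.integral_eq_sub_of_hasDerivAt
    (fun s _ => hasDerivAt_flow hu q s hZ), flow_zero, quot]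
  apply ContinuousOn.intervalIntegrable
  refine (continuousOn_R hu q).comp (f := fun s => flow q s Z) ?_
    (fun s _ => flow_mem_halfSpace.2 hZ)
  exact ((continuous_flow_uncurry q).comp
    (by fun_prop : Continuous fun s : ℝ => (s, Z))).continuousOn

lemma tendsto_quot {u : Heis × ℝ → ℝ} (hu : ContDiffOn ℝ 1 u halfSpace) (q : Heis)
    {Z : Heis × ℝ} (hZ : Z ∈ halfSpace) :
    Tendsto (fun t => quot q t u Z) (𝓝[≠] 0) (𝓝 (R q u Z)) := by
  have := (hasDerivAt_flow hu q 0 hZ).tendsto_slope_zero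
  simpa [flow_zero, quot] using this

end

end Heisenberg

namespace Heisenberg

noncomputable section

/-! ### The weighted measure -/

/-- The measure `y^a dy` on `(0, ∞)`. -/
def weightMeasure (a : ℝ) : Measure ℝ :=
  (volume.restrict (Ioi 0)).withDensity fun y => ENNReal.ofReal (y ^ a)

/-- The measure `y^a dx dy` on `ℍ × (0, ∞)`. -/
def μ (a : ℝ) : Measure (Heis × ℝ) := (volume : Measure Heis).prod (weightMeasure a)

lemma measurable_weight (a : ℝ) : Measurable fun y : ℝ => ENNReal.ofReal (y ^ a) := by fun_prop

instance (a : ℝ) : SFinite (weightMeasure a) := by unfold weightMeasure; infer_instance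

instance (a : ℝ) : SFinite (μ a) := by unfold μ; infer_instance

lemma μ_eq (a : ℝ) :
    μ a = (volume.restrict halfSpace).withDensity fun Z => ENNReal.ofReal (Z.2 ^ a) := by
  have h : halfSpace = (univ : Set Heis) ×ˢ Ioi (0 : ℝ) := by ext; simp [halfSpace]
  rw [μ, weightMeasure, prod_withDensity_right (measurable_weight a), h,
    show (volume : Measure (Heis × ℝ)) = (volume : Measure Heis).prod (volume : Measure ℝ) from rfl,
    ← Measure.prod_restrict, Measure.restrict_univ]

lemma ae_weightMeasure (a : ℝ) : ∀ᵐ y ∂(weightMeasure a), 0 < y :=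
  (withDensity_absolutelyContinuous _ _).ae_le (ae_restrict_mem measurableSet_Ioi)

lemma ae_mem_halfSpace (a : ℝ) : ∀ᵐ Z ∂(μ a), Z ∈ halfSpace := by
  rw [μ_eq]
  exact (withDensity_absolutelyContinuous _ _).ae_le (ae_restrict_mem measurableSet_halfSpace)

lemma μ_restrict_halfSpace (a : ℝ) : (μ a).restrict halfSpace = μ a :=
  Measure.restrict_eq_self_of_ae_mem (ae_mem_halfSpace a)

lemma integral_weightMeasure (a : ℝ) (F : ℝ → ℝ) :
    ∫ y, F y ∂(weightMeasure a) = ∫ y in Ioi 0, y ^ a * F y := by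
  rw [weightMeasure, integral_withDensity_eq_integral_toReal_smul (measurable_weight a) (by simp)]
  refine setIntegral_congr_fun measurableSet_Ioi fun y hy => ?_
  simp [ENNReal.toReal_ofReal (Real.rpow_nonneg (le_of_lt hy) a)]

lemma integrable_weightMeasure_iff (a : ℝ) (F : ℝ → ℝ) :
    Integrable F (weightMeasure a) ↔ IntegrableOn (fun y => y ^ a * F y) (Ioi 0) := by
  rw [weightMeasure, integrable_withDensity_iff_integrable_smul' (measurable_weight a) (by simp)]
  refine integrableOn_congr_fun (fun y hy => ?_) measurableSet_Ioi
  simp [ENNReal.toReal_ofReal (Real.rpow_nonneg (le_of_lt hy) a)]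

lemma setIntegral_μ (a : ℝ) (F : Heis × ℝ → ℝ) {S : Set (Heis × ℝ)} (hS : MeasurableSet S)
    (h : S ⊆ halfSpace) : ∫ Z in S, F Z ∂(μ a) = ∫ Z in S, Z.2 ^ a * F Z := by
  rw [μ_eq, restrict_withDensity hS, Measure.restrict_restrict hS, inter_eq_left.2 h,
    integral_withDensity_eq_integral_toReal_smul (by fun_prop) (by simp)]
  refine setIntegral_congr_fun hS fun Z hZ => ?_
  simp [ENNReal.toReal_ofReal (Real.rpow_nonneg (le_of_lt (h hZ)) a)]

lemma integral_μ (a : ℝ) (F : Heis × ℝ → ℝ) :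
    ∫ Z, F Z ∂(μ a) = ∫ Z in halfSpace, Z.2 ^ a * F Z := by
  rw [← setIntegral_μ a F measurableSet_halfSpace subset_rfl, μ_restrict_halfSpace]

lemma integrableOn_μ_iff (a : ℝ) (F : Heis × ℝ → ℝ) {S : Set (Heis × ℝ)} (hS : MeasurableSet S)
    (h : S ⊆ halfSpace) : IntegrableOn F S (μ a) ↔ IntegrableOn (fun Z => Z.2 ^ a * F Z) S := by
  rw [IntegrableOn, μ_eq, restrict_withDensity hS, Measure.restrict_restrict hS,
    inter_eq_left.2 h, integrable_withDensity_iff_integrable_smul' (by fun_prop) (by simp)]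
  refine integrableOn_congr_fun (fun Z hZ => ?_) hS
  simp [ENNReal.toReal_ofReal (Real.rpow_nonneg (le_of_lt (h hZ)) a)]

lemma aestronglyMeasurable_of_continuousOn {p : Heis × ℝ → ℝ} (hp : ContinuousOn p halfSpace)
    (a : ℝ) : AEStronglyMeasurable p (μ a) := by
  rw [← μ_restrict_halfSpace]
  exact hp.aestronglyMeasurable measurableSet_halfSpace

lemma weightMeasure_Iio_lt_top {a : ℝ} (ha : -1 < a) (r : ℝ) : weightMeasure a (Iio r) < ∞ := by
  rw [weightMeasure, withDensity_apply _ measurableSet_Iio,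
    Measure.restrict_restrict measurableSet_Iio]
  have h : IntegrableOn (fun y : ℝ => y ^ a) (Iio r ∩ Ioi 0) := by
    rcases le_or_gt r 0 with hr | hr
    · have : Iio r ∩ Ioi 0 = ∅ := by
        ext y; simp only [mem_inter_iff, mem_Iio, mem_Ioi, mem_empty_iff_false, iff_false]
        intro h; linarith [h.1, h.2]
      rw [this]; exact integrableOn_empty
    · have := (intervalIntegral.intervalIntegrable_rpow' (a := 0) (b := r) ha).1
      exact this.mono_set fun y hy => ⟨hy.2, hy.1.le⟩
  refine lt_of_le_of_lt (lintegral_mono fun y => ?_) h.2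
  exact Real.ofReal_le_enorm _

lemma halfBall_subset_prod (r : ℝ) :
    halfBall r ⊆ (Icc (-|r|) |r| ×ˢ Icc (-|r|) |r| ×ˢ Icc (-|r|) |r|) ×ˢ (Iio (|r| + 1)) := by
  rintro ⟨⟨x, y, z⟩, w⟩ ⟨h0, h⟩
  simp only at h0 h
  rw [← sq_abs r] at h
  have hx : |x| ≤ |r| := abs_le_of_sq_le_sq
    (by nlinarith [sq_nonneg y, sq_nonneg z, sq_nonneg w]) (abs_nonneg r)
  have hy : |y| ≤ |r| := abs_le_of_sq_le_sq
    (by nlinarith [sq_nonneg x, sq_nonneg z, sq_nonneg w]) (abs_nonneg r)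
  have hz : |z| ≤ |r| := abs_le_of_sq_le_sq
    (by nlinarith [sq_nonneg y, sq_nonneg x, sq_nonneg w]) (abs_nonneg r)
  have hw : |w| ≤ |r| := abs_le_of_sq_le_sq
    (by nlinarith [sq_nonneg y, sq_nonneg z, sq_nonneg x]) (abs_nonneg r)
  have hw' : w ≤ |r| := (le_abs_self w).trans hw
  exact ⟨⟨abs_le.1 hx, abs_le.1 hy, abs_le.1 hz⟩, by simp; linarith⟩

lemma μ_halfBall_lt_top {a : ℝ} (ha : -1 < a) (r : ℝ) : μ a (halfBall r) < ∞ := by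
  refine (measure_mono (halfBall_subset_prod r)).trans_lt ?_
  rw [μ, Measure.prod_prod]
  refine ENNReal.mul_lt_top ?_ (weightMeasure_Iio_lt_top ha _)
  exact (isCompact_Icc.prod (isCompact_Icc.prod isCompact_Icc)).measure_lt_top

/-! ### Left translations preserve the measure -/

/-- The left translation by `t q` on `ℍ`. -/
def flowBase (q : Heis) (t : ℝ) (x : Heis) : Heis :=
  (x.1 + t * q.1, x.2.1 + t * q.2.1, x.2.2 + t * (q.2.2 + 2 * q.2.1 * x.1 + -2 * q.1 * x.2.1))

lemma flow_mk (q : Heis) (t : ℝ) (x : Heis) (y : ℝ) :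
    flow q t (x, y) = (flowBase q t x, y) := flow_eq q t (x, y)

lemma continuous_flowBase (q : Heis) (t : ℝ) : Continuous (flowBase q t) := by
  unfold flowBase; fun_prop

lemma measurePreserving_flowBase (q : Heis) (t : ℝ) :
    MeasurePreserving (flowBase q t) volume volume := by
  have h2 (x₁ : ℝ) : MeasurePreserving (fun x' : ℝ × ℝ => (x'.1 + t * q.2.1,
      x'.2 + t * (q.2.2 + 2 * q.2.1 * x₁ + -2 * q.1 * x'.1))) := by
    refine (measurePreserving_add_right (volume : Measure ℝ) (t * q.2.1)).skew_product
      (g := fun x₂ x₃ => x₃ + t * (q.2.2 + 2 * q.2.1 * x₁ + -2 * q.1 * x₂)) ?_ ?_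
    · simp only [Function.uncurry_def]; fun_prop
    · exact ae_of_all _ fun x₂ => (measurePreserving_add_right volume _).map_eq
  refine (measurePreserving_add_right (volume : Measure ℝ) (t * q.1)).skew_product
    (g := fun x₁ (x' : ℝ × ℝ) => (x'.1 + t * q.2.1,
      x'.2 + t * (q.2.2 + 2 * q.2.1 * x₁ + -2 * q.1 * x'.1))) ?_ ?_
  · simp only [Function.uncurry_def]; fun_prop
  · exact ae_of_all _ fun x₁ => (h2 x₁).map_eq

lemma measurePreserving_flow (a : ℝ) (q : Heis) (t : ℝ) :
    MeasurePreserving (flow q t) (μ a) (μ a) := by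
  have h : flow q t = Prod.map (flowBase q t) id := by
    funext Z; exact flow_eq q t Z
  rw [h]
  exact (measurePreserving_flowBase q t).prod (MeasurePreserving.id _)

/-- The left translation by `t q` as a homeomorphism. -/
def flowHomeo (q : Heis) (t : ℝ) : Heis × ℝ ≃ₜ Heis × ℝ where
  toFun := flow q t
  invFun := flow q (-t)
  left_inv := flow_neg_flow q t
  right_inv := flow_flow_neg q t
  continuous_toFun := (contDiff_flow (n := 0) q t).continuous
  continuous_invFun := (contDiff_flow (n := 0) q (-t)).continuous

lemma integral_comp_flow (a : ℝ) (q : Heis) (t : ℝ) (F : Heis × ℝ → ℝ) :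
    ∫ Z, F (flow q t Z) ∂(μ a) = ∫ Z, F Z ∂(μ a) :=
  (measurePreserving_flow a q t).integral_comp (flowHomeo q t).measurableEmbedding F

lemma flowBase_neg_flowBase (q : Heis) (t : ℝ) (x : Heis) :
    flowBase q (-t) (flowBase q t x) = x := by
  have := flow_neg_flow q t (x, 0)
  simpa [flow_mk] using this

lemma flowBase_flowBase_neg (q : Heis) (t : ℝ) (x : Heis) :
    flowBase q t (flowBase q (-t) x) = x := by
  have := flow_flow_neg q t (x, 0)
  simpa [flow_mk] using this

/-- The left translation by `t q` as a homeomorphism of `ℍ`. -/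
def flowBaseHomeo (q : Heis) (t : ℝ) : Heis ≃ₜ Heis where
  toFun := flowBase q t
  invFun := flowBase q (-t)
  left_inv := flowBase_neg_flowBase q t
  right_inv := flowBase_flowBase_neg q t
  continuous_toFun := continuous_flowBase q t
  continuous_invFun := continuous_flowBase q (-t)

lemma integral_comp_flowBase (q : Heis) (t : ℝ) (F : Heis → ℝ) :
    ∫ x, F (flowBase q t x) = ∫ x, F x :=
  (measurePreserving_flowBase q t).integral_comp (flowBaseHomeo q t).measurableEmbedding F

/-- Left translations by bounded times map half-balls into half-balls. -/
lemma exists_flow_halfBall (q : Heis) (r : ℝ) :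
    ∃ r' > 0, ∀ t : ℝ, |t| ≤ 1 → ∀ Z ∈ halfBall r, flow q t Z ∈ halfBall r' := by
  let g : ℝ × (Heis × ℝ) → ℝ := fun p => (flow q p.1 p.2).1.1 ^ 2 + (flow q p.1 p.2).1.2.1 ^ 2 +
    (flow q p.1 p.2).1.2.2 ^ 2 + (flow q p.1 p.2).2 ^ 2
  have hg : Continuous g := by have := continuous_flow_uncurry q; fun_prop
  have hK : IsCompact (Icc (-1 : ℝ) 1 ×ˢ
      ((Icc (-|r|) |r| ×ˢ Icc (-|r|) |r| ×ˢ Icc (-|r|) |r|) ×ˢ (Icc 0 (|r| + 1)))) :=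
    isCompact_Icc.prod ((isCompact_Icc.prod (isCompact_Icc.prod isCompact_Icc)).prod isCompact_Icc)
  obtain ⟨C, hC⟩ := hK.exists_bound_of_continuousOn hg.continuousOn
  refine ⟨|C| + 1, by positivity, fun t ht Z hZ => ⟨flow_mem_halfSpace.2 hZ.1, ?_⟩⟩
  have h1 := halfBall_subset_prod r hZ
  have h2 := hC (t, Z) ⟨abs_le.1 ht, h1.1, hZ.1.le, (le_of_lt h1.2)⟩
  have h3 : g (t, Z) ≤ |C| := (le_abs_self _).trans (h2.trans (le_abs_self _))
  refine lt_of_le_of_lt h3 ?_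
  nlinarith [abs_nonneg C]

/-! ### Local square integrability up to the boundary -/

/-- Local boundedness up to the boundary, for functions continuous in the open half-space. -/
structure LocBdd (b : Heis × ℝ → ℝ) : Prop where
  continuousOn : ContinuousOn b halfSpace
  bound : ∀ r, ∃ C, ∀ Z ∈ halfBall r, |b Z| ≤ C

/-- Local square integrability up to the boundary, for functions continuous in the open
half-space. -/
structure LocSq (a : ℝ) (p : Heis × ℝ → ℝ) : Prop where
  continuousOn : ContinuousOn p halfSpace
  memLp : ∀ r, MemLp p 2 ((μ a).restrict (halfBall r))

/-- `p` vanishes in the half-space off some half-ball. -/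
def BddSupp (p : Heis × ℝ → ℝ) : Prop :=
  ∃ r > 0, ∀ Z ∈ halfSpace, Z ∉ halfBall r → p Z = 0

variable {a : ℝ} {p q b w : Heis × ℝ → ℝ}

lemma LocBdd.of_continuous (hb : Continuous b) : LocBdd b := by
  refine ⟨hb.continuousOn, fun r => ?_⟩
  have hK : IsCompact ((Icc (-|r|) |r| ×ˢ Icc (-|r|) |r| ×ˢ Icc (-|r|) |r|) ×ˢ (Icc 0 (|r| + 1))) :=
    (isCompact_Icc.prod (isCompact_Icc.prod isCompact_Icc)).prod isCompact_Icc
  obtain ⟨C, hC⟩ := hK.exists_bound_of_continuousOn hb.continuousOn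
  refine ⟨C, fun Z hZ => hC Z ?_⟩
  have h1 := halfBall_subset_prod r hZ
  exact ⟨h1.1, hZ.1.le, (le_of_lt h1.2)⟩

lemma LocBdd.mul (hb : LocBdd b) (hp : LocBdd p) : LocBdd fun Z => b Z * p Z := by
  refine ⟨hb.continuousOn.mul hp.continuousOn, fun r => ?_⟩
  obtain ⟨C, hC⟩ := hb.bound r
  obtain ⟨C', hC'⟩ := hp.bound r
  refine ⟨C * C', fun Z hZ => ?_⟩
  rw [abs_mul]
  exact mul_le_mul (hC Z hZ) (hC' Z hZ) (abs_nonneg _) ((abs_nonneg _).trans (hC Z hZ))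

lemma LocSq.aesm (hp : LocSq a p) : AEStronglyMeasurable p (μ a) :=
  aestronglyMeasurable_of_continuousOn hp.continuousOn a

lemma LocSq.mono (hp : LocSq a p) (hq : ContinuousOn q halfSpace)
    (h : ∀ Z ∈ halfSpace, |q Z| ≤ |p Z|) : LocSq a q := by
  refine ⟨hq, fun r => (hp.memLp r).mono
    (aestronglyMeasurable_of_continuousOn hq a).restrict ?_⟩
  filter_upwards [ae_restrict_mem (measurableSet_halfBall r)] with Z hZ using h Z hZ.1

lemma LocSq.congr (hp : LocSq a p) (h : ∀ Z ∈ halfSpace, q Z = p Z) : LocSq a q :=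
  hp.mono (hp.continuousOn.congr h) fun Z hZ => by rw [h Z hZ]

lemma LocSq.add (hp : LocSq a p) (hq : LocSq a q) : LocSq a fun Z => p Z + q Z :=
  ⟨hp.continuousOn.add hq.continuousOn, fun r => (hp.memLp r).add (hq.memLp r)⟩

lemma LocSq.sub (hp : LocSq a p) (hq : LocSq a q) : LocSq a fun Z => p Z - q Z :=
  ⟨hp.continuousOn.sub hq.continuousOn, fun r => (hp.memLp r).sub (hq.memLp r)⟩

lemma LocSq.const_mul (hp : LocSq a p) (c : ℝ) : LocSq a fun Z => c * p Z :=
  ⟨continuousOn_const.mul hp.continuousOn, fun r => (hp.memLp r).const_mul c⟩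

lemma LocSq.bdd_mul (hp : LocSq a p) (hb : LocBdd b) : LocSq a fun Z => b Z * p Z := by
  refine ⟨hb.continuousOn.mul hp.continuousOn, fun r => ?_⟩
  obtain ⟨C, hC⟩ := hb.bound r
  refine ((hp.memLp r).const_mul C).mono
    ((aestronglyMeasurable_of_continuousOn hb.continuousOn a).restrict.mul
      (hp.memLp r).aestronglyMeasurable) ?_
  filter_upwards [ae_restrict_mem (measurableSet_halfBall r)] with Z hZ
  rw [norm_mul, norm_mul]
  gcongr
  exact (hC Z hZ).trans (le_abs_self C)

lemma LocSq.mul_bdd (hp : LocSq a p) (hb : LocBdd b) : LocSq a fun Z => p Z * b Z := by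
  simpa only [mul_comm] using hp.bdd_mul hb

lemma LocBdd.locSq (ha : -1 < a) (hb : LocBdd b) : LocSq a b := by
  refine ⟨hb.continuousOn, fun r => ?_⟩
  have : IsFiniteMeasure ((μ a).restrict (halfBall r)) :=
    ⟨by simpa using μ_halfBall_lt_top ha r⟩
  obtain ⟨C, hC⟩ := hb.bound r
  refine MemLp.of_bound (aestronglyMeasurable_of_continuousOn hb.continuousOn a).restrict C ?_
  filter_upwards [ae_restrict_mem (measurableSet_halfBall r)] with Z hZ using hC Z hZ

lemma locSq_of_integrableOn (hp : ContinuousOn p halfSpace)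
    (h : ∀ r > 0, IntegrableOn (fun Z => Z.2 ^ a * p Z ^ 2) (halfBall r)) : LocSq a p := by
  refine ⟨hp, fun r => ?_⟩
  have h1 := (integrableOn_μ_iff a (fun Z => p Z ^ 2) (measurableSet_halfBall _)
    (halfBall_subset _)).2 (h (|r| + 1) (by positivity))
  have h2 : halfBall r ⊆ halfBall (|r| + 1) := fun Z hZ => ⟨hZ.1, hZ.2.trans_le (by
    rw [← sq_abs r]; gcongr; linarith)⟩
  exact (memLp_two_iff_integrable_sq
    (aestronglyMeasurable_of_continuousOn hp a).restrict).2 (h1.mono_set h2)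

lemma LocSq.comp_flow (hp : LocSq a p) (e : Heis) (t : ℝ) :
    LocSq a fun Z => p (flow e t Z) := by
  refine ⟨continuousOn_comp_flow hp.continuousOn e t, fun r => ?_⟩
  obtain ⟨r', -, h⟩ := exists_flow_halfBall (t • e) r
  have hflow : ∀ Z, flow (t • e) 1 Z = flow e t Z := fun Z => by
    simp only [flow_eq]
    ext <;> simp
    ring
  have h1 : MemLp ((halfBall r').indicator p) 2 (μ a) :=
    (memLp_indicator_iff_restrict (measurableSet_halfBall r')).2 (hp.memLp r')
  have h2 := (h1.comp_measurePreserving (measurePreserving_flow a e t)).restrict (halfBall r)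
  refine (memLp_congr_ae ?_).1 h2
  filter_upwards [ae_restrict_mem (measurableSet_halfBall r)] with Z hZ
  have := h 1 (by simp) Z hZ
  rw [hflow] at this
  simp [indicator_of_mem this]

lemma LocSq.quot (hp : LocSq a p) (e : Heis) (t : ℝ) : LocSq a (quot e t p) :=
  ((hp.comp_flow e t).sub hp).const_mul t⁻¹

lemma LocSq.memLp_of_bddSupp (hp : LocSq a p) (h : BddSupp p) : MemLp p 2 (μ a) := by
  obtain ⟨r, -, hr⟩ := h
  have h1 : MemLp ((halfBall r).indicator p) 2 (μ a) :=
    (memLp_indicator_iff_restrict (measurableSet_halfBall r)).2 (hp.memLp r)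
  refine (memLp_congr_ae ?_).1 h1
  filter_upwards [ae_mem_halfSpace a] with Z hZ
  by_cases hZr : Z ∈ halfBall r
  · simp [hZr]
  · simp [hZr, hr Z hZ hZr]

lemma BddSupp.mul_left (h : BddSupp p) (w : Heis × ℝ → ℝ) : BddSupp fun Z => w Z * p Z := by
  obtain ⟨r, h0, hr⟩ := h
  exact ⟨r, h0, fun Z h1 h2 => by simp [hr Z h1 h2]⟩

lemma BddSupp.mul_right (h : BddSupp p) (w : Heis × ℝ → ℝ) : BddSupp fun Z => p Z * w Z := by
  obtain ⟨r, h0, hr⟩ := h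
  exact ⟨r, h0, fun Z h1 h2 => by simp [hr Z h1 h2]⟩

lemma BddSupp.comp_flow (h : BddSupp p) (e : Heis) (t : ℝ) :
    BddSupp fun Z => p (flow e t Z) := by
  obtain ⟨r, -, hr⟩ := h
  obtain ⟨r', h0, h'⟩ := exists_flow_halfBall (-t • e) r
  have hflow : ∀ Z, flow (-t • e) 1 Z = flow e (-t) Z := fun Z => by
    simp only [flow_eq]
    ext <;> simp
    ring
  refine ⟨r', h0, fun Z h1 h2 => hr _ (flow_mem_halfSpace.2 h1) fun h3 => h2 ?_⟩
  have := h' 1 (by simp) _ h3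
  rwa [hflow, flow_neg_flow] at this

lemma BddSupp.D (h : BddSupp p) (i : Fin 3) : BddSupp (D i p) := by
  obtain ⟨r, h0, hr⟩ := h
  refine ⟨r + 1, by positivity, fun Z h1 h2 => ?_⟩
  have hU : IsOpen (halfSpace ∩
      {Z : Heis × ℝ | r ^ 2 < Z.1.1 ^ 2 + Z.1.2.1 ^ 2 + Z.1.2.2 ^ 2 + Z.2 ^ 2}) :=
    isOpen_halfSpace.inter (isOpen_lt continuous_const (by fun_prop))
  refine along_eq_zero_of_eqOn hU (fun W hW => hr W hW.1 fun h3 => ?_) ⟨h1, ?_⟩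
  · exact absurd h3.2 (not_lt.2 (le_of_lt hW.2))
  · by_contra h3
    refine h2 ⟨h1, ?_⟩
    simp only [mem_ofPred_eq, not_lt] at h3
    nlinarith

/-- Cutoff functions are compactly supported `C¹` functions on the whole space. -/
structure Cutoff (φ : Heis × ℝ → ℝ) : Prop where
  contDiff : ContDiff ℝ 1 φ
  compact : HasCompactSupport φ

lemma bddSupp_of_hasCompactSupport (h : HasCompactSupport p) : BddSupp p := by
  obtain ⟨C, hC⟩ := h.isCompact.exists_bound_of_continuousOn
    (f := fun Z : Heis × ℝ => Z.1.1 ^ 2 + Z.1.2.1 ^ 2 + Z.1.2.2 ^ 2 + Z.2 ^ 2) (by fun_prop)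
  refine ⟨|C| + 1, by positivity, fun Z h1 h2 => ?_⟩
  by_contra h3
  refine h2 ⟨h1, ?_⟩
  have h4 := (le_abs_self _).trans (hC Z (subset_tsupport _ h3))
  nlinarith [abs_nonneg C, le_abs_self C]

variable {φ : Heis × ℝ → ℝ}

lemma Cutoff.bddSupp (h : Cutoff φ) : BddSupp φ := bddSupp_of_hasCompactSupport h.compact

lemma Cutoff.locBdd (h : Cutoff φ) : LocBdd φ := .of_continuous h.contDiff.continuous

lemma Cutoff.continuous_D (h : Cutoff φ) (i : Fin 3) : Continuous (D i φ) :=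
  (h.contDiff.continuous_fderiv one_ne_zero).clm_apply (contDiff_frame (n := 1) i).continuous

lemma Cutoff.locBdd_D (h : Cutoff φ) (i : Fin 3) : LocBdd (D i φ) :=
  .of_continuous (h.continuous_D i)

lemma Cutoff.differentiableAt (h : Cutoff φ) (Z : Heis × ℝ) : DifferentiableAt ℝ φ Z :=
  h.contDiff.differentiable one_ne_zero Z

lemma Cutoff.exists_bound (h : Cutoff φ) : ∃ C, 0 ≤ C ∧ ∀ Z, |φ Z| ≤ C ∧ ∀ i, |D i φ Z| ≤ C := by
  have h1 : ∀ i, HasCompactSupport (D i φ) := fun i => by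
    refine h.compact.fderiv (𝕜 := ℝ) |>.mono fun Z hZ => ?_
    simp only [Function.mem_support, Heisenberg.D, along] at hZ ⊢
    exact fun h0 => hZ (by simp [h0])
  obtain ⟨C, hC⟩ := h.compact.exists_bound_of_continuous h.contDiff.continuous
  choose B hB using fun i => (h1 i).exists_bound_of_continuous (h.continuous_D i)
  refine ⟨|C| + ∑ i, |B i|, by positivity, fun Z => ⟨?_, fun i => ?_⟩⟩
  · refine (hC Z).trans ((le_abs_self C).trans ?_)
    have : 0 ≤ ∑ i, |B i| := by positivity
    linarith
  · refine (hB i Z).trans ((le_abs_self _).trans ?_)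
    have : |B i| ≤ ∑ i, |B i| := Finset.single_le_sum (f := fun i => |B i|)
      (fun j _ => abs_nonneg _) (Finset.mem_univ i)
    linarith [abs_nonneg C]

lemma Cutoff.mul (h : Cutoff φ) (h' : Cutoff w) : Cutoff fun Z => φ Z * w Z :=
  ⟨h.contDiff.mul h'.contDiff, h.compact.mul_right⟩

lemma Cutoff.sq (h : Cutoff φ) : Cutoff fun Z => φ Z ^ 2 := by
  simpa only [pow_two] using h.mul h

lemma exists_cutoff (r : ℝ) : ∃ φ, Cutoff φ ∧ (∀ Z, 0 ≤ φ Z ∧ φ Z ≤ 1) ∧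
    ∀ Z : Heis × ℝ, ‖Z‖ ≤ r → φ Z = 1 := by
  let f : ContDiffBump (0 : Heis × ℝ) := ⟨|r| + 1, |r| + 2, by positivity, by linarith⟩
  refine ⟨f, ⟨f.contDiff, f.hasCompactSupport⟩, fun Z => ⟨f.nonneg, f.le_one⟩, fun Z hZ => ?_⟩
  refine f.one_of_mem_closedBall ?_
  simp only [mem_closedBall_zero_iff]
  change ‖Z‖ ≤ |r| + 1
  linarith [le_abs_self r]

lemma norm_le_of_mem_halfBall {r : ℝ} {Z : Heis × ℝ} (h : Z ∈ halfBall r) : ‖Z‖ ≤ |r| + 1 := by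
  obtain ⟨⟨h1, h2, h3⟩, h4⟩ := halfBall_subset_prod r h
  have h0 := h.1
  simp only [Prod.norm_def, Real.norm_eq_abs, max_le_iff]
  simp only [mem_Iio] at h4
  exact ⟨⟨by linarith [abs_le.2 h1], by linarith [abs_le.2 h2], by linarith [abs_le.2 h3]⟩,
    by rw [abs_of_pos h0]; linarith⟩

lemma exists_cutoff_halfBall (r : ℝ) : ∃ φ, Cutoff φ ∧ (∀ Z, 0 ≤ φ Z ∧ φ Z ≤ 1) ∧
    ∀ Z ∈ halfBall r, φ Z = 1 := by
  obtain ⟨φ, h1, h2, h3⟩ := exists_cutoff (|r| + 1)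
  exact ⟨φ, h1, h2, fun Z hZ => h3 Z (norm_le_of_mem_halfBall hZ)⟩

end

end Heisenberg

namespace Heisenberg

noncomputable section

/-! ### Traces: one-dimensional estimates -/

section OneDim

variable {a : ℝ} {w w' : ℝ → ℝ}

lemma weightMeasure_Iio_pos (a : ℝ) {δ : ℝ} (hδ : 0 < δ) : 0 < weightMeasure a (Iio δ) := by
  rw [pos_iff_ne_zero]
  intro h
  rw [weightMeasure, withDensity_apply_eq_zero (measurable_weight a)] at h
  have h1 : Ioo 0 δ ⊆ {x : ℝ | ENNReal.ofReal (x ^ a) ≠ 0} ∩ Iio δ := fun y hy =>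
    ⟨by simpa using Real.rpow_pos_of_pos hy.1 a, hy.2⟩
  have h2 := measure_mono_null h1 h
  rw [Measure.restrict_apply measurableSet_Ioo, inter_eq_left.2 (fun y hy => hy.1)] at h2
  simp at h2
  linarith

lemma integrableOn_Ioc_of_weighted (ha : a < 1) (hc : ContinuousOn w' (Ioi 0))
    (hi : Integrable (fun y => w' y ^ 2) (weightMeasure a)) {δ : ℝ} (hδ : 0 < δ) :
    IntegrableOn w' (Ioc 0 δ) ∧ (∫ y in Ioc 0 δ, |w' y|) ^ 2 ≤
      δ ^ (1 - a) / (1 - a) * ∫ y, w' y ^ 2 ∂(weightMeasure a) := by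
  have hi' := (integrable_weightMeasure_iff a _).1 hi
  have hi1 : IntegrableOn (fun y => y ^ a * w' y ^ 2) (Ioc 0 δ) := hi'.mono_set fun y hy => hy.1
  have hneg : -1 < -a := by linarith
  have hi2 : IntegrableOn (fun y : ℝ => y ^ (-a)) (Ioc 0 δ) :=
    (intervalIntegral.intervalIntegrable_rpow' (a := 0) (b := δ) hneg).1
  have hval : ∫ y in Ioc 0 δ, y ^ (-a) = δ ^ (1 - a) / (1 - a) := by
    rw [← intervalIntegral.integral_of_le hδ.le, integral_rpow (Or.inl hneg),
      Real.zero_rpow (by linarith), sub_zero, neg_add_eq_sub]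
  have key : ∀ l : ℝ, ∀ y ∈ Ioc 0 δ, 2 * l * |w' y| ≤ y ^ a * w' y ^ 2 + l ^ 2 * y ^ (-a) := by
    intro l y hy
    have h0 : 0 < y ^ a := Real.rpow_pos_of_pos hy.1 a
    have h1 : y ^ (-a) = (y ^ a)⁻¹ := Real.rpow_neg hy.1.le a
    rw [h1]
    have h2 : y ^ a * w' y ^ 2 + l ^ 2 * (y ^ a)⁻¹ - 2 * l * |w' y|
        = y ^ a * (|w' y| - l * (y ^ a)⁻¹) ^ 2 := by
      have : |w' y| ^ 2 = w' y ^ 2 := sq_abs _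
      field_simp
      rw [← this]; ring
    have : 0 ≤ y ^ a * (|w' y| - l * (y ^ a)⁻¹) ^ 2 := by positivity
    linarith
  have hint : IntegrableOn w' (Ioc 0 δ) := by
    refine (hi1.add hi2).mono' ((hc.mono fun y hy => hy.1).aestronglyMeasurable
      measurableSet_Ioc) ?_
    filter_upwards [ae_restrict_mem measurableSet_Ioc] with y hy
    have := key 1 y hy
    simp only [Pi.add_apply, Real.norm_eq_abs]
    linarith [abs_nonneg (w' y)]
  refine ⟨hint, ?_⟩
  set I := ∫ y in Ioc 0 δ, |w' y| with hI
  set c := δ ^ (1 - a) / (1 - a) with hcdef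
  have hcpos : 0 < c := div_pos (Real.rpow_pos_of_pos hδ _) (by linarith)
  have hE : ∫ y in Ioc 0 δ, y ^ a * w' y ^ 2 ≤ ∫ y, w' y ^ 2 ∂(weightMeasure a) := by
    rw [integral_weightMeasure]
    refine setIntegral_mono_set hi' ?_ (Eventually.of_forall fun y hy => hy.1)
    filter_upwards [ae_restrict_mem measurableSet_Ioi] with y hy
    exact mul_nonneg (Real.rpow_nonneg (le_of_lt hy) _) (sq_nonneg _)
  have h3 : ∀ l : ℝ, 2 * l * I ≤ (∫ y, w' y ^ 2 ∂(weightMeasure a)) + l ^ 2 * c := by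
    intro l
    have := setIntegral_mono_on (hint.abs.const_mul (2 * l)) (hi1.add (hi2.const_mul (l ^ 2)))
      measurableSet_Ioc (fun y hy => key l y hy)
    simp only [Pi.add_apply] at this
    rw [integral_const_mul, integral_add hi1 (hi2.const_mul _), integral_const_mul, hval] at this
    linarith
  have h4 := h3 (I / c)
  have h5 : 2 * (I / c) * I = 2 * (I ^ 2 / c) := by ring
  have h6 : (I / c) ^ 2 * c = I ^ 2 / c := by field_simp
  rw [h5, h6] at h4
  have h7 : I ^ 2 / c ≤ ∫ y, w' y ^ 2 ∂(weightMeasure a) := by linarith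
  rwa [div_le_iff₀ hcpos, mul_comm] at h7

lemma exists_trace (ha : a < 1) (hw : ∀ y > 0, HasDerivAt w (w' y) y)
    (hc : ContinuousOn w' (Ioi 0)) (hi : Integrable (fun y => w' y ^ 2) (weightMeasure a)) :
    ∃ l, Tendsto w (𝓝[>] 0) (𝓝 l) ∧ ∀ y > 0, (l - w y) ^ 2 ≤
      y ^ (1 - a) / (1 - a) * ∫ y, w' y ^ 2 ∂(weightMeasure a) := by
  have hlim : ∀ δ > 0, Tendsto w (𝓝[>] 0) (𝓝 (w δ + ∫ y in δ..0, w' y)) := by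
    intro δ hδ
    have h1 := (integrableOn_Ioc_of_weighted ha hc hi hδ).1
    have h2 : IntervalIntegrable w' volume 0 δ :=
      (intervalIntegrable_iff_integrableOn_Ioc_of_le hδ.le).2 h1
    have h3 := intervalIntegral.continuousOn_primitive_interval' h2 right_mem_uIcc
    have h4 : Tendsto (fun b => ∫ x in δ..b, w' x) (𝓝[>] 0) (𝓝 (∫ x in δ..0, w' x)) := by
      have := (h3 0 left_mem_uIcc).tendsto
      refine this.mono_left ?_
      rw [uIcc_of_le hδ.le, ← nhdsWithin_Ioc_eq_nhdsGT hδ]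
      exact nhdsWithin_mono _ Ioc_subset_Icc_self
    refine (h4.const_add (w δ)).congr' ?_
    filter_upwards [Ioc_mem_nhdsGT hδ] with y hy
    rw [intervalIntegral.integral_eq_sub_of_hasDerivAt (f := w)]
    · ring
    · intro z hz
      rw [uIcc_of_ge hy.2] at hz
      exact hw z (hy.1.trans_le hz.1)
    · apply ContinuousOn.intervalIntegrable
      rw [uIcc_of_ge hy.2]
      exact hc.mono fun z hz => hy.1.trans_le hz.1
  refine ⟨_, hlim 1 one_pos, fun y hy => ?_⟩
  have h1 : w 1 + ∫ y in (1 : ℝ)..0, w' y = w y + ∫ z in y..0, w' z :=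
    tendsto_nhds_unique (hlim 1 one_pos) (hlim y hy)
  rw [h1, add_sub_cancel_left, intervalIntegral.integral_symm, neg_sq,
    intervalIntegral.integral_of_le hy.le]
  refine le_trans ?_ (integrableOn_Ioc_of_weighted ha hc hi hy).2
  rw [← sq_abs]
  gcongr
  exact abs_integral_le_integral_abs

lemma exists_trace_constant (ha : a ∈ Ioo (-1 : ℝ) 1) {ε : ℝ} (hε : 0 < ε) :
    ∃ C, 0 ≤ C ∧ ∀ (w w' : ℝ → ℝ) (l : ℝ), (∀ y > 0, HasDerivAt w (w' y) y) →
      ContinuousOn w' (Ioi 0) → Integrable (fun y => w' y ^ 2) (weightMeasure a) →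
      Integrable (fun y => w y ^ 2) (weightMeasure a) → Tendsto w (𝓝[>] 0) (𝓝 l) →
      l ^ 2 ≤ ε * (∫ y, w' y ^ 2 ∂(weightMeasure a)) + C * ∫ y, w y ^ 2 ∂(weightMeasure a) := by
  obtain ⟨δ, hδ, hδε⟩ : ∃ δ > 0, 2 * (δ ^ (1 - a) / (1 - a)) ≤ ε := by
    have h1 : Tendsto (fun δ : ℝ => 2 * (δ ^ (1 - a) / (1 - a))) (𝓝[>] 0) (𝓝 0) := by
      have : ContinuousAt (fun δ : ℝ => 2 * (δ ^ (1 - a) / (1 - a))) 0 :=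
        ((Real.continuousAt_rpow_const 0 (1 - a)
          (Or.inr (by linarith [ha.2]))).div_const _).const_mul 2
      have h2 := this.tendsto.mono_left (nhdsWithin_le_nhds (s := Ioi 0))
      simpa [Real.zero_rpow (by linarith [ha.2] : 1 - a ≠ 0)] using h2
    obtain ⟨δ, h2, h3⟩ := ((h1.eventually (ge_mem_nhds hε)).and self_mem_nhdsWithin).exists
    exact ⟨δ, h3, h2⟩
  set m := (weightMeasure a).real (Iio δ) with hm
  have hmpos : 0 < m := ENNReal.toReal_pos (weightMeasure_Iio_pos a hδ).ne'
    (weightMeasure_Iio_lt_top ha.1 δ).ne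
  refine ⟨2 / m, by positivity, fun w w' l hw hc hi hi2 hl => ?_⟩
  obtain ⟨l', hl', hb⟩ := exists_trace ha.2 hw hc hi
  obtain rfl := tendsto_nhds_unique hl hl'
  set E := ∫ y, w' y ^ 2 ∂(weightMeasure a) with hE
  have hE0 : 0 ≤ E := integral_nonneg fun y => sq_nonneg _
  have hpt : ∀ᵐ y ∂(weightMeasure a).restrict (Iio δ), l ^ 2 ≤ 2 * w y ^ 2 + ε * E := by
    filter_upwards [ae_restrict_mem measurableSet_Iio,
      ae_restrict_of_ae (ae_weightMeasure a)] with y hy hy0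
    have h1 := hb y hy0
    have h2 : y ^ (1 - a) / (1 - a) ≤ δ ^ (1 - a) / (1 - a) := by
      have : 0 < 1 - a := by linarith [ha.2]
      have h3 : y ≤ δ := le_of_lt hy
      gcongr
    have h3 : y ^ (1 - a) / (1 - a) * E ≤ δ ^ (1 - a) / (1 - a) * E := by gcongr
    nlinarith [sq_nonneg (l - 2 * w y), sq_nonneg (l - w y - w y)]
  have hfin : IsFiniteMeasure ((weightMeasure a).restrict (Iio δ)) :=
    ⟨by simpa using weightMeasure_Iio_lt_top ha.1 δ⟩
  have h1 := integral_mono_ae (integrable_const (l ^ 2))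
    ((hi2.restrict.const_mul 2).add (integrable_const (ε * E))) hpt
  simp only [Pi.add_apply] at h1
  rw [integral_add (hi2.restrict.const_mul 2) (integrable_const _), integral_const, integral_const,
    integral_const_mul] at h1
  simp only [measureReal_restrict_apply_univ, smul_eq_mul] at h1
  rw [← hm] at h1
  have h2 : ∫ y in Iio δ, w y ^ 2 ∂(weightMeasure a) ≤ ∫ y, w y ^ 2 ∂(weightMeasure a) :=
    setIntegral_le_integral hi2 (ae_of_all _ fun y => sq_nonneg _)
  have h3 : m * l ^ 2 ≤ m * (ε * E + 2 / m * ∫ y, w y ^ 2 ∂(weightMeasure a)) := by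
    have : m * (ε * E + 2 / m * ∫ y, w y ^ 2 ∂(weightMeasure a)) =
      m * (ε * E) + 2 * ∫ y, w y ^ 2 ∂(weightMeasure a) := by field_simp
    linarith
  exact le_of_mul_le_mul_left h3 hmpos

end OneDim

/-! ### Functions of locally finite weighted energy -/

/-- `C¹` functions in the open half-space of locally finite weighted energy. -/
structure Energy (a : ℝ) (w : Heis × ℝ → ℝ) : Prop where
  contDiffOn : ContDiffOn ℝ 1 w halfSpace
  locSq : LocSq a w
  locSq_D : ∀ i, LocSq a (D i w)

/-- `C¹` admissible test functions. -/
structure Admissible (a : ℝ) (ξ : Heis × ℝ → ℝ) : Prop where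
  energy : Energy a ξ
  bounded : ∃ M, ∀ Z ∈ halfSpace, |ξ Z| ≤ M
  bddSupp : BddSupp ξ

/-- The pointwise inner product of gradients. -/
def dot (u w : Heis × ℝ → ℝ) (Z : Heis × ℝ) : ℝ := ∑ i, D i u Z * D i w Z

lemma inner_gradHbar (u w : Heis × ℝ → ℝ) (Z : Heis × ℝ) :
    inner ℝ (gradHbar u Z) (gradHbar w Z) = dot u w Z := by
  simp [gradHbar, dot, PiLp.inner_apply, Fin.sum_univ_three, D_zero, D_one, D_two, mul_comm]

lemma norm_gradHbar_sq (u : Heis × ℝ → ℝ) (Z : Heis × ℝ) :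
    ‖gradHbar u Z‖ ^ 2 = dot u u Z := by
  rw [← real_inner_self_eq_norm_sq, inner_gradHbar]

variable {a : ℝ} {u w ξ p φ ψ : Heis × ℝ → ℝ}

lemma dot_self_nonneg (u : Heis × ℝ → ℝ) (Z : Heis × ℝ) : 0 ≤ dot u u Z :=
  Finset.sum_nonneg fun _ _ => mul_self_nonneg _

lemma sq_D_le_dot (u : Heis × ℝ → ℝ) (Z : Heis × ℝ) (i : Fin 3) : D i u Z ^ 2 ≤ dot u u Z := by
  rw [pow_two]
  exact Finset.single_le_sum (f := fun i => D i u Z * D i u Z)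
    (fun _ _ => mul_self_nonneg _) (Finset.mem_univ i)

lemma integrable_mul_of_memLp {ν : Measure (Heis × ℝ)} (hp : MemLp p 2 ν) (hw : MemLp w 2 ν) :
    Integrable (fun Z => p Z * w Z) ν := hp.integrable_mul hw

/-- Products of locally square integrable functions, one of bounded support, are integrable. -/
lemma LocSq.integrable_mul (hp : LocSq a p) (hw : LocSq a w) (h : BddSupp w) :
    Integrable (fun Z => p Z * w Z) (μ a) := by
  obtain ⟨r, -, hr⟩ := id h
  have h1 : MemLp ((halfBall r).indicator p) 2 (μ a) :=
    (memLp_indicator_iff_restrict (measurableSet_halfBall r)).2 (hp.memLp r)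
  refine (integrable_mul_of_memLp h1 (hw.memLp_of_bddSupp h)).congr ?_
  filter_upwards [ae_mem_halfSpace a] with Z hZ
  by_cases hZr : Z ∈ halfBall r
  · simp [hZr]
  · simp [hZr, hr Z hZ hZr]

lemma LocSq.integrable_sq (hp : LocSq a p) (h : BddSupp p) :
    Integrable (fun Z => p Z ^ 2) (μ a) := by
  simpa only [pow_two] using hp.integrable_mul hp h

lemma Energy.integrable_dot (hu : Energy a u) (hw : Energy a w) (h : BddSupp w) :
    Integrable (dot u w) (μ a) :=
  integrable_finsetSum _ fun i _ => (hu.locSq_D i).integrable_mul (hw.locSq_D i) (h.D i)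

lemma Energy.differentiableAt (hu : Energy a u) {Z : Heis × ℝ} (hZ : Z ∈ halfSpace) :
    DifferentiableAt ℝ u Z := differentiableAt_of_mem hu.contDiffOn hZ

lemma Energy.add (hu : Energy a u) (hw : Energy a w) : Energy a fun Z => u Z + w Z :=
  ⟨hu.contDiffOn.add hw.contDiffOn, hu.locSq.add hw.locSq, fun i =>
    ((hu.locSq_D i).add (hw.locSq_D i)).congr fun _ hZ =>
      along_add (hu.differentiableAt hZ) (hw.differentiableAt hZ)⟩

lemma Energy.sub (hu : Energy a u) (hw : Energy a w) : Energy a fun Z => u Z - w Z :=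
  ⟨hu.contDiffOn.sub hw.contDiffOn, hu.locSq.sub hw.locSq, fun i =>
    ((hu.locSq_D i).sub (hw.locSq_D i)).congr fun _ hZ =>
      along_sub (hu.differentiableAt hZ) (hw.differentiableAt hZ)⟩

lemma Energy.const_mul (hu : Energy a u) (c : ℝ) : Energy a fun Z => c * u Z :=
  ⟨contDiffOn_const.mul hu.contDiffOn, hu.locSq.const_mul c, fun i =>
    ((hu.locSq_D i).const_mul c).congr fun _ hZ => along_const_mul c (hu.differentiableAt hZ)⟩

lemma Energy.comp_flow (hu : Energy a u) (q : Heis) (t : ℝ) :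
    Energy a fun Z => u (flow q t Z) :=
  ⟨contDiffOn_comp_flow hu.contDiffOn q t, hu.locSq.comp_flow q t, fun i =>
    ((hu.locSq_D i).comp_flow q t).congr fun _ hZ => D_comp_flow hu.contDiffOn q t hZ i⟩

lemma Energy.quot (hu : Energy a u) (q : Heis) (t : ℝ) : Energy a (quot q t u) :=
  ((hu.comp_flow q t).sub hu).const_mul t⁻¹

lemma locBdd_D_of_contDiff (hψ : ContDiff ℝ 1 ψ) (i : Fin 3) : LocBdd (D i ψ) :=
  .of_continuous ((hψ.continuous_fderiv one_ne_zero).clm_apply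
    (contDiff_frame (n := 1) i).continuous)

lemma Energy.mul_contDiff (hu : Energy a u) (hψ : ContDiff ℝ 1 ψ) :
    Energy a fun Z => u Z * ψ Z := by
  have hb : LocBdd ψ := .of_continuous hψ.continuous
  exact ⟨hu.contDiffOn.mul hψ.contDiffOn, hu.locSq.mul_bdd hb, fun i =>
    ((hu.locSq.mul_bdd (locBdd_D_of_contDiff hψ i)).add ((hu.locSq_D i).mul_bdd hb)).congr
      fun Z hZ => along_mul (hu.differentiableAt hZ) (hψ.differentiable one_ne_zero Z)⟩

lemma Energy.of_contDiff (ha : -1 < a) (hψ : ContDiff ℝ 1 ψ) : Energy a ψ :=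
  ⟨hψ.contDiffOn, (LocBdd.of_continuous hψ.continuous).locSq ha,
    fun i => (locBdd_D_of_contDiff hψ i).locSq ha⟩

lemma BddSupp.exists_bound (h : BddSupp p) (hb : LocBdd p) :
    ∃ M, ∀ Z ∈ halfSpace, |p Z| ≤ M := by
  obtain ⟨r, -, hr⟩ := h
  obtain ⟨C, hC⟩ := hb.bound r
  refine ⟨|C|, fun Z hZ => ?_⟩
  by_cases hZr : Z ∈ halfBall r
  · exact (hC Z hZr).trans (le_abs_self C)
  · simp [hr Z hZ hZr]

lemma Energy.admissible_mul_cutoff (hw : Energy a w) (hb : LocBdd w) (hφ : Cutoff φ) :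
    Admissible a fun Z => w Z * φ Z :=
  ⟨hw.mul_contDiff hφ.contDiff, (hφ.bddSupp.mul_left w).exists_bound (hb.mul hφ.locBdd),
    hφ.bddSupp.mul_left w⟩

lemma Admissible.locBdd (h : Admissible a ξ) : LocBdd ξ :=
  ⟨h.energy.contDiffOn.continuousOn, fun _ =>
    let ⟨M, hM⟩ := h.bounded; ⟨M, fun Z hZ => hM Z hZ.1⟩⟩

lemma Admissible.mul_contDiff (h : Admissible a ξ) (hψ : ContDiff ℝ 1 ψ) :
    Admissible a fun Z => ξ Z * ψ Z :=
  ⟨h.energy.mul_contDiff hψ, (h.bddSupp.mul_right ψ).exists_bound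
    (h.locBdd.mul (.of_continuous hψ.continuous)), h.bddSupp.mul_right ψ⟩

lemma Admissible.comp_flow (h : Admissible a ξ) (q : Heis) (t : ℝ) :
    Admissible a fun Z => ξ (flow q t Z) :=
  ⟨h.energy.comp_flow q t,
    let ⟨M, hM⟩ := h.bounded; ⟨M, fun _ hZ => hM _ (flow_mem_halfSpace.2 hZ)⟩,
    h.bddSupp.comp_flow q t⟩

lemma Admissible.isTestFunction (h : Admissible a ξ) : IsTestFunction a ξ := by
  refine ⟨h.bounded, ?_, h.bddSupp, fun r _ => ?_⟩
  · intro Z hZ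
    obtain ⟨K, t, ht, hK⟩ := (contDiffAt_of_mem h.energy.contDiffOn hZ).exists_lipschitzOnWith
    exact ⟨K, t, mem_nhdsWithin_of_mem_nhds ht, hK⟩
  · have h1 : IntegrableOn (fun Z => dot ξ ξ Z) (halfBall r) (μ a) :=
      (h.energy.integrable_dot h.energy h.bddSupp).integrableOn
    have h2 := (integrableOn_μ_iff a _ (measurableSet_halfBall r) (halfBall_subset r)).1 h1
    simpa only [norm_gradHbar_sq] using h2

/-! ### Traces -/

lemma hasDerivAt_vertical (hw : ContDiffOn ℝ 1 w halfSpace) (x : Heis) {y : ℝ} (hy : 0 < y) :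
    HasDerivAt (fun y => w (x, y)) (D 2 w (x, y)) y := by
  have h1 : HasDerivAt (fun y : ℝ => (x, y)) ((0 : Heis), (1 : ℝ)) y :=
    (hasDerivAt_const y x).prodMk (hasDerivAt_id y)
  have h2 := (differentiableAt_of_mem hw (Z := (x, y)) hy).hasFDerivAt.comp_hasDerivAt y h1
  rw [D_two]
  exact h2

lemma continuousOn_vertical (hp : ContinuousOn p halfSpace) (x : Heis) :
    ContinuousOn (fun y => p (x, y)) (Ioi 0) :=
  hp.comp (by fun_prop) fun _ hy => hy

lemma continuous_horizontal (hp : ContinuousOn p halfSpace) {y : ℝ} (hy : 0 < y) :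
    Continuous fun x => p (x, y) :=
  continuousOn_univ.1 (hp.comp (f := fun x => (x, y)) (by fun_prop) fun _ _ => hy)

/-- The boundary values of `w` exist almost everywhere. -/
def HasTrace (w : Heis × ℝ → ℝ) : Prop :=
  ∀ᵐ x : Heis, Tendsto (fun y => w (x, y)) (𝓝[>] 0) (𝓝 (bdry w x))

lemma bdry_eq {l : ℝ} {x : Heis} (h : Tendsto (fun y => w (x, y)) (𝓝[>] 0) (𝓝 l)) :
    bdry w x = l := h.limUnder_eq

lemma bdry_of_continuous (h : Continuous ψ) (x : Heis) : bdry ψ x = ψ (x, 0) := by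
  apply bdry_eq
  have : Continuous fun y => ψ (x, y) := by fun_prop
  exact (this.tendsto 0).mono_left nhdsWithin_le_nhds

lemma bdry_comp_flow (w : Heis × ℝ → ℝ) (q : Heis) (t : ℝ) (x : Heis) :
    bdry (fun Z => w (flow q t Z)) x = bdry w (flowBase q t x) := by
  simp only [bdry, flow_mk]

lemma Energy.hasTrace_of_bddSupp (ha : a < 1) (hw : Energy a w) (h : BddSupp w) :
    HasTrace w := by
  have h1 := ((hw.locSq_D 2).integrable_sq (h.D 2)).prod_right_ae
  filter_upwards [h1] with x hx
  obtain ⟨l, hl, -⟩ := exists_trace ha (fun y hy => hasDerivAt_vertical hw.contDiffOn x hy)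
    (continuousOn_vertical (continuousOn_D hw.contDiffOn 2) x) hx
  rwa [bdry_eq hl]

lemma Energy.hasTrace (ha : a < 1) (hw : Energy a w) : HasTrace w := by
  choose φ h1 _ h3 using fun n : ℕ => exists_cutoff_halfBall (n + 1)
  have h4 : ∀ n, HasTrace fun Z => w Z * φ n Z := fun n =>
    (hw.mul_contDiff (h1 n).contDiff).hasTrace_of_bddSupp ha ((h1 n).bddSupp.mul_left w)
  filter_upwards [ae_all_iff.2 h4] with x hx
  obtain ⟨n, hn⟩ := exists_nat_gt (x.1 ^ 2 + x.2.1 ^ 2 + x.2.2 ^ 2 + 1)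
  have h5 : (fun y => w (x, y) * φ n (x, y)) =ᶠ[𝓝[>] 0] fun y => w (x, y) := by
    filter_upwards [Ioo_mem_nhdsGT (one_pos : (0 : ℝ) < 1)] with y hy
    rw [h3 n (x, y) ⟨hy.1, ?_⟩, mul_one]
    have : y ^ 2 < 1 := by nlinarith [hy.1, hy.2]
    simp only
    nlinarith [(Nat.cast_nonneg n : (0 : ℝ) ≤ n)]
  have h6 := (hx n).congr' h5
  rwa [bdry_eq h6]

lemma HasTrace.mul (hu : HasTrace u) (hw : HasTrace w) :
    HasTrace (fun Z => u Z * w Z) ∧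
      bdry (fun Z => u Z * w Z) =ᵐ[volume] fun x => bdry u x * bdry w x := by
  have : ∀ᵐ x : Heis, Tendsto (fun y => u (x, y) * w (x, y)) (𝓝[>] 0)
      (𝓝 (bdry u x * bdry w x)) := by
    filter_upwards [hu, hw] with x h1 h2 using h1.mul h2
  refine ⟨?_, ?_⟩ <;> filter_upwards [this] with x hx
  · rwa [bdry_eq hx]
  · exact bdry_eq hx

lemma HasTrace.of_continuous (h : Continuous ψ) : HasTrace ψ := by
  refine ae_of_all _ fun x => ?_
  rw [bdry_of_continuous h]
  have : Continuous fun y => ψ (x, y) := by fun_prop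
  exact (this.tendsto 0).mono_left nhdsWithin_le_nhds

lemma HasTrace.comp_flow (hw : HasTrace w) (q : Heis) (t : ℝ) :
    HasTrace fun Z => w (flow q t Z) := by
  have := (measurePreserving_flowBase q t).quasiMeasurePreserving.ae hw
  filter_upwards [this] with x hx
  rw [bdry_comp_flow]
  simpa only [flow_mk] using hx

lemma bdry_quot (hw : HasTrace w) (q : Heis) (t : ℝ) :
    bdry (quot q t w) =ᵐ[volume] fun x => t⁻¹ * (bdry w (flowBase q t x) - bdry w x) := by
  filter_upwards [hw, hw.comp_flow q t] with x h1 h2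
  rw [bdry_comp_flow] at h2
  exact bdry_eq ((h2.sub h1).const_mul t⁻¹)

lemma HasTrace.aesm (hw : HasTrace w) (hc : ContinuousOn w halfSpace) :
    AEStronglyMeasurable (bdry w) (volume : Measure Heis) := by
  have hs : Tendsto (fun n : ℕ => (1 : ℝ) / (n + 1)) atTop (𝓝[>] 0) :=
    tendsto_nhdsWithin_iff.2 ⟨tendsto_one_div_add_atTop_nhds_zero_nat,
      Eventually.of_forall fun n => by simp only [mem_Ioi]; positivity⟩
  refine aestronglyMeasurable_of_tendsto_ae atTop
    (f := fun (n : ℕ) x => w (x, (1 : ℝ) / (n + 1))) (fun n =>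
      (continuous_horizontal hc (by positivity)).aestronglyMeasurable) ?_
  filter_upwards [hw] with x hx using hx.comp hs

/-- The trace inequality with a small constant in front of the energy. -/
lemma exists_trace_inequality (ha : a ∈ Ioo (-1 : ℝ) 1) {ε : ℝ} (hε : 0 < ε) :
    ∃ C, 0 ≤ C ∧ ∀ w, Energy a w → BddSupp w → MemLp (bdry w) 2 (volume : Measure Heis) ∧
      ∫ x, bdry w x ^ 2 ≤ ε * (∫ Z, dot w w Z ∂(μ a)) + C * ∫ Z, w Z ^ 2 ∂(μ a) := by
  obtain ⟨C, hC0, hC⟩ := exists_trace_constant ha hε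
  refine ⟨C, hC0, fun w hw h => ?_⟩
  have hi := (hw.locSq_D 2).integrable_sq (h.D 2)
  have hi2 := hw.locSq.integrable_sq h
  have htr := hw.hasTrace ha.2
  have hpt : ∀ᵐ x : Heis, bdry w x ^ 2 ≤
      ε * (∫ y, D 2 w (x, y) ^ 2 ∂(weightMeasure a)) +
        C * ∫ y, w (x, y) ^ 2 ∂(weightMeasure a) := by
    filter_upwards [hi.prod_right_ae, hi2.prod_right_ae, htr] with x h1 h2 h3
    exact hC _ _ _ (fun y hy => hasDerivAt_vertical hw.contDiffOn x hy)
      (continuousOn_vertical (continuousOn_D hw.contDiffOn 2) x) h1 h2 h3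
  have hint := (hi.integral_prod_left.const_mul ε).add (hi2.integral_prod_left.const_mul C)
  have hm := htr.aesm hw.contDiffOn.continuousOn
  have hsq : Integrable (fun x => bdry w x ^ 2) (volume : Measure Heis) := by
    refine hint.mono' (hm.pow 2) ?_
    filter_upwards [hpt] with x hx
    rw [Real.norm_of_nonneg (sq_nonneg _)]
    exact hx
  refine ⟨(memLp_two_iff_integrable_sq hm).2 hsq, (integral_mono_ae hsq hint hpt).trans ?_⟩
  simp only [Pi.add_apply]
  rw [integral_add (hi.integral_prod_left.const_mul ε) (hi2.integral_prod_left.const_mul C),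
    integral_const_mul, integral_const_mul, μ,
    ← integral_prod (fun Z : Heis × ℝ => D 2 w Z ^ 2) hi, ← integral_prod (fun Z => w Z ^ 2) hi2]
  gcongr
  · exact hw.integrable_dot hw h
  · exact fun Z => sq_D_le_dot w Z 2

end

end Heisenberg

namespace Heisenberg

noncomputable section

/-! ### The equation for difference quotients -/

/-- Bounded weak solutions of class `C²`, for a reaction term with bounded derivative. -/
structure BoundarySolution (a M : ℝ) (f : ℝ → ℝ) (u : Heis × ℝ → ℝ) : Prop where
  weight : a ∈ Ioo (-1 : ℝ) 1
  contDiff : ContDiff ℝ 1 f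
  deriv_le : ∀ s, |deriv f s| ≤ M
  smooth : ContDiffOn ℝ 2 u halfSpace
  bounded : ∃ B, ∀ Z ∈ halfSpace, |u Z| ≤ B
  energy : Energy a u
  weak : ∀ ξ, Admissible a ξ → ∫ Z, dot u ξ Z ∂(μ a) = ∫ x : Heis, f (bdry u x) * bdry ξ x

variable {a M : ℝ} {f : ℝ → ℝ} {u w ξ φ : Heis × ℝ → ℝ}

lemma HasTrace.ae_abs_le (h : HasTrace w) {B : ℝ} (hB : ∀ Z ∈ halfSpace, |w Z| ≤ B) :
    ∀ᵐ x : Heis, |bdry w x| ≤ B := by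
  filter_upwards [h] with x hx
  refine le_of_tendsto hx.abs ?_
  filter_upwards [self_mem_nhdsWithin] with y hy using hB (x, y) hy

/-- The traces of functions of bounded support vanish off a bounded set. -/
lemma BddSupp.exists_bdry_eq_zero (h : BddSupp w) :
    ∃ K : Set Heis, IsCompact K ∧ ∀ x ∉ K, bdry w x = 0 := by
  obtain ⟨r, h0, hr⟩ := h
  refine ⟨Icc (-|r|) |r| ×ˢ Icc (-|r|) |r| ×ˢ Icc (-|r|) |r|,
    isCompact_Icc.prod (isCompact_Icc.prod isCompact_Icc), fun x hx => bdry_eq ?_⟩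
  refine tendsto_const_nhds.congr' ?_
  filter_upwards [self_mem_nhdsWithin] with y hy
  exact (hr (x, y) hy fun h => hx (halfBall_subset_prod r h).1).symm

lemma Admissible.hasTrace (ha : a < 1) (h : Admissible a ξ) : HasTrace ξ := h.energy.hasTrace ha

lemma Admissible.aesm_bdry (ha : a < 1) (h : Admissible a ξ) :
    AEStronglyMeasurable (bdry ξ) (volume : Measure Heis) :=
  (h.hasTrace ha).aesm h.energy.contDiffOn.continuousOn

lemma Admissible.integrable_bdry (ha : a < 1) (h : Admissible a ξ) :
    Integrable (bdry ξ) (volume : Measure Heis) := by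
  obtain ⟨K, hK, h0⟩ := h.bddSupp.exists_bdry_eq_zero
  obtain ⟨B, hB⟩ := h.bounded
  rw [← integrableOn_iff_integrable_of_support_subset (s := K)
    (fun x hx => by by_contra h1; exact hx (h0 x h1))]
  refine Measure.integrableOn_of_bounded hK.measure_ne_top (h.aesm_bdry ha) (M := B) ?_
  exact ae_restrict_of_ae ((h.hasTrace ha).ae_abs_le hB)

lemma Admissible.memLp_bdry (ha : a ∈ Ioo (-1 : ℝ) 1) (h : Admissible a ξ) :
    MemLp (bdry ξ) 2 (volume : Measure Heis) :=
  let ⟨_, _, hC⟩ := exists_trace_inequality ha one_pos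
  (hC ξ h.energy h.bddSupp).1

namespace BoundarySolution

lemma lipschitz (hu : BoundarySolution a M f u) (s t : ℝ) : |f s - f t| ≤ M * |s - t| :=
  Convex.norm_image_sub_le_of_norm_deriv_le (s := univ)
    (fun x _ => hu.contDiff.differentiable one_ne_zero x) (fun x _ => hu.deriv_le x) convex_univ
    (mem_univ t) (mem_univ s)

lemma nonneg (hu : BoundarySolution a M f u) : 0 ≤ M := (abs_nonneg _).trans (hu.deriv_le 0)

lemma hasTrace (hu : BoundarySolution a M f u) : HasTrace u := hu.energy.hasTrace hu.weight.2

lemma contDiffOn (hu : BoundarySolution a M f u) : ContDiffOn ℝ 1 u halfSpace :=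
  hu.smooth.of_le (by norm_num)

lemma aesm_bdry (hu : BoundarySolution a M f u) :
    AEStronglyMeasurable (bdry u) (volume : Measure Heis) :=
  hu.hasTrace.aesm hu.contDiffOn.continuousOn

lemma integrable_comp_bdry_mul (hu : BoundarySolution a M f u) (hξ : Admissible a ξ) (q : Heis)
    (t : ℝ) : Integrable (fun x : Heis => f (bdry u (flowBase q t x)) * bdry ξ x) := by
  obtain ⟨B, hB⟩ := hu.bounded
  have h1 : ∀ᵐ x : Heis, |bdry u (flowBase q t x)| ≤ B :=
    (measurePreserving_flowBase q t).quasiMeasurePreserving.ae (hu.hasTrace.ae_abs_le hB)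
  obtain ⟨C, hC⟩ := (isCompact_Icc (a := -B) (b := B)).exists_bound_of_continuousOn
    hu.contDiff.continuous.continuousOn
  have hm : AEStronglyMeasurable (fun x : Heis => f (bdry u (flowBase q t x))) :=
    hu.contDiff.continuous.comp_aestronglyMeasurable
      (hu.aesm_bdry.comp_measurePreserving (measurePreserving_flowBase q t))
  refine (hξ.integrable_bdry hu.weight.2).bdd_mul (c := C) hm ?_
  filter_upwards [h1] with x hx using hC _ (abs_le.1 hx)

lemma locBdd_quot (hu : BoundarySolution a M f u) (q : Heis) (t : ℝ) : LocBdd (quot q t u) := by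
  obtain ⟨B, hB⟩ := hu.bounded
  refine ⟨(contDiffOn_quot hu.contDiffOn q t).continuousOn,
    fun r => ⟨|t⁻¹| * (B + B), fun Z hZ => ?_⟩⟩
  rw [Heisenberg.quot, abs_mul]
  gcongr
  exact (abs_sub _ _).trans (add_le_add (hB _ (flow_mem_halfSpace.2 hZ.1)) (hB _ hZ.1))

lemma weak_quot (hu : BoundarySolution a M f u) (hξ : Admissible a ξ) (q : Heis) (t : ℝ) :
    ∫ Z, dot (quot q t u) ξ Z ∂(μ a) =
      ∫ x : Heis, t⁻¹ * (f (bdry u (flowBase q t x)) - f (bdry u x)) * bdry ξ x := by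
  have hξ' := hξ.comp_flow q (-t)
  have e1 : ∫ Z, dot u (fun Z => ξ (flow q (-t) Z)) (flow q t Z) ∂(μ a) =
      ∫ x : Heis, f (bdry u (flowBase q t x)) * bdry ξ x := by
    rw [integral_comp_flow, hu.weak _ hξ', ← integral_comp_flowBase q t]
    refine integral_congr_ae (ae_of_all _ fun x => ?_)
    simp only [bdry_comp_flow, flowBase_neg_flowBase]
  have i1 : Integrable (fun Z => dot u (fun Z => ξ (flow q (-t) Z)) (flow q t Z)) (μ a) :=
    (measurePreserving_flow a q t).integrable_comp_of_integrable
      (hu.energy.integrable_dot hξ'.energy hξ'.bddSupp)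
  have i2 := hu.energy.integrable_dot hξ.energy hξ.bddSupp
  have e2 : ∫ Z, dot (quot q t u) ξ Z ∂(μ a) = ∫ Z, t⁻¹ *
      (dot u (fun Z => ξ (flow q (-t) Z)) (flow q t Z) - dot u ξ Z) ∂(μ a) := by
    refine integral_congr_ae ?_
    filter_upwards [ae_mem_halfSpace a] with Z hZ
    simp only [dot, ← Finset.sum_sub_distrib, Finset.mul_sum]
    refine Finset.sum_congr rfl fun i _ => ?_
    rw [D_quot hu.contDiffOn q t hZ i,
      D_comp_flow hξ.energy.contDiffOn q (-t) (flow_mem_halfSpace.2 hZ) i, flow_neg_flow,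
      Heisenberg.quot]
    ring
  have i3 := hu.integrable_comp_bdry_mul hξ q t
  have i4 : Integrable (fun x : Heis => f (bdry u x) * bdry ξ x) := by
    simpa [flowBase] using hu.integrable_comp_bdry_mul hξ q 0
  rw [e2, integral_const_mul, integral_sub i1 i2, e1, hu.weak ξ hξ, ← integral_sub i3 i4,
    ← integral_const_mul]
  refine integral_congr_ae (ae_of_all _ fun x => ?_)
  simp only
  ring

end BoundarySolution

lemma dot_mul_self (hw : DifferentiableAt ℝ w Z) (hφ : DifferentiableAt ℝ φ Z) :
    dot (fun Z => w Z * φ Z) (fun Z => w Z * φ Z) Z =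
      dot w (fun Z => w Z * φ Z ^ 2) Z + w Z ^ 2 * dot φ φ Z := by
  have h2 : DifferentiableAt ℝ (fun Z => φ Z ^ 2) Z := hφ.pow 2
  have h3 : ∀ i, D i (fun Z => φ Z ^ 2) Z = 2 * φ Z * D i φ Z := fun i => by
    have := along_mul (V := frame i) hφ hφ
    simp only [pow_two]
    unfold D
    rw [this]; ring
  simp only [dot, Finset.mul_sum, ← Finset.sum_add_distrib]
  refine Finset.sum_congr rfl fun i _ => ?_
  have h4 : D i (fun Z => w Z * φ Z) Z = w Z * D i φ Z + D i w Z * φ Z := along_mul hw hφ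
  have h5 : D i (fun Z => w Z * φ Z ^ 2) Z = w Z * D i (fun Z => φ Z ^ 2) Z + D i w Z * φ Z ^ 2 :=
    along_mul hw h2
  rw [h4, h5, h3]
  ring

/-- The Caccioppoli inequality for difference quotients. -/
lemma BoundarySolution.exists_caccioppoli (hu : BoundarySolution a M f u) :
    ∃ C, 0 ≤ C ∧ ∀ φ, Cutoff φ → ∀ q t,
      ∫ Z, dot (fun Z => quot q t u Z * φ Z) (fun Z => quot q t u Z * φ Z) Z ∂(μ a) ≤
        C * (∫ Z, (quot q t u Z * φ Z) ^ 2 ∂(μ a)) +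
          2 * ∫ Z, quot q t u Z ^ 2 * dot φ φ Z ∂(μ a) := by
  have hM := hu.nonneg
  obtain ⟨C, hC0, hC⟩ := exists_trace_inequality hu.weight (ε := 1 / (2 * (M + 1))) (by positivity)
  refine ⟨2 * (M * C), by positivity, fun φ hφ q t => ?_⟩
  set w := quot q t u with hw
  have hE : Energy a w := hu.energy.quot q t
  have hb : LocBdd w := hu.locBdd_quot q t
  have hξ := hE.admissible_mul_cutoff hb hφ.sq
  have hη := hE.admissible_mul_cutoff hb hφ
  have hbdry : ∫ Z, dot w (fun Z => w Z * φ Z ^ 2) Z ∂(μ a) ≤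
      M * ∫ x, bdry (fun Z => w Z * φ Z) x ^ 2 := by
    rw [hw, hu.weak_quot (by rw [← hw]; exact hξ), ← hw, ← integral_const_mul]
    refine (Real.le_norm_self _).trans (norm_integral_le_of_norm_le
      ((hη.memLp_bdry hu.weight).integrable_sq.const_mul M) ?_)
    have t1 := hE.hasTrace hu.weight.2
    have t2 := HasTrace.of_continuous hφ.contDiff.continuous
    have t3 := HasTrace.of_continuous hφ.sq.contDiff.continuous
    filter_upwards [bdry_quot hu.hasTrace q t, (t1.mul t2).2, (t1.mul t3).2] with x h1 h2 h3
    rw [h2, h3, bdry_of_continuous hφ.contDiff.continuous,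
      bdry_of_continuous hφ.sq.contDiff.continuous, norm_mul, norm_mul, norm_mul]
    have h4 : ‖f (bdry u (flowBase q t x)) - f (bdry u x)‖ ≤
      M * |bdry u (flowBase q t x) - bdry u x| := hu.lipschitz _ _
    have h5 : ‖bdry w x‖ = ‖t⁻¹‖ * |bdry u (flowBase q t x) - bdry u x| := by
      rw [hw, h1, norm_mul]; rfl
    have h6 : ‖φ (x, 0) ^ 2‖ = φ (x, 0) ^ 2 := by simp
    have h7 : bdry w x ^ 2 = ‖bdry w x‖ ^ 2 := by simp
    rw [mul_pow, h6, h7]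
    calc ‖t⁻¹‖ * ‖f (bdry u (flowBase q t x)) - f (bdry u x)‖ * (‖bdry w x‖ * φ (x, 0) ^ 2)
        ≤ ‖t⁻¹‖ * (M * |bdry u (flowBase q t x) - bdry u x|) * (‖bdry w x‖ * φ (x, 0) ^ 2) := by
          gcongr
      _ = M * (‖bdry w x‖ ^ 2 * φ (x, 0) ^ 2) := by rw [h5]; ring
  have i1 := hE.integrable_dot hξ.energy hξ.bddSupp
  have i2 : Integrable (fun Z => w Z ^ 2 * dot φ φ Z) (μ a) := by
    have : Integrable (fun Z => ∑ i, w Z * (w Z * (D i φ Z * D i φ Z))) (μ a) :=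
      integrable_finsetSum _ fun i _ => hE.locSq.integrable_mul
        (hE.locSq.mul_bdd ((hφ.locBdd_D i).mul (hφ.locBdd_D i)))
        (((hφ.bddSupp.D i).mul_left _).mul_left _)
    refine this.congr (ae_of_all _ fun Z => ?_)
    simp only [dot, Finset.mul_sum]
    exact Finset.sum_congr rfl fun i _ => by ring
  have e1 : ∫ Z, dot (fun Z => w Z * φ Z) (fun Z => w Z * φ Z) Z ∂(μ a) =
      (∫ Z, dot w (fun Z => w Z * φ Z ^ 2) Z ∂(μ a)) + ∫ Z, w Z ^ 2 * dot φ φ Z ∂(μ a) := by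
    rw [← integral_add i1 i2]
    refine integral_congr_ae ?_
    filter_upwards [ae_mem_halfSpace a] with Z hZ
    exact dot_mul_self (hE.differentiableAt hZ) (hφ.differentiableAt Z)
  have h1 := (hC _ hη.energy hη.bddSupp).2
  set A := ∫ Z, dot (fun Z => w Z * φ Z) (fun Z => w Z * φ Z) Z ∂(μ a) with hA
  have hA0 : 0 ≤ A := integral_nonneg fun Z => dot_self_nonneg _ Z
  have h2 : M * (1 / (2 * (M + 1)) * A) ≤ A / 2 := by
    have : M / (M + 1) ≤ 1 := by rw [div_le_one (by positivity)]; linarith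
    have h3 : M * (1 / (2 * (M + 1)) * A) = M / (M + 1) * (A / 2) := by field_simp
    rw [h3]
    nlinarith
  have h3 : M * (∫ x, bdry (fun Z => w Z * φ Z) x ^ 2) ≤
      M * (1 / (2 * (M + 1)) * A + C * ∫ Z, (w Z * φ Z) ^ 2 ∂(μ a)) := by gcongr
  nlinarith

end

end Heisenberg

namespace Heisenberg

noncomputable section

/-! ### Horizontal integration by parts -/

variable {a M : ℝ} {f : ℝ → ℝ} {u w ξ φ ψ p : Heis × ℝ → ℝ}

instance : (volume : Measure Heis).IsAddHaarMeasure := by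
  have h2 : ((volume : Measure ℝ).prod (volume : Measure ℝ)).IsAddHaarMeasure := inferInstance
  have h3 : SFinite ((volume : Measure ℝ).prod (volume : Measure ℝ)) := inferInstance
  exact Measure.prod.instIsAddHaarMeasure (volume : Measure ℝ)
    ((volume : Measure ℝ).prod (volume : Measure ℝ))

lemma integral_mul_fderiv_eq_zero {G g : Heis → ℝ} (hG : ContDiff ℝ 1 G)
    (hc : HasCompactSupport G) (hg : ContDiff ℝ 1 g) (v : Heis) (h0 : ∀ x, fderiv ℝ g x v = 0) :
    ∫ x, g x * fderiv ℝ G x v = 0 := by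
  have h1 : Integrable (fun x => g x * fderiv ℝ G x v) := by
    refine Continuous.integrable_of_hasCompactSupport
      (hg.continuous.mul ((hG.continuous_fderiv one_ne_zero).clm_apply continuous_const)) ?_
    exact (hc.fderiv_apply ℝ v).mul_left
  have h2 : Integrable (fun x => g x * G x) :=
    (hg.continuous.mul hG.continuous).integrable_of_hasCompactSupport hc.mul_left
  rw [integral_mul_fderiv_eq_neg_fderiv_mul_of_integrable (by simp [h0]) h1 h2
    (fun x _ => hg.differentiable one_ne_zero x) (fun x _ => hG.differentiable one_ne_zero x)]
  simp [h0]

lemma contDiff_slice (hw : ContDiffOn ℝ 1 w halfSpace) {y : ℝ} (hy : 0 < y) :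
    ContDiff ℝ 1 fun x => w (x, y) := by
  rw [← contDiffOn_univ]
  exact hw.comp (f := fun x => (x, y)) (by fun_prop) fun _ _ => hy

lemma BddSupp.hasCompactSupport_slice (h : BddSupp w) {y : ℝ} (hy : 0 < y) :
    HasCompactSupport fun x => w (x, y) := by
  obtain ⟨r, h0, hr⟩ := h
  refine HasCompactSupport.intro (isCompact_Icc.prod (isCompact_Icc.prod isCompact_Icc))
    (K := Icc (-|r|) |r| ×ˢ Icc (-|r|) |r| ×ˢ Icc (-|r|) |r|) fun x hx => hr (x, y) hy fun h => ?_
  exact hx (halfBall_subset_prod r h).1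

lemma fderiv_slice (hw : ContDiffOn ℝ 1 w halfSpace) {y : ℝ} (hy : 0 < y) (x v : Heis) :
    fderiv ℝ (fun x => w (x, y)) x v = fderiv ℝ w (x, y) (v, 0) := by
  have h1 : HasFDerivAt (fun x : Heis => (x, y)) (ContinuousLinearMap.inl ℝ Heis ℝ) x :=
    hasFDerivAt_prodMk_left x y
  have := ((differentiableAt_of_mem hw (Z := (x, y)) hy).hasFDerivAt.comp x h1).fderiv
  rw [show (fun x => w (x, y)) = w ∘ fun x => (x, y) from rfl, this]
  simp

lemma integral_slice_D_eq_zero (hw : ContDiffOn ℝ 1 w halfSpace) (h : BddSupp w) {y : ℝ}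
    (hy : 0 < y) (i : Fin 3) (hi : i ≠ 2) : ∫ x : Heis, D i w (x, y) = 0 := by
  have hG := contDiff_slice hw hy
  have hc := h.hasCompactSupport_slice hy
  have key : ∀ (g : Heis → ℝ) (b : Heis), ContDiff ℝ 1 g → (∀ x, fderiv ℝ g x (0, 0, 1) = 0) →
      (∀ x, D i w (x, y) = 1 * fderiv ℝ (fun x => w (x, y)) x b +
        g x * fderiv ℝ (fun x => w (x, y)) x (0, 0, 1)) → ∫ x : Heis, D i w (x, y) = 0 := by
    intro g b hg hg0 he
    have hint : ∀ (g : Heis → ℝ) (v : Heis), Continuous g →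
        Integrable fun x => g x * fderiv ℝ (fun x => w (x, y)) x v := fun g v hg =>
      Continuous.integrable_of_hasCompactSupport
        (hg.mul ((hG.continuous_fderiv one_ne_zero).clm_apply continuous_const))
        ((hc.fderiv_apply ℝ v).mul_left)
    rw [integral_congr_ae (ae_of_all _ he), integral_add (hint _ _ continuous_const)
      (hint _ _ hg.continuous),
      integral_mul_fderiv_eq_zero hG hc contDiff_const b (by simp),
      integral_mul_fderiv_eq_zero hG hc hg _ hg0, add_zero]
  have hspl : ∀ (x b : Heis) (c : ℝ), fderiv ℝ w (x, y) ((b.1, b.2.1, c), 0) =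
      fderiv ℝ w (x, y) ((b.1, b.2.1, 0), 0) + c * fderiv ℝ w (x, y) ((0, 0, 1), 0) := by
    intro x b c
    rw [← smul_eq_mul, ← map_smul, ← map_add]
    congr 1
    ext <;> simp
  fin_cases i
  · refine key (fun x => 2 * x.2.1) (1, 0, 0) (by fun_prop) (fun x => ?_) fun x => ?_
    · have : HasFDerivAt (fun x : Heis => 2 * x.2.1)
          ((2 : ℝ) • (ContinuousLinearMap.fst ℝ ℝ ℝ).comp
            (ContinuousLinearMap.snd ℝ ℝ (ℝ × ℝ))) x :=
        (((ContinuousLinearMap.fst ℝ ℝ ℝ).comp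
          (ContinuousLinearMap.snd ℝ ℝ (ℝ × ℝ))).hasFDerivAt).const_mul 2
      rw [this.fderiv]; simp
    · rw [fderiv_slice hw hy, fderiv_slice hw hy, one_mul, ← hspl x (1, 0, 0)]
      simp [D, along, frame, affineField]
  · refine key (fun x => -2 * x.1) (0, 1, 0) (by fun_prop) (fun x => ?_) fun x => ?_
    · have : HasFDerivAt (fun x : Heis => -2 * x.1)
          ((-2 : ℝ) • (ContinuousLinearMap.fst ℝ ℝ (ℝ × ℝ))) x :=
        ((ContinuousLinearMap.fst ℝ ℝ (ℝ × ℝ)).hasFDerivAt).const_mul (-2)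
      rw [this.fderiv]; simp
    · rw [fderiv_slice hw hy, fderiv_slice hw hy, one_mul, ← hspl x (0, 1, 0)]
      simp [D, along, frame, affineField]
  · exact absurd rfl hi

lemma integral_D_eq_zero (hw : ContDiffOn ℝ 1 w halfSpace) (h : BddSupp w) (i : Fin 3)
    (hi : i ≠ 2) (hint : Integrable (D i w) (μ a)) : ∫ Z, D i w Z ∂(μ a) = 0 := by
  rw [μ, integral_prod_symm _ hint]
  refine integral_eq_zero_of_ae ?_
  filter_upwards [ae_weightMeasure a] with y hy
  exact integral_slice_D_eq_zero hw h hy i hi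

/-- Integration by parts on horizontal slices. -/
lemma integral_slice_D_mul (hp : ContDiffOn ℝ 1 p halfSpace) (hψ : ContDiffOn ℝ 1 ψ halfSpace)
    (h : BddSupp ψ) {y : ℝ} (hy : 0 < y) (i : Fin 3) (hi : i ≠ 2) :
    ∫ x : Heis, D i p (x, y) * ψ (x, y) = - ∫ x : Heis, p (x, y) * D i ψ (x, y) := by
  have h0 := integral_slice_D_eq_zero (hp.mul hψ) (h.mul_left p) hy i hi
  have i1 : Integrable fun x : Heis => D i p (x, y) * ψ (x, y) :=
    ((continuous_horizontal (continuousOn_D hp i) hy).mul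
      (continuous_horizontal hψ.continuousOn hy)).integrable_of_hasCompactSupport
      (h.hasCompactSupport_slice hy).mul_left
  have i2 : Integrable fun x : Heis => p (x, y) * D i ψ (x, y) :=
    ((continuous_horizontal hp.continuousOn hy).mul
      (continuous_horizontal (continuousOn_D hψ i) hy)).integrable_of_hasCompactSupport
      ((h.D i).hasCompactSupport_slice hy).mul_left
  have h1 : ∀ x : Heis, D i (fun Z => p Z * ψ Z) (x, y) =
      p (x, y) * D i ψ (x, y) + D i p (x, y) * ψ (x, y) := fun x =>
    along_mul (differentiableAt_of_mem hp hy) (differentiableAt_of_mem hψ hy)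
  have h0' : ∫ x : Heis, (p (x, y) * D i ψ (x, y) + D i p (x, y) * ψ (x, y)) = 0 :=
    (integral_congr_ae (ae_of_all _ fun x => (h1 x).symm)).trans h0
  rw [integral_add i2 i1] at h0'
  linarith

/-! ### The vertical derivative -/

lemma abs_integral_slice_R_mul_le (hu : ContDiffOn ℝ 2 u halfSpace)
    (hψ : ContDiffOn ℝ 1 ψ halfSpace) {C r : ℝ} (h : BddSupp ψ)
    (hr : ∀ i, ∀ Z ∈ halfSpace, Z ∉ halfBall r → D i ψ Z = 0) {s : ℝ}
    (hC : ∀ i ≠ 2, ∀ Z ∈ halfBall r, |D i u (flow (0, 0, -4) s Z)| ≤ C) {y : ℝ} (hy : 0 < y) :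
    |∫ x : Heis, R (0, 0, -4) u (flow (0, 0, -4) s (x, y)) * ψ (x, y)| ≤
      C * ∫ x : Heis, (|D 0 ψ (x, y)| + |D 1 ψ (x, y)|) := by
  have hP : ∀ i, ContDiffOn ℝ 1 (fun Z => D i u (flow (0, 0, -4) s Z)) halfSpace :=
    fun i => contDiffOn_comp_flow (contDiffOn_D hu i) _ s
  have hcD : ∀ i, Continuous fun x : Heis => D i ψ (x, y) :=
    fun i => continuous_horizontal (continuousOn_D hψ i) hy
  have hsD : ∀ i, HasCompactSupport fun x : Heis => D i ψ (x, y) :=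
    fun i => (h.D i).hasCompactSupport_slice hy
  have i1 : ∀ i j, Integrable fun x : Heis =>
      D i (fun Z => D j u (flow (0, 0, -4) s Z)) (x, y) * ψ (x, y) := fun i j =>
    ((continuous_horizontal (continuousOn_D (hP j) i) hy).mul
      (continuous_horizontal hψ.continuousOn hy)).integrable_of_hasCompactSupport
      (h.hasCompactSupport_slice hy).mul_left
  have i2 : ∀ i j, Integrable fun x : Heis =>
      D j u (flow (0, 0, -4) s (x, y)) * D i ψ (x, y) := fun i j =>
    ((continuous_horizontal (hP j).continuousOn hy).mul (hcD i)).integrable_of_hasCompactSupport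
      (hsD i).mul_left
  have e1 : ∫ x : Heis, R (0, 0, -4) u (flow (0, 0, -4) s (x, y)) * ψ (x, y) =
      ∫ x : Heis, (D 0 u (flow (0, 0, -4) s (x, y)) * D 1 ψ (x, y) -
        D 1 u (flow (0, 0, -4) s (x, y)) * D 0 ψ (x, y)) := by
    rw [integral_sub (i2 1 0) (i2 0 1)]
    have e2 := integral_slice_D_mul (hP 1) hψ h hy 0 (by decide)
    have e3 := integral_slice_D_mul (hP 0) hψ h hy 1 (by decide)
    have e4 : ∫ x : Heis, R (0, 0, -4) u (flow (0, 0, -4) s (x, y)) * ψ (x, y) =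
        ∫ x : Heis, (D 0 (fun Z => D 1 u (flow (0, 0, -4) s Z)) (x, y) * ψ (x, y) -
          D 1 (fun Z => D 0 u (flow (0, 0, -4) s Z)) (x, y) * ψ (x, y)) := by
      refine integral_congr_ae (ae_of_all _ fun x => ?_)
      have hZ : (x, y) ∈ halfSpace := hy
      simp only
      rw [D_comp_flow (contDiffOn_D hu 1) _ s hZ, D_comp_flow (contDiffOn_D hu 0) _ s hZ,
        ← commutator_X_Y hu (flow_mem_halfSpace.2 hZ)]
      ring
    rw [e4, integral_sub (i1 0 1) (i1 1 0), e2, e3]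
    ring
  rw [e1, ← integral_const_mul, ← Real.norm_eq_abs]
  refine norm_integral_le_of_norm_le ((Continuous.integrable_of_hasCompactSupport
    ((hcD 0).abs.add (hcD 1).abs) ((hsD 0).norm.add (hsD 1).norm)).const_mul C)
    (ae_of_all _ fun x => ?_)
  by_cases hZ : (x, y) ∈ halfBall r
  · have h0 := hC 0 (by decide) _ hZ
    have h1 := hC 1 (by decide) _ hZ
    refine (norm_sub_le _ _).trans ?_
    simp only [norm_mul, Real.norm_eq_abs]
    have := mul_le_mul_of_nonneg_right h0 (abs_nonneg (D 1 ψ (x, y)))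
    have := mul_le_mul_of_nonneg_right h1 (abs_nonneg (D 0 ψ (x, y)))
    linarith
  · simp [hr 0 (x, y) hy hZ, hr 1 (x, y) hy hZ]

lemma abs_integral_slice_quot_mul_le (hu : ContDiffOn ℝ 2 u halfSpace)
    (hψ : ContDiffOn ℝ 1 ψ halfSpace) {C r : ℝ} (h : BddSupp ψ)
    (hr : ∀ i, ∀ Z ∈ halfSpace, Z ∉ halfBall r → D i ψ Z = 0)
    (hC : ∀ i ≠ 2, ∀ Z ∈ halfBall r, ∀ s ∈ Ioc (0 : ℝ) 1, |D i u (flow (0, 0, -4) s Z)| ≤ C)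
    {t : ℝ} (ht : t ∈ Ioc (0 : ℝ) 1) {y : ℝ} (hy : 0 < y) :
    |∫ x : Heis, quot (0, 0, -4) t u (x, y) * ψ (x, y)| ≤
      C * ∫ x : Heis, (|D 0 ψ (x, y)| + |D 1 ψ (x, y)|) := by
  have hu1 : ContDiffOn ℝ 1 u halfSpace := hu.of_le (by norm_num)
  set B := C * ∫ x : Heis, (|D 0 ψ (x, y)| + |D 1 ψ (x, y)|) with hB
  let F : ℝ → Heis → ℝ := fun s x => R (0, 0, -4) u (flow (0, 0, -4) s (x, y)) * ψ (x, y)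
  have hF : Continuous (Function.uncurry F) := by
    refine Continuous.mul ?_ ((continuous_horizontal hψ.continuousOn hy).comp continuous_snd)
    refine continuousOn_univ.1 ((continuousOn_R hu1 (0, 0, -4)).comp
      (f := fun p : ℝ × Heis => flow (0, 0, -4) p.1 (p.2, y)) ?_ fun p _ => ?_)
    · exact ((continuous_flow_uncurry (0, 0, -4)).comp
        (by fun_prop : Continuous fun p : ℝ × Heis => (p.1, (p.2, y)))).continuousOn
    · exact flow_mem_halfSpace.2 hy
  have hK := h.hasCompactSupport_slice hy
  have hFi : Integrable (Function.uncurry F) ((volume.restrict (Ioc 0 t)).prod volume) := by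
    obtain ⟨c, hc⟩ := (isCompact_Icc.prod hK.isCompact).exists_bound_of_continuousOn
      (s := Icc 0 t ×ˢ tsupport fun x => ψ (x, y)) hF.continuousOn
    have h1 : Integrable (fun _ : ℝ => c) (volume.restrict (Ioc 0 t)) := integrable_const c
    have h2 : Integrable ((tsupport fun x => ψ (x, y)).indicator fun _ => (1 : ℝ)) :=
      (integrable_indicator_iff (isClosed_tsupport _).measurableSet).2
        (integrableOn_const hK.isCompact.measure_lt_top.ne)
    refine (h1.mul_prod h2).mono' hF.aestronglyMeasurable ?_
    have h3 : ∀ᵐ z ∂((volume.restrict (Ioc 0 t)).prod (volume : Measure Heis)), z.1 ∈ Ioc 0 t :=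
      Measure.quasiMeasurePreserving_fst.ae (ae_restrict_mem measurableSet_Ioc)
    filter_upwards [h3] with z hz
    by_cases hz2 : z.2 ∈ tsupport fun x => ψ (x, y)
    · simpa [indicator_of_mem hz2] using hc z ⟨Ioc_subset_Icc_self hz, hz2⟩
    · have : ψ (z.2, y) = 0 :=
        image_eq_zero_of_notMem_tsupport (f := fun x => ψ (x, y)) hz2
      simp [indicator_of_notMem hz2, Function.uncurry_def, F, this]
  have e1 : ∫ x : Heis, quot (0, 0, -4) t u (x, y) * ψ (x, y) =
      t⁻¹ * ∫ s in Ioc 0 t, ∫ x : Heis, F s x := by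
    rw [integral_integral_swap hFi, ← integral_const_mul]
    refine integral_congr_ae (ae_of_all _ fun x => ?_)
    simp only [F]
    rw [quot_eq_integral hu1 _ _ hy, intervalIntegral.integral_of_le ht.1.le, integral_mul_const,
      mul_assoc]
  have e2 : ‖∫ s in Ioc 0 t, ∫ x : Heis, F s x‖ ≤ B * t := by
    have := norm_setIntegral_le_of_norm_le_const (μ := volume) (s := Ioc (0 : ℝ) t) (C := B)
      (f := fun s => ∫ x : Heis, F s x) (by simp) fun s hs =>
        abs_integral_slice_R_mul_le hu hψ h hr
          (fun i hi Z hZ => hC i hi Z hZ s ⟨hs.1, hs.2.trans ht.2⟩) hy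
    simpa [ht.1.le] using this
  rw [e1, abs_mul, abs_of_pos (inv_pos.2 ht.1), inv_mul_le_iff₀ ht.1, mul_comm t B]
  exact e2

/-- The vertical difference quotients are controlled by horizontal derivatives. -/
lemma integral_quot_mul_le (hu : ContDiffOn ℝ 2 u halfSpace) (ha : -1 < a) (hus : LocSq a u)
    (hψ : Energy a ψ) {C r : ℝ} (h : BddSupp ψ)
    (hr : ∀ i, ∀ Z ∈ halfSpace, Z ∉ halfBall r → D i ψ Z = 0)
    (hC : ∀ i ≠ 2, ∀ Z ∈ halfBall r, ∀ s ∈ Ioc (0 : ℝ) 1, |D i u (flow (0, 0, -4) s Z)| ≤ C)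
    (hC0 : 0 ≤ C) {t : ℝ} (ht : t ∈ Ioc (0 : ℝ) 1) {κ : ℝ} (hκ : 0 < κ) :
    ∫ Z, quot (0, 0, -4) t u Z * ψ Z ∂(μ a) ≤
      C * (κ * (∫ Z, dot ψ ψ Z ∂(μ a)) + 1 / (2 * κ) * (μ a).real (halfBall r)) := by
  have i1 := (hus.quot (0, 0, -4) t).integrable_mul hψ.locSq h
  have i2 := hψ.integrable_dot hψ h
  have i3 : Integrable ((halfBall r).indicator fun _ => (1 : ℝ)) (μ a) :=
    (integrable_indicator_iff (measurableSet_halfBall r)).2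
      (integrableOn_const (μ_halfBall_lt_top ha r).ne)
  have i4 := (i2.const_mul κ).add (i3.const_mul (1 / (2 * κ)))
  have hpt : ∀ Z ∈ halfSpace, |D 0 ψ Z| + |D 1 ψ Z| ≤
      κ * dot ψ ψ Z + 1 / (2 * κ) * (halfBall r).indicator (fun _ => (1 : ℝ)) Z := by
    intro Z hZ
    by_cases hZr : Z ∈ halfBall r
    · rw [indicator_of_mem hZr, dot, Fin.sum_univ_three]
      have key : ∀ b : ℝ, |b| ≤ κ * (b * b) + 1 / (4 * κ) := fun b => by
        have : κ * (b * b) + 1 / (4 * κ) - |b| = κ * (|b| - 1 / (2 * κ)) ^ 2 := by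
          rw [← abs_mul_abs_self b]; field_simp; ring
        have h2 : 0 ≤ κ * (|b| - 1 / (2 * κ)) ^ 2 := by positivity
        linarith
      have h1 := key (D 0 ψ Z)
      have h2 := key (D 1 ψ Z)
      have h3 : 1 / (2 * κ) = 1 / (4 * κ) + 1 / (4 * κ) := by field_simp; norm_num
      have h4 : 0 ≤ κ * (D 2 ψ Z * D 2 ψ Z) := mul_nonneg hκ.le (mul_self_nonneg _)
      rw [h3]; nlinarith
    · simp [hr 0 Z hZ hZr, hr 1 Z hZ hZr, indicator_of_notMem hZr, dot_self_nonneg, hκ.le,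
        mul_nonneg]
  have i5 : Integrable (fun Z => |D 0 ψ Z| + |D 1 ψ Z|) (μ a) := by
    refine i4.mono' ((hψ.locSq_D 0).aesm.norm.add (hψ.locSq_D 1).aesm.norm) ?_
    filter_upwards [ae_mem_halfSpace a] with Z hZ
    rw [Real.norm_of_nonneg (by positivity)]
    exact hpt Z hZ
  have h1 : ∫ Z, quot (0, 0, -4) t u Z * ψ Z ∂(μ a) ≤
      C * ∫ Z, (|D 0 ψ Z| + |D 1 ψ Z|) ∂(μ a) := by
    rw [μ, integral_prod_symm _ i1, integral_prod_symm _ i5, ← integral_const_mul]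
    refine (Real.le_norm_self _).trans (norm_integral_le_of_norm_le
      (i5.integral_prod_right.const_mul C) ?_)
    filter_upwards [ae_weightMeasure a] with y hy
    exact abs_integral_slice_quot_mul_le hu hψ.contDiffOn h hr hC ht hy
  refine h1.trans ?_
  have h2 : ∫ Z, (|D 0 ψ Z| + |D 1 ψ Z|) ∂(μ a) ≤
      κ * (∫ Z, dot ψ ψ Z ∂(μ a)) + 1 / (2 * κ) * (μ a).real (halfBall r) := by
    have e : ∫ Z, ((halfBall r).indicator fun _ => (1 : ℝ)) Z ∂(μ a) = (μ a).real (halfBall r) := by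
      rw [integral_indicator (measurableSet_halfBall r)]; simp
    rw [← e, ← integral_const_mul, ← integral_const_mul,
      ← integral_add (i2.const_mul κ) (i3.const_mul _)]
    refine integral_mono_ae i5 i4 ?_
    filter_upwards [ae_mem_halfSpace a] with Z hZ using hpt Z hZ
  gcongr

lemma dot_sq_le (hφ : DifferentiableAt ℝ φ Z) {B : ℝ} (hB : ∀ i, |D i φ Z| ≤ B) :
    dot (fun Z => φ Z ^ 2) (fun Z => φ Z ^ 2) Z ≤ 12 * B ^ 2 * φ Z ^ 2 := by
  have h3 : ∀ i, D i (fun Z => φ Z ^ 2) Z = 2 * φ Z * D i φ Z := fun i => by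
    have := along_mul (V := frame i) hφ hφ
    simp only [pow_two]
    unfold D
    rw [this]; ring
  simp only [dot, h3]
  have h4 : ∀ i, D i φ Z ^ 2 ≤ B ^ 2 := fun i => by
    rw [← sq_abs]; gcongr; exact hB i
  calc ∑ i, 2 * φ Z * D i φ Z * (2 * φ Z * D i φ Z) = ∑ i, 4 * φ Z ^ 2 * D i φ Z ^ 2 :=
        Finset.sum_congr rfl fun i _ => by ring
    _ ≤ ∑ _i : Fin 3, 4 * φ Z ^ 2 * B ^ 2 := Finset.sum_le_sum fun i _ =>
        mul_le_mul_of_nonneg_left (h4 i) (by positivity)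
    _ = _ := by simp; ring

lemma BoundarySolution.exists_bound_quot_center (hu : BoundarySolution a M f u)
    (hb : ∀ i ≠ 2, LocBdd (D i u)) (hφ : Cutoff φ) :
    ∃ C, ∀ t ∈ Ioc (0 : ℝ) 1, ∫ Z, (quot (0, 0, -4) t u Z * φ Z) ^ 2 ∂(μ a) ≤ C := by
  obtain ⟨C₁, hC₁, hcac⟩ := hu.exists_caccioppoli
  obtain ⟨B, hB0, hB⟩ := hφ.exists_bound
  obtain ⟨r, h0, hr⟩ := hφ.bddSupp
  obtain ⟨r', -, hr'⟩ := exists_flow_halfBall (0, 0, -4) (r + 1)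
  obtain ⟨c0, hc0⟩ := (hb 0 (by decide)).bound r'
  obtain ⟨c1, hc1⟩ := (hb 1 (by decide)).bound r'
  set C := |c0| + |c1| with hC
  have hCb : ∀ i ≠ 2, ∀ Z ∈ halfBall (r + 1), ∀ s ∈ Ioc (0 : ℝ) 1,
      |D i u (flow (0, 0, -4) s Z)| ≤ C := by
    intro i hi Z hZ s hs
    have hmem := hr' s (by rw [abs_of_pos hs.1]; exact hs.2) Z hZ
    have h2 := (hc0 _ hmem).trans (le_abs_self _)
    have h3 := (hc1 _ hmem).trans (le_abs_self _)
    fin_cases i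
    · exact h2.trans (by rw [hC]; linarith [abs_nonneg c1])
    · exact h3.trans (by rw [hC]; linarith [abs_nonneg c0])
    · exact absurd rfl hi
  have hC0 : 0 ≤ C := by positivity
  set C₂ := C₁ * B ^ 2 + 24 * B ^ 2 with hC₂
  have hC₂0 : 0 ≤ C₂ := by positivity
  set κ := 1 / (2 * (C * C₂ + 1)) with hκ
  have hκ0 : 0 < κ := by positivity
  refine ⟨2 * (C * (1 / (2 * κ) * (μ a).real (halfBall (r + 1)))), fun t ht => ?_⟩
  set w := quot (0, 0, -4) t u with hw
  have hE : Energy a w := hu.energy.quot _ t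
  have hwb : LocBdd w := hu.locBdd_quot _ t
  have hψ := hE.admissible_mul_cutoff hwb hφ.sq
  have hψr : ∀ i, ∀ Z ∈ halfSpace, Z ∉ halfBall (r + 1) → D i (fun Z => w Z * φ Z ^ 2) Z = 0 := by
    intro i Z hZ hZr
    have hφ0 : φ Z = 0 := hr Z hZ fun h => hZr (halfBall_mono h0.le (by linarith) h)
    have h4 : D i (fun Z => w Z * φ Z ^ 2) Z =
        w Z * D i (fun Z => φ Z ^ 2) Z + D i w Z * φ Z ^ 2 :=
      along_mul (hE.differentiableAt hZ) (hφ.sq.differentiableAt Z)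
    have h5 : D i (fun Z => φ Z ^ 2) Z = φ Z * D i φ Z + D i φ Z * φ Z := by
      simp only [pow_two]
      exact along_mul (hφ.differentiableAt Z) (hφ.differentiableAt Z)
    rw [h4, h5, hφ0]; ring
  set I := ∫ Z, (w Z * φ Z) ^ 2 ∂(μ a) with hI
  have hI0 : 0 ≤ I := integral_nonneg fun Z => sq_nonneg _
  have hwφ := hE.admissible_mul_cutoff hwb hφ
  have iI : Integrable (fun Z => (w Z * φ Z) ^ 2) (μ a) :=
    hwφ.energy.locSq.integrable_sq hwφ.bddSupp
  have h1 := integral_quot_mul_le hu.smooth hu.weight.1 hu.energy.locSq hψ.energy hψ.bddSupp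
    hψr hCb hC0 ht hκ0
  have e1 : ∫ Z, w Z * (w Z * φ Z ^ 2) ∂(μ a) = I :=
    integral_congr_ae (ae_of_all _ fun Z => by simp only; ring)
  rw [← hw, e1] at h1
  have h2 := hcac _ hφ.sq (0, 0, -4) t
  rw [← hw] at h2
  have h3 : ∫ Z, (w Z * φ Z ^ 2) ^ 2 ∂(μ a) ≤ B ^ 2 * I := by
    rw [hI, ← integral_const_mul]
    refine integral_mono (hψ.energy.locSq.integrable_sq hψ.bddSupp) (iI.const_mul _) fun Z => ?_
    simp only
    have h4 : φ Z ^ 2 ≤ B ^ 2 := by rw [← sq_abs]; gcongr; exact (hB Z).1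
    have : (w Z * φ Z ^ 2) ^ 2 = φ Z ^ 2 * (w Z * φ Z) ^ 2 := by ring
    rw [this]; gcongr
  have h4 : ∫ Z, w Z ^ 2 * dot (fun Z => φ Z ^ 2) (fun Z => φ Z ^ 2) Z ∂(μ a) ≤
      12 * B ^ 2 * I := by
    rw [hI, ← integral_const_mul]
    refine integral_mono_of_nonneg (ae_of_all _ fun Z => ?_) (iI.const_mul _)
      (ae_of_all _ fun Z => ?_)
    · exact mul_nonneg (sq_nonneg _) (dot_self_nonneg _ _)
    · have := dot_sq_le (hφ.differentiableAt Z) (fun i => (hB Z).2 i)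
      simp only
      calc _ ≤ w Z ^ 2 * (12 * B ^ 2 * φ Z ^ 2) := by gcongr
        _ = _ := by ring
  have h5 : ∫ Z, dot (fun Z => w Z * φ Z ^ 2) (fun Z => w Z * φ Z ^ 2) Z ∂(μ a) ≤ C₂ * I := by
    refine h2.trans ?_
    rw [hC₂]
    nlinarith [mul_le_mul_of_nonneg_left h3 hC₁]
  have h6 : C * (κ * (C₂ * I)) ≤ I / 2 := by
    have : C * (κ * (C₂ * I)) = (C * C₂) / (C * C₂ + 1) * (I / 2) := by rw [hκ]; field_simp
    rw [this]
    have h7 : (C * C₂) / (C * C₂ + 1) ≤ 1 := by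
      rw [div_le_one (by positivity)]; linarith
    nlinarith
  have h7 : C * (κ * (∫ Z, dot (fun Z => w Z * φ Z ^ 2) (fun Z => w Z * φ Z ^ 2) Z ∂(μ a))) ≤
      C * (κ * (C₂ * I)) := by gcongr
  nlinarith

/-! ### Passage to the limit -/

lemma eLpNorm_le_of_integral_sq_le {α : Type*} [MeasurableSpace α] {ν : Measure α} {g : α → ℝ}
    (hg : MemLp g 2 ν) {C : ℝ} (h : ∫ Z, g Z ^ 2 ∂ν ≤ C) :
    eLpNorm g 2 ν ≤ ENNReal.ofReal (Real.sqrt C) := by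
  rw [hg.eLpNorm_eq_integral_rpow_norm (by norm_num) (by norm_num)]
  refine ENNReal.ofReal_le_ofReal ?_
  simp only [ENNReal.toReal_ofNat, Real.rpow_ofNat, Real.norm_eq_abs, sq_abs]
  rw [Real.sqrt_eq_rpow, one_div]
  exact Real.rpow_le_rpow (integral_nonneg fun Z => sq_nonneg _) h (by norm_num)

/-- Fatou's lemma for local square integrability. -/
lemma locSq_of_tendsto (hp : ContinuousOn p halfSpace) (P : ℝ → Heis × ℝ → ℝ)
    (hP : ∀ t, LocSq a (P t))
    (hlim : ∀ Z ∈ halfSpace, Tendsto (fun t => P t Z) (𝓝[>] 0) (𝓝 (p Z)))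
    (hbd : ∀ φ, Cutoff φ → ∃ C, ∀ᶠ t in 𝓝[>] (0 : ℝ), ∫ Z, (P t Z * φ Z) ^ 2 ∂(μ a) ≤ C) :
    LocSq a p := by
  refine ⟨hp, fun r => ?_⟩
  obtain ⟨φ, hφ, -, h1⟩ := exists_cutoff_halfBall r
  obtain ⟨C, hC⟩ := hbd φ hφ
  have hm := (aestronglyMeasurable_of_continuousOn hp a).restrict (s := halfBall r)
  have hs : Tendsto (fun n : ℕ => (1 : ℝ) / (n + 1)) atTop (𝓝[>] 0) :=
    tendsto_nhdsWithin_iff.2 ⟨tendsto_one_div_add_atTop_nhds_zero_nat,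
      Eventually.of_forall fun n => by simp only [mem_Ioi]; positivity⟩
  refine ⟨hm, lt_of_le_of_lt (Lp.eLpNorm_lim_le_liminf_eLpNorm
    (f := fun n : ℕ => P (1 / (n + 1))) (fun n => (hP _).aesm.restrict) p ?_)
    (lt_of_le_of_lt (liminf_le_of_le (by isBoundedDefault) (a := ENNReal.ofReal (Real.sqrt C))
      fun b hb => ?_) ENNReal.ofReal_lt_top)⟩
  · filter_upwards [ae_restrict_mem (measurableSet_halfBall r)] with Z hZ
    exact (hlim Z hZ.1).comp hs
  · obtain ⟨n, hn, hCn⟩ := (hb.and (hs.eventually hC)).exists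
    refine hn.trans ?_
    have hint := ((hP (1 / (n + 1))).mul_bdd hφ.locBdd).integrable_sq (hφ.bddSupp.mul_left _)
    refine eLpNorm_le_of_integral_sq_le ((hP _).memLp r) (le_trans ?_ hCn)
    have e : ∫ Z in halfBall r, P (1 / (n + 1)) Z ^ 2 ∂(μ a) =
        ∫ Z in halfBall r, (P (1 / (n + 1)) Z * φ Z) ^ 2 ∂(μ a) :=
      setIntegral_congr_fun (measurableSet_halfBall r) fun Z hZ => by simp [h1 Z hZ]
    rw [e]
    exact setIntegral_le_integral hint (ae_of_all _ fun Z => sq_nonneg _)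

lemma tendsto_quot_right (hu : ContDiffOn ℝ 1 u halfSpace) (q : Heis) {Z : Heis × ℝ}
    (hZ : Z ∈ halfSpace) : Tendsto (fun t => quot q t u Z) (𝓝[>] 0) (𝓝 (R q u Z)) :=
  (tendsto_quot hu q hZ).mono_left (nhdsWithin_mono _ fun _ hx => ne_of_gt hx)

/-- The vertical derivative of a solution is locally square integrable up to the boundary. -/
lemma BoundarySolution.locSq_center (hu : BoundarySolution a M f u)
    (hb : ∀ i ≠ 2, LocBdd (D i u)) : LocSq a (R (0, 0, -4) u) :=
  locSq_of_tendsto (continuousOn_R hu.contDiffOn _) (fun t => Heisenberg.quot (0, 0, -4) t u)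
    (fun t => hu.energy.locSq.quot _ t) (fun _ hZ => tendsto_quot_right hu.contDiffOn _ hZ)
    fun _ hφ => let ⟨C, hC⟩ := hu.exists_bound_quot_center hb hφ
      ⟨C, by filter_upwards [Ioc_mem_nhdsGT one_pos] with t ht using hC t ht⟩

end

end Heisenberg

namespace Heisenberg

noncomputable section

variable {a M : ℝ} {f : ℝ → ℝ} {u v w ξ φ ψ p : Heis × ℝ → ℝ}

/-! ### Convergence of difference quotients in the weighted space -/

lemma LocSq.integrableOn_sq (hp : LocSq a p) (r : ℝ) :
    IntegrableOn (fun Z => p Z ^ 2) (halfBall r) (μ a) := (hp.memLp r).integrable_sq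

lemma setIntegral_comp_flow_sq_le (hp : LocSq a p) {q : Heis} {r r' : ℝ}
    (hr : ∀ t : ℝ, |t| ≤ 1 → ∀ Z ∈ halfBall r, flow q t Z ∈ halfBall r') {s : ℝ} (hs : |s| ≤ 1) :
    ∫ Z in halfBall r, p (flow q s Z) ^ 2 ∂(μ a) ≤ ∫ Z in halfBall r', p Z ^ 2 ∂(μ a) := by
  have h1 : Integrable ((halfBall r').indicator fun Z => p Z ^ 2) (μ a) :=
    (integrable_indicator_iff (measurableSet_halfBall r')).2 (hp.integrableOn_sq r')
  rw [← integral_indicator (measurableSet_halfBall r'), ← integral_comp_flow a q s,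
    ← integral_indicator (measurableSet_halfBall r)]
  refine integral_mono_of_nonneg (ae_of_all _ fun Z => indicator_nonneg (fun _ _ => sq_nonneg _) _)
    ((measurePreserving_flow a q s).integrable_comp_of_integrable h1) (ae_of_all _ fun Z => ?_)
  by_cases hZ : Z ∈ halfBall r
  · simp [hZ, hr s hs Z hZ]
  · simp only [indicator_of_notMem hZ]
    exact indicator_nonneg (fun _ _ => sq_nonneg _) _

/-- Truncation of real values at height `N`. -/
def clamp (N s : ℝ) : ℝ := max (-N) (min s N)

lemma continuous_clamp (N : ℝ) : Continuous (clamp N) := by unfold clamp; fun_prop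

lemma abs_clamp_le {N : ℝ} (hN : 0 ≤ N) (s : ℝ) : |clamp N s| ≤ N := by
  rw [abs_le]; unfold clamp
  exact ⟨le_max_left _ _, max_le (by linarith) (min_le_right _ _)⟩

lemma clamp_of_abs_le {N s : ℝ} (h : |s| ≤ N) : clamp N s = s := by
  rw [abs_le] at h; unfold clamp
  rw [min_eq_left h.2, max_eq_right h.1]

lemma abs_sub_clamp_le {N : ℝ} (hN : 0 ≤ N) (s : ℝ) : |s - clamp N s| ≤ |s| := by
  unfold clamp
  rcases le_total s N with h1 | h1
  · rw [min_eq_left h1]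
    rcases le_total (-N) s with h2 | h2
    · rw [max_eq_right h2]; simp
    · rw [max_eq_left h2, abs_of_nonpos (by linarith), abs_of_nonpos (by linarith)]; linarith
  · rw [min_eq_right h1, max_eq_right (by linarith), abs_of_nonneg (by linarith),
      abs_of_nonneg (by linarith)]; linarith

lemma LocSq.sub_clamp (hp : LocSq a p) {N : ℝ} (hN : 0 ≤ N) :
    LocSq a fun Z => p Z - clamp N (p Z) :=
  hp.mono (hp.continuousOn.sub ((continuous_clamp N).comp_continuousOn hp.continuousOn))
    fun _ _ => abs_sub_clamp_le hN _

lemma tendsto_sub_clamp (hp : LocSq a p) (r : ℝ) :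
    Tendsto (fun N : ℕ => ∫ Z in halfBall r, (p Z - clamp N (p Z)) ^ 2 ∂(μ a))
      atTop (𝓝 0) := by
  have := tendsto_integral_of_dominated_convergence (μ := (μ a).restrict (halfBall r))
    (F := fun (N : ℕ) Z => (p Z - clamp N (p Z)) ^ 2) (f := fun _ => 0)
    (fun Z => p Z ^ 2) (fun N => ((hp.sub_clamp N.cast_nonneg).aesm.restrict).pow 2)
    (hp.integrableOn_sq r) (fun N => ae_of_all _ fun Z => ?_) (ae_of_all _ fun Z => ?_)
  · simpa using this
  · rw [Real.norm_of_nonneg (sq_nonneg _)]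
    exact sq_le_sq.2 (abs_sub_clamp_le N.cast_nonneg _)
  · refine tendsto_const_nhds.congr' ?_
    obtain ⟨n, hn⟩ := exists_nat_ge |p Z|
    filter_upwards [eventually_ge_atTop n] with N hN
    rw [clamp_of_abs_le (hn.trans (by exact_mod_cast hN))]; simp


/-- Left translations act continuously on locally square integrable functions. -/
lemma tendsto_comp_flow_sub (hp : LocSq a p) (ha : -1 < a) (q : Heis) (r : ℝ) :
    Tendsto (fun s => ∫ Z in halfBall r, (p (flow q s Z) - p Z) ^ 2 ∂(μ a)) (𝓝 0) (𝓝 0) := by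
  obtain ⟨r', -, hr'⟩ := exists_flow_halfBall q r
  have hfin : IsFiniteMeasure ((μ a).restrict (halfBall r)) :=
    ⟨by simpa using μ_halfBall_lt_top ha r⟩
  have hg : ∀ N : ℕ, Tendsto (fun s => ∫ Z in halfBall r,
      (clamp N (p (flow q s Z)) - clamp N (p Z)) ^ 2 ∂(μ a)) (𝓝 0) (𝓝 0) := by
    intro N
    have hc := (continuous_clamp N).comp_continuousOn hp.continuousOn
    have := tendsto_integral_filter_of_dominated_convergence (μ := (μ a).restrict (halfBall r))
      (l := 𝓝 (0 : ℝ)) (F := fun s Z => (clamp N (p (flow q s Z)) - clamp N (p Z)) ^ 2)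
      (f := fun _ => 0) (fun _ => (2 * N : ℝ) ^ 2) (Eventually.of_forall fun s =>
        ((aestronglyMeasurable_of_continuousOn
          ((continuousOn_comp_flow hc q s).sub hc) a).restrict).pow 2)
      (Eventually.of_forall fun s => ae_of_all _ fun Z => ?_) (integrable_const _) ?_
    · simpa using this
    · rw [Real.norm_of_nonneg (sq_nonneg _), ← sq_abs]
      have h1 := abs_clamp_le (N := N) N.cast_nonneg (p (flow q s Z))
      have h2 := abs_clamp_le (N := N) N.cast_nonneg (p Z)
      gcongr
      exact (abs_sub _ _).trans (by linarith)
    · filter_upwards [ae_restrict_mem (measurableSet_halfBall r)] with Z hZ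
      have h1 : ContinuousAt (fun s => p (flow q s Z)) 0 := by
        have h2 : ContinuousAt (fun s => flow q s Z) 0 := ((continuous_flow_uncurry q).comp
          (by fun_prop : Continuous fun s : ℝ => (s, Z))).continuousAt
        refine ContinuousAt.comp (f := fun s => flow q s Z) ?_ h2
        rw [flow_zero]
        exact hp.continuousOn.continuousAt (isOpen_halfSpace.mem_nhds hZ.1)
      have h3 : Tendsto (fun s => (clamp N (p (flow q s Z)) - clamp N (p Z)) ^ 2) (𝓝 0)
          (𝓝 ((clamp N (p (flow q 0 Z)) - clamp N (p Z)) ^ 2)) :=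
        ((((continuous_clamp N).continuousAt.comp h1).sub continuousAt_const).pow 2).tendsto
      simpa [flow_zero] using h3
  rw [Metric.tendsto_nhds]
  intro ε hε
  have hT := ((tendsto_sub_clamp hp r).add (tendsto_sub_clamp hp r')).const_mul 3
  simp only [add_zero, mul_zero] at hT
  obtain ⟨N, hN⟩ := ((tendsto_order.1 hT).2 (ε / 2) (by positivity)).exists
  have h1 := (tendsto_order.1 ((hg N).const_mul 3)).2 (ε / 2) (by simpa using by positivity)
  have h2 : ∀ᶠ s in 𝓝 (0 : ℝ), |s| ≤ 1 := by
    filter_upwards [Icc_mem_nhds (by norm_num : (-1 : ℝ) < 0) one_pos] with s hs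
    exact abs_le.2 hs
  filter_upwards [h1, h2] with s hs hs1
  rw [Real.dist_eq, sub_zero, abs_of_nonneg (integral_nonneg fun Z => sq_nonneg _)]
  have hd := hp.sub_clamp (N := N) N.cast_nonneg
  have i1 := (hd.comp_flow q s).integrableOn_sq r
  have i2 := hd.integrableOn_sq r
  have hcl : LocSq a fun Z => clamp N (p Z) := (hp.sub hd).congr fun Z _ => by ring
  have i3 := ((hcl.comp_flow q s).sub hcl).integrableOn_sq r
  have h4 := setIntegral_comp_flow_sq_le hd hr' hs1
  have h5 : ∫ Z in halfBall r, (p (flow q s Z) - p Z) ^ 2 ∂(μ a) ≤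
      ∫ Z in halfBall r, (3 * ((p (flow q s Z) - clamp N (p (flow q s Z))) ^ 2 +
        (p Z - clamp N (p Z)) ^ 2) +
        3 * (clamp N (p (flow q s Z)) - clamp N (p Z)) ^ 2) ∂(μ a) := by
    refine integral_mono_of_nonneg (ae_of_all _ fun Z => sq_nonneg _)
      (((i1.add i2).const_mul 3).add (i3.const_mul 3)) (ae_of_all _ fun Z => ?_)
    simp only
    nlinarith [sq_nonneg ((p (flow q s Z) - clamp N (p (flow q s Z))) + (p Z - clamp N (p Z))),
      sq_nonneg ((p (flow q s Z) - clamp N (p (flow q s Z))) -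
        (clamp N (p (flow q s Z)) - clamp N (p Z))),
      sq_nonneg ((p Z - clamp N (p Z)) + (clamp N (p (flow q s Z)) - clamp N (p Z)))]
  have i12 : IntegrableOn (fun Z => (p (flow q s Z) - clamp N (p (flow q s Z))) ^ 2 +
      (p Z - clamp N (p Z)) ^ 2) (halfBall r) (μ a) := i1.add i2
  rw [integral_add (i12.const_mul 3) (i3.const_mul 3), integral_const_mul,
    integral_add i1 i2, integral_const_mul] at h5
  linarith

lemma sq_integral_le {g : ℝ → ℝ} {t : ℝ} (ht : 0 < t) (hg : ContinuousOn g (Icc 0 t)) :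
    (t⁻¹ * ∫ s in Ioc 0 t, g s) ^ 2 ≤ t⁻¹ * ∫ s in Ioc 0 t, g s ^ 2 := by
  have i1 : IntegrableOn g (Ioc 0 t) := hg.integrableOn_Icc.mono_set Ioc_subset_Icc_self
  have i2 : IntegrableOn (fun s => g s ^ 2) (Ioc 0 t) :=
    (hg.pow 2).integrableOn_Icc.mono_set Ioc_subset_Icc_self
  set m := t⁻¹ * ∫ s in Ioc 0 t, g s with hm
  have h0 : 0 ≤ ∫ s in Ioc 0 t, (g s - m) ^ 2 := integral_nonneg fun s => sq_nonneg _
  have h1 : ∫ s in Ioc 0 t, (g s - m) ^ 2 =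
      (∫ s in Ioc 0 t, g s ^ 2) - 2 * m * (∫ s in Ioc 0 t, g s) + t * m ^ 2 := by
    have e : ∀ s, (g s - m) ^ 2 = g s ^ 2 - 2 * m * g s + m ^ 2 := fun s => by ring
    simp only [e]
    have i3 : IntegrableOn (fun s => g s ^ 2 - 2 * m * g s) (Ioc 0 t) := i2.sub (i1.const_mul _)
    rw [integral_add i3 (integrable_const _), integral_sub i2 (i1.const_mul _),
      integral_const_mul, integral_const]
    simp [ht.le]
  have h2 : ∫ s in Ioc 0 t, g s = t * m := by rw [hm]; field_simp
  rw [h1, h2] at h0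
  rw [← div_eq_inv_mul, le_div_iff₀ ht]
  nlinarith

/-- Difference quotients converge in the weighted space as soon as the derivative belongs to it. -/
lemma tendsto_quot_sub (hv : ContDiffOn ℝ 1 v halfSpace) (hvs : LocSq a v) (ha : -1 < a)
    (q : Heis) (hR : LocSq a (R q v)) (r : ℝ) :
    Tendsto (fun t => ∫ Z in halfBall r, (quot q t v Z - R q v Z) ^ 2 ∂(μ a)) (𝓝[>] 0) (𝓝 0) := by
  rw [Metric.tendsto_nhds]
  intro ε hε
  have h1 := (tendsto_order.1 (tendsto_comp_flow_sub hR ha q r)).2 (ε / 2) (by positivity)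
  obtain ⟨δ, hδ, hδε⟩ := Metric.eventually_nhds_iff.1 h1
  filter_upwards [Ioo_mem_nhdsGT hδ] with t ht
  rw [Real.dist_eq, sub_zero, abs_of_nonneg (integral_nonneg fun Z => sq_nonneg _)]
  refine lt_of_le_of_lt ?_ (half_lt_self hε)
  set ν := (μ a).restrict (halfBall r) with hν
  have hcont : ∀ Z ∈ halfSpace, Continuous fun s => R q v (flow q s Z) := fun Z hZ => by
    refine continuousOn_univ.1 (hR.continuousOn.comp (f := fun s => flow q s Z) ?_
      fun _ _ => flow_mem_halfSpace.2 hZ)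
    exact ((continuous_flow_uncurry q).comp
      (by fun_prop : Continuous fun s : ℝ => (s, Z))).continuousOn
  have hpt : ∀ Z ∈ halfSpace, (quot q t v Z - R q v Z) ^ 2 ≤
      t⁻¹ * ∫ s in Ioc 0 t, (R q v (flow q s Z) - R q v Z) ^ 2 := by
    intro Z hZ
    have hc := ((hcont Z hZ).sub (continuous_const (y := R q v Z))).continuousOn (s := Icc 0 t)
    refine le_trans (le_of_eq ?_) (sq_integral_le ht.1 hc)
    rw [quot_eq_integral hv q t hZ, intervalIntegral.integral_of_le ht.1.le,
      integral_sub ((hcont Z hZ).continuousOn.integrableOn_Icc.mono_set Ioc_subset_Icc_self)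
        (integrable_const _), integral_const]
    have := ht.1.ne'
    simp only [measureReal_restrict_apply_univ, Real.volume_real_Ioc_of_le ht.1.le, sub_zero,
      smul_eq_mul]
    field_simp
  have hmeas : AEMeasurable (Function.uncurry fun Z s =>
      ENNReal.ofReal ((R q v (flow q s Z) - R q v Z) ^ 2))
      (ν.prod (volume.restrict (Ioc 0 t))) := by
    have hc : ContinuousOn (fun p : (Heis × ℝ) × ℝ => (R q v (flow q p.2 p.1) - R q v p.1) ^ 2)
        (halfBall r ×ˢ Ioc 0 t) := by
      refine ((hR.continuousOn.comp (f := fun p : (Heis × ℝ) × ℝ => flow q p.2 p.1) ?_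
        fun p hp => flow_mem_halfSpace.2 hp.1.1).sub
        (hR.continuousOn.comp (f := fun p : (Heis × ℝ) × ℝ => p.1) (by fun_prop)
          fun p hp => hp.1.1)).pow 2
      exact ((continuous_flow_uncurry q).comp
        (by fun_prop : Continuous fun p : (Heis × ℝ) × ℝ => (p.2, p.1))).continuousOn
    rw [hν, Measure.prod_restrict]
    exact (hc.aestronglyMeasurable ((measurableSet_halfBall r).prod
      measurableSet_Ioc)).aemeasurable.ennreal_ofReal
  have hGint : ∀ s, Integrable (fun Z => (R q v (flow q s Z) - R q v Z) ^ 2) ν := fun s =>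
    ((hR.comp_flow q s).sub hR).integrableOn_sq r
  have hL : ∫⁻ Z, ENNReal.ofReal ((quot q t v Z - R q v Z) ^ 2) ∂ν ≤ ENNReal.ofReal (ε / 2) := by
    calc ∫⁻ Z, ENNReal.ofReal ((quot q t v Z - R q v Z) ^ 2) ∂ν
        ≤ ∫⁻ Z, ENNReal.ofReal t⁻¹ *
          (∫⁻ s in Ioc 0 t, ENNReal.ofReal ((R q v (flow q s Z) - R q v Z) ^ 2)) ∂ν := by
          refine lintegral_mono_ae ?_
          filter_upwards [ae_restrict_mem (measurableSet_halfBall r)] with Z hZ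
          rw [← ofReal_integral_eq_lintegral_ofReal, ← ENNReal.ofReal_mul (inv_pos.2 ht.1).le]
          · exact ENNReal.ofReal_le_ofReal (hpt Z hZ.1)
          · exact ((((hcont Z hZ.1).sub continuous_const).pow 2).continuousOn
              |>.integrableOn_Icc).mono_set
              Ioc_subset_Icc_self
          · exact ae_of_all _ fun s => sq_nonneg _
      _ = ENNReal.ofReal t⁻¹ * ∫⁻ Z, (∫⁻ s in Ioc 0 t,
          ENNReal.ofReal ((R q v (flow q s Z) - R q v Z) ^ 2)) ∂ν :=
          lintegral_const_mul'' _ hmeas.lintegral_prod_right'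
      _ = ENNReal.ofReal t⁻¹ * ∫⁻ s in Ioc 0 t, (∫⁻ Z,
          ENNReal.ofReal ((R q v (flow q s Z) - R q v Z) ^ 2) ∂ν) := by
          rw [lintegral_lintegral_swap hmeas]
      _ ≤ ENNReal.ofReal t⁻¹ * ∫⁻ s in Ioc 0 t, ENNReal.ofReal (ε / 2) := by
          refine mul_le_mul_right ?_ _
          refine setLIntegral_mono' measurableSet_Ioc fun s hs => ?_
          rw [← ofReal_integral_eq_lintegral_ofReal (hGint s) (ae_of_all _ fun Z => sq_nonneg _)]
          refine ENNReal.ofReal_le_ofReal (le_of_lt (hδε ?_))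
          rw [Real.dist_eq, sub_zero, abs_of_pos hs.1]
          exact hs.2.trans_lt ht.2
      _ = ENNReal.ofReal (ε / 2) := by
          rw [setLIntegral_const, Real.volume_Ioc, sub_zero, ← ENNReal.ofReal_mul (by positivity),
            ← ENNReal.ofReal_mul (inv_pos.2 ht.1).le]
          congr 1
          have := ht.1.ne'
          field_simp
  have hint : Integrable (fun Z => (quot q t v Z - R q v Z) ^ 2) ν :=
    ((hvs.quot q t).sub hR).integrableOn_sq r
  rw [← ofReal_integral_eq_lintegral_ofReal hint (ae_of_all _ fun Z => sq_nonneg _)] at hL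
  exact (ENNReal.ofReal_le_ofReal_iff (by positivity)).1 hL

end

end Heisenberg

namespace Heisenberg

noncomputable section

variable {a M : ℝ} {f : ℝ → ℝ} {u v w ξ φ ψ p : Heis × ℝ → ℝ}

/-! ### Derivatives along right-invariant fields have finite energy -/

lemma integral_sq_mul_le (hp : LocSq a p) {B r : ℝ}
    (hψ : ∀ Z ∈ halfSpace, 0 ≤ ψ Z ∧ ψ Z ≤ B) (hr : ∀ Z ∈ halfSpace, Z ∉ halfBall r → ψ Z = 0) :
    ∫ Z, p Z ^ 2 * ψ Z ∂(μ a) ≤ B * ∫ Z in halfBall r, p Z ^ 2 ∂(μ a) := by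
  rw [← integral_const_mul, ← integral_indicator (measurableSet_halfBall r)]
  refine integral_mono_of_nonneg ?_ ((integrable_indicator_iff (measurableSet_halfBall r)).2
    ((hp.integrableOn_sq r).const_mul B)) ?_
  · filter_upwards [ae_mem_halfSpace a] with Z hZ
    exact mul_nonneg (sq_nonneg _) (hψ Z hZ).1
  · filter_upwards [ae_mem_halfSpace a] with Z hZ
    by_cases hZr : Z ∈ halfBall r
    · rw [indicator_of_mem hZr, mul_comm]
      exact mul_le_mul_of_nonneg_right (hψ Z hZ).2 (sq_nonneg _)
    · rw [indicator_of_notMem hZr, hr Z hZ hZr, mul_zero]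

lemma Cutoff.exists_bound_dot (hφ : Cutoff φ) : ∃ B r, 0 ≤ B ∧ 0 < r ∧
    (∀ Z, φ Z ^ 2 ≤ B ∧ dot φ φ Z ≤ B) ∧
    ∀ Z ∈ halfSpace, Z ∉ halfBall r → φ Z = 0 ∧ dot φ φ Z = 0 := by
  obtain ⟨B, hB0, hB⟩ := hφ.exists_bound
  obtain ⟨r, hr0, hr⟩ := hφ.bddSupp
  choose ρ hρ0 hρ using fun i => hφ.bddSupp.D i
  have hle : ∀ i, ρ i ≤ r + ∑ i, ρ i := fun i => by
    have := Finset.single_le_sum (f := ρ) (fun j _ => (hρ0 j).le) (Finset.mem_univ i)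
    linarith
  have hs : 0 ≤ ∑ i, ρ i := Finset.sum_nonneg fun j _ => (hρ0 j).le
  refine ⟨3 * B ^ 2, r + ∑ i, ρ i, by positivity, by positivity, fun Z => ⟨?_, ?_⟩,
    fun Z h1 h2 => ⟨?_, ?_⟩⟩
  · have h1 : φ Z ^ 2 ≤ B ^ 2 := by rw [← sq_abs]; gcongr; exact (hB Z).1
    nlinarith [sq_nonneg B]
  · have h1 : ∀ i, D i φ Z * D i φ Z ≤ B ^ 2 := fun i => by
      rw [← pow_two, ← sq_abs]; gcongr; exact (hB Z).2 i
    calc dot φ φ Z ≤ ∑ _i : Fin 3, B ^ 2 := Finset.sum_le_sum fun i _ => h1 i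
      _ = 3 * B ^ 2 := by simp
  · exact hr Z h1 fun h => h2 (halfBall_mono hr0.le (by linarith) h)
  · refine Finset.sum_eq_zero fun i _ => ?_
    rw [hρ i Z h1 fun h => h2 (halfBall_mono (hρ0 i).le (hle i) h), mul_zero]

lemma exists_eventually_quot_sq_le (hv : ContDiffOn ℝ 1 v halfSpace) (hvs : LocSq a v)
    (ha : -1 < a) (q : Heis) (hR : LocSq a (R q v)) (r : ℝ) :
    ∃ C, 0 ≤ C ∧ ∀ᶠ t in 𝓝[>] (0 : ℝ), ∫ Z in halfBall r, quot q t v Z ^ 2 ∂(μ a) ≤ C := by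
  have h1 := (tendsto_order.1 (tendsto_quot_sub hv hvs ha q hR r)).2 1 one_pos
  have h0 : 0 ≤ ∫ Z in halfBall r, R q v Z ^ 2 ∂(μ a) := integral_nonneg fun Z => sq_nonneg _
  refine ⟨2 * 1 + 2 * ∫ Z in halfBall r, R q v Z ^ 2 ∂(μ a), by positivity, ?_⟩
  filter_upwards [h1] with t ht
  have i1 := ((hvs.quot q t).sub hR).integrableOn_sq r
  have i2 := hR.integrableOn_sq r
  have h2 : ∫ Z in halfBall r, quot q t v Z ^ 2 ∂(μ a) ≤
      ∫ Z in halfBall r, (2 * (quot q t v Z - R q v Z) ^ 2 + 2 * R q v Z ^ 2) ∂(μ a) := by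
    refine integral_mono_of_nonneg (ae_of_all _ fun Z => sq_nonneg _)
      ((i1.const_mul 2).add (i2.const_mul 2)) (ae_of_all _ fun Z => ?_)
    simp only
    nlinarith [sq_nonneg (quot q t v Z - R q v Z - R q v Z)]
  rw [integral_add (i1.const_mul 2) (i2.const_mul 2), integral_const_mul, integral_const_mul] at h2
  linarith

lemma sq_mul_D_le (hw : DifferentiableAt ℝ w Z) (hφ : DifferentiableAt ℝ φ Z) (i : Fin 3) :
    (D i w Z * φ Z) ^ 2 ≤ 2 * dot (fun Z => w Z * φ Z) (fun Z => w Z * φ Z) Z +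
      2 * (w Z ^ 2 * dot φ φ Z) := by
  have h1 : D i (fun Z => w Z * φ Z) Z = w Z * D i φ Z + D i w Z * φ Z := along_mul hw hφ
  have h2 := sq_D_le_dot (fun Z => w Z * φ Z) Z i
  have h3 := sq_D_le_dot φ Z i
  have h4 : w Z ^ 2 * D i φ Z ^ 2 ≤ w Z ^ 2 * dot φ φ Z := by gcongr
  rw [h1] at h2
  nlinarith [sq_nonneg (w Z * D i φ Z + D i w Z * φ Z + w Z * D i φ Z)]

lemma integrable_sq_mul_dot (hw : LocSq a w) (hφ : Cutoff φ) :
    Integrable (fun Z => w Z ^ 2 * dot φ φ Z) (μ a) := by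
  have : Integrable (fun Z => ∑ i, w Z * (w Z * (D i φ Z * D i φ Z))) (μ a) :=
    integrable_finsetSum _ fun i _ => hw.integrable_mul
      (hw.mul_bdd ((hφ.locBdd_D i).mul (hφ.locBdd_D i)))
      (((hφ.bddSupp.D i).mul_left _).mul_left _)
  refine this.congr (ae_of_all _ fun Z => ?_)
  simp only [dot, Finset.mul_sum]
  exact Finset.sum_congr rfl fun i _ => by ring

namespace BoundarySolution

lemma locSq_R_D (hu : BoundarySolution a M f u) (q : Heis) (hR : LocSq a (R q u)) (i : Fin 3) :
    LocSq a (R q (D i u)) := by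
  have hDi := contDiffOn_D hu.smooth i
  refine locSq_of_tendsto (continuousOn_R hDi q) (fun t => Heisenberg.quot q t (D i u))
    (fun t => (hu.energy.locSq_D i).quot q t) (fun _ hZ => tendsto_quot_right hDi q hZ)
    fun φ hφ => ?_
  obtain ⟨C, hC0, hcac⟩ := hu.exists_caccioppoli
  obtain ⟨B, r, hB0, -, hB, hr⟩ := hφ.exists_bound_dot
  obtain ⟨C', hC'0, hev⟩ := exists_eventually_quot_sq_le hu.contDiffOn hu.energy.locSq hu.weight.1
    q hR r
  refine ⟨2 * (C * (B * C') + 2 * (B * C')) + 2 * (B * C'), ?_⟩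
  filter_upwards [hev] with t ht
  set w := Heisenberg.quot q t u with hw
  have hE : Energy a w := hu.energy.quot q t
  have hη := hE.admissible_mul_cutoff (hu.locBdd_quot q t) hφ
  have h1 : ∫ Z, w Z ^ 2 * φ Z ^ 2 ∂(μ a) ≤ B * C' :=
    (integral_sq_mul_le hE.locSq (fun Z _ => ⟨sq_nonneg _, (hB Z).1⟩)
      fun Z h1 h2 => by rw [(hr Z h1 h2).1]; norm_num).trans (by gcongr)
  have h2 : ∫ Z, w Z ^ 2 * dot φ φ Z ∂(μ a) ≤ B * C' :=
    (integral_sq_mul_le hE.locSq (fun Z _ => ⟨dot_self_nonneg _ _, (hB Z).2⟩)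
      fun Z h1 h2 => (hr Z h1 h2).2).trans (by gcongr)
  have h3 := hcac φ hφ q t
  rw [← hw] at h3
  have h4 : ∫ Z, (w Z * φ Z) ^ 2 ∂(μ a) = ∫ Z, w Z ^ 2 * φ Z ^ 2 ∂(μ a) :=
    integral_congr_ae (ae_of_all _ fun Z => mul_pow _ _ _)
  rw [h4] at h3
  have i1 := hη.energy.integrable_dot hη.energy hη.bddSupp
  have i2 := integrable_sq_mul_dot hE.locSq hφ
  have h5 : ∫ Z, (Heisenberg.quot q t (D i u) Z * φ Z) ^ 2 ∂(μ a) ≤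
      ∫ Z, (2 * dot (fun Z => w Z * φ Z) (fun Z => w Z * φ Z) Z +
        2 * (w Z ^ 2 * dot φ φ Z)) ∂(μ a) := by
    refine integral_mono_of_nonneg (ae_of_all _ fun Z => sq_nonneg _)
      ((i1.const_mul 2).add (i2.const_mul 2)) ?_
    filter_upwards [ae_mem_halfSpace a] with Z hZ
    rw [← D_quot hu.contDiffOn q t hZ i]
    exact sq_mul_D_le (hE.differentiableAt hZ) (hφ.differentiableAt Z) i
  rw [integral_add (i1.const_mul 2) (i2.const_mul 2), integral_const_mul, integral_const_mul] at h5
  have h6 : C * (∫ Z, w Z ^ 2 * φ Z ^ 2 ∂(μ a)) ≤ C * (B * C') := by gcongr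
  linarith

lemma energy_R (hu : BoundarySolution a M f u) (q : Heis) (hR : LocSq a (R q u)) :
    Energy a (R q u) :=
  ⟨contDiffOn_R hu.smooth q, hR, fun i =>
    (hu.locSq_R_D q hR i).congr fun _ hZ => D_R_comm hu.smooth hZ q i⟩

end BoundarySolution

/-! ### The linearized equation -/

lemma abs_integral_mul_le {α : Type*} [MeasurableSpace α] {ν : Measure α} {g h : α → ℝ}
    (hg : MemLp g 2 ν) (hh : MemLp h 2 ν) :
    ∫ x, |g x * h x| ∂ν ≤ Real.sqrt (∫ x, g x ^ 2 ∂ν) * Real.sqrt (∫ x, h x ^ 2 ∂ν) := by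
  have h2 : ENNReal.ofReal (2 : ℝ) = 2 := by norm_num
  have := integral_mul_norm_le_Lp_mul_Lq (μ := ν) (f := g) (g := h) (p := 2) (q := 2)
    Real.HolderConjugate.two_two (by rwa [h2]) (by rwa [h2])
  simpa only [Real.norm_eq_abs, ← abs_mul, Real.rpow_ofNat, sq_abs, ← Real.sqrt_eq_rpow] using this

lemma dot_mul_self_le (hw : DifferentiableAt ℝ w Z) (hφ : DifferentiableAt ℝ φ Z) :
    dot (fun Z => w Z * φ Z) (fun Z => w Z * φ Z) Z ≤
      2 * (∑ i, D i w Z ^ 2 * φ Z ^ 2) + 2 * (w Z ^ 2 * dot φ φ Z) := by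
  simp only [dot, Finset.mul_sum, ← Finset.sum_add_distrib]
  refine Finset.sum_le_sum fun i _ => ?_
  have h1 : D i (fun Z => w Z * φ Z) Z = w Z * D i φ Z + D i w Z * φ Z := along_mul hw hφ
  rw [h1]
  nlinarith [sq_nonneg (w Z * D i φ Z - D i w Z * φ Z)]

lemma tendsto_integral_mul {ι : Type*} {l : Filter ι} {P : ι → Heis × ℝ → ℝ} {g : Heis × ℝ → ℝ}
    (hP : ∀ t, LocSq a (P t)) (hp : LocSq a p) (hg : LocSq a g) (hs : BddSupp g)
    (h : ∀ r, Tendsto (fun t => ∫ Z in halfBall r, (P t Z - p Z) ^ 2 ∂(μ a)) l (𝓝 0)) :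
    Tendsto (fun t => ∫ Z, P t Z * g Z ∂(μ a)) l (𝓝 (∫ Z, p Z * g Z ∂(μ a))) := by
  obtain ⟨r, -, hr⟩ := id hs
  rw [tendsto_iff_norm_sub_tendsto_zero]
  have h1 : Tendsto (fun t => Real.sqrt (∫ Z in halfBall r, (P t Z - p Z) ^ 2 ∂(μ a)) *
      Real.sqrt (∫ Z in halfBall r, g Z ^ 2 ∂(μ a))) l (𝓝 0) := by
    simpa using ((h r).sqrt).mul_const (Real.sqrt (∫ Z in halfBall r, g Z ^ 2 ∂(μ a)))
  refine squeeze_zero (fun _ => norm_nonneg _) (fun t => ?_) h1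
  refine le_trans ?_ (abs_integral_mul_le (((hP t).sub hp).memLp r) (hg.memLp r))
  rw [← integral_sub ((hP t).integrable_mul hg hs) (hp.integrable_mul hg hs)]
  have e : ∫ Z, (P t Z * g Z - p Z * g Z) ∂(μ a) =
      ∫ Z in halfBall r, (P t Z - p Z) * g Z ∂(μ a) := by
    rw [← integral_indicator (measurableSet_halfBall r)]
    refine integral_congr_ae ?_
    filter_upwards [ae_mem_halfSpace a] with Z hZ
    by_cases hZr : Z ∈ halfBall r
    · rw [indicator_of_mem hZr]; ring
    · rw [indicator_of_notMem hZr, hr Z hZ hZr]; ring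
  rw [e]
  exact abs_integral_le_integral_abs

lemma bdry_congr (h : ∀ Z ∈ halfSpace, v Z = w Z) (x : Heis) : bdry v x = bdry w x := by
  unfold bdry limUnder
  congr 1
  refine Filter.map_congr ?_
  filter_upwards [self_mem_nhdsWithin] with y hy using h (x, y) hy

lemma exists_cutoff_mul_eq (h : BddSupp ξ) : ∃ φ, Cutoff φ ∧ ∀ Z ∈ halfSpace, ξ Z * φ Z = ξ Z := by
  obtain ⟨r, -, hr⟩ := h
  obtain ⟨φ, hφ, -, h1⟩ := exists_cutoff_halfBall r
  refine ⟨φ, hφ, fun Z hZ => ?_⟩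
  by_cases hZr : Z ∈ halfBall r
  · rw [h1 Z hZr, mul_one]
  · rw [hr Z hZ hZr, zero_mul]

/-- Products of traces are integrable if one factor is admissible. -/
lemma integrable_bdry_mul_bdry (ha : a ∈ Ioo (-1 : ℝ) 1) (hw : Energy a w) (hξ : Admissible a ξ) :
    Integrable fun x => bdry w x * bdry ξ x := by
  obtain ⟨φ, hφ, h1⟩ := exists_cutoff_mul_eq hξ.bddSupp
  obtain ⟨C, -, hC⟩ := exists_trace_inequality ha one_pos
  have h2 := (hC _ (hw.mul_contDiff hφ.contDiff) (hφ.bddSupp.mul_left w)).1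
  refine (h2.integrable_mul (hξ.memLp_bdry ha)).congr ?_
  have t1 := (hw.hasTrace ha.2).mul (.of_continuous hφ.contDiff.continuous)
  have t2 := (hξ.hasTrace ha.2).mul (.of_continuous hφ.contDiff.continuous)
  filter_upwards [t1.2, t2.2] with x h3 h4
  rw [bdry_congr h1] at h4
  simp only [Pi.mul_apply]
  rw [h3, mul_assoc, mul_comm (bdry φ x), ← h4]

namespace BoundarySolution

lemma tendsto_quot_D (hu : BoundarySolution a M f u) (q : Heis) (hR : LocSq a (R q u))
    (i : Fin 3) (r : ℝ) : Tendsto (fun t => ∫ Z in halfBall r,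
      (D i (Heisenberg.quot q t u) Z - D i (R q u) Z) ^ 2 ∂(μ a)) (𝓝[>] 0) (𝓝 0) := by
  refine (tendsto_quot_sub (contDiffOn_D hu.smooth i) (hu.energy.locSq_D i) hu.weight.1 q
    (hu.locSq_R_D q hR i) r).congr fun t => ?_
  refine setIntegral_congr_fun (measurableSet_halfBall r) fun Z hZ => ?_
  rw [D_quot hu.contDiffOn q t hZ.1, D_R_comm hu.smooth hZ.1]

lemma tendsto_integral_dot_quot (hu : BoundarySolution a M f u) (q : Heis)
    (hR : LocSq a (R q u)) (hξ : Admissible a ξ) :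
    Tendsto (fun t => ∫ Z, dot (Heisenberg.quot q t u) ξ Z ∂(μ a)) (𝓝[>] 0)
      (𝓝 (∫ Z, dot (R q u) ξ Z ∂(μ a))) := by
  have hs : ∀ w, Energy a w → ∫ Z, dot w ξ Z ∂(μ a) = ∑ i, ∫ Z, D i w Z * D i ξ Z ∂(μ a) :=
    fun w hw => integral_finsetSum _ fun i _ =>
      (hw.locSq_D i).integrable_mul (hξ.energy.locSq_D i) (hξ.bddSupp.D i)
  rw [hs _ (hu.energy_R q hR)]
  simp only [hs _ (hu.energy.quot q _)]
  exact tendsto_finsetSum _ fun i _ => tendsto_integral_mul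
    (fun t => (hu.energy.quot q t).locSq_D i) ((hu.energy_R q hR).locSq_D i)
    (hξ.energy.locSq_D i) (hξ.bddSupp.D i) (hu.tendsto_quot_D q hR i)

/-- The traces of the difference quotients converge locally in mean square. -/
lemma tendsto_integral_bdry_sq (hu : BoundarySolution a M f u) (q : Heis) (hR : LocSq a (R q u))
    (hφ : Cutoff φ) :
    Tendsto (fun t => ∫ x, bdry (fun Z => (Heisenberg.quot q t u Z - R q u Z) * φ Z) x ^ 2)
      (𝓝[>] 0) (𝓝 0) := by
  obtain ⟨C, hC0, hC⟩ := exists_trace_inequality hu.weight one_pos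
  obtain ⟨B, r, hB0, -, hB, hr⟩ := hφ.exists_bound_dot
  have hlim : Tendsto (fun t => 2 * (∑ i, B * ∫ Z in halfBall r,
      (D i (Heisenberg.quot q t u) Z - D i (R q u) Z) ^ 2 ∂(μ a)) + (2 + C) * (B *
      ∫ Z in halfBall r, (Heisenberg.quot q t u Z - R q u Z) ^ 2 ∂(μ a))) (𝓝[>] 0) (𝓝 0) := by
    have h1 := ((tendsto_finsetSum Finset.univ fun i _ =>
      (hu.tendsto_quot_D q hR i r).const_mul B).const_mul 2).add (((tendsto_quot_sub hu.contDiffOn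
      hu.energy.locSq hu.weight.1 q hR r).const_mul B).const_mul (2 + C))
    simpa using h1
  refine squeeze_zero (fun _ => integral_nonneg fun _ => sq_nonneg _) (fun t => ?_) hlim
  set g : Heis × ℝ → ℝ := fun Z => Heisenberg.quot q t u Z - R q u Z with hg
  have hE : Energy a g := (hu.energy.quot q t).sub (hu.energy_R q hR)
  have hgφ := hE.mul_contDiff hφ.contDiff
  have hgs : BddSupp fun Z => g Z * φ Z := hφ.bddSupp.mul_left g
  refine (hC _ hgφ hgs).2.trans ?_
  have h1 : ∫ Z, g Z ^ 2 * φ Z ^ 2 ∂(μ a) ≤ B * ∫ Z in halfBall r, g Z ^ 2 ∂(μ a) :=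
    integral_sq_mul_le hE.locSq (fun Z _ => ⟨sq_nonneg _, (hB Z).1⟩)
      fun Z h1 h2 => by rw [(hr Z h1 h2).1]; norm_num
  have h2 : ∫ Z, g Z ^ 2 * dot φ φ Z ∂(μ a) ≤ B * ∫ Z in halfBall r, g Z ^ 2 ∂(μ a) :=
    integral_sq_mul_le hE.locSq (fun Z _ => ⟨dot_self_nonneg _ _, (hB Z).2⟩)
      fun Z h1 h2 => (hr Z h1 h2).2
  have h3 : ∀ i, ∫ Z, D i g Z ^ 2 * φ Z ^ 2 ∂(μ a) ≤
      B * ∫ Z in halfBall r, D i g Z ^ 2 ∂(μ a) := fun i =>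
    integral_sq_mul_le (hE.locSq_D i) (fun Z _ => ⟨sq_nonneg _, (hB Z).1⟩)
      fun Z h1 h2 => by rw [(hr Z h1 h2).1]; norm_num
  have h4 : ∫ Z, (g Z * φ Z) ^ 2 ∂(μ a) = ∫ Z, g Z ^ 2 * φ Z ^ 2 ∂(μ a) :=
    integral_congr_ae (ae_of_all _ fun Z => mul_pow _ _ _)
  have i1 : ∀ i, Integrable (fun Z => D i g Z ^ 2 * φ Z ^ 2) (μ a) := fun i => by
    simpa only [mul_pow] using ((hE.locSq_D i).mul_bdd hφ.locBdd).integrable_sq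
      (hφ.bddSupp.mul_left _)
  have i2 : Integrable (fun Z => ∑ i, D i g Z ^ 2 * φ Z ^ 2) (μ a) :=
    integrable_finsetSum _ fun i _ => i1 i
  have i3 := integrable_sq_mul_dot hE.locSq hφ
  have h5 : ∫ Z, dot (fun Z => g Z * φ Z) (fun Z => g Z * φ Z) Z ∂(μ a) ≤
      ∫ Z, (2 * (∑ i, D i g Z ^ 2 * φ Z ^ 2) + 2 * (g Z ^ 2 * dot φ φ Z)) ∂(μ a) := by
    refine integral_mono_ae (hgφ.integrable_dot hgφ hgs) ((i2.const_mul 2).add (i3.const_mul 2)) ?_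
    filter_upwards [ae_mem_halfSpace a] with Z hZ
    exact dot_mul_self_le (hE.differentiableAt hZ) (hφ.differentiableAt Z)
  rw [integral_add (i2.const_mul 2) (i3.const_mul 2), integral_const_mul, integral_const_mul,
    integral_finsetSum _ fun i _ => i1 i] at h5
  have h6 : ∀ i, ∫ Z in halfBall r, D i g Z ^ 2 ∂(μ a) = ∫ Z in halfBall r,
      (D i (Heisenberg.quot q t u) Z - D i (R q u) Z) ^ 2 ∂(μ a) := fun i =>
    setIntegral_congr_fun (measurableSet_halfBall r) fun Z hZ => by
      congr 1
      exact along_sub ((hu.energy.quot q t).differentiableAt hZ.1)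
        ((hu.energy_R q hR).differentiableAt hZ.1)
  have h7 : ∑ i, ∫ Z, D i g Z ^ 2 * φ Z ^ 2 ∂(μ a) ≤ ∑ i, B * ∫ Z in halfBall r,
      (D i (Heisenberg.quot q t u) Z - D i (R q u) Z) ^ 2 ∂(μ a) :=
    Finset.sum_le_sum fun i _ => by rw [← h6]; exact h3 i
  rw [h4, one_mul]
  have h8 := mul_le_mul_of_nonneg_left h1 hC0
  have h9 : (2 + C) * (B * ∫ Z in halfBall r, g Z ^ 2 ∂(μ a)) =
    2 * (B * ∫ Z in halfBall r, g Z ^ 2 ∂(μ a)) + C * (B * ∫ Z in halfBall r, g Z ^ 2 ∂(μ a)) := by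
    ring
  change _ ≤ _ + (2 + C) * (B * ∫ Z in halfBall r, g Z ^ 2 ∂(μ a))
  rw [h9]
  linarith

lemma tendsto_integral_boundary (hu : BoundarySolution a M f u) (q : Heis)
    (hR : LocSq a (R q u)) (hξ : Admissible a ξ) :
    Tendsto (fun t => ∫ x : Heis, t⁻¹ * (f (bdry u (flowBase q t x)) - f (bdry u x)) * bdry ξ x)
      (𝓝[>] 0) (𝓝 (∫ x : Heis, deriv f (bdry u x) * bdry (R q u) x * bdry ξ x)) := by
  obtain ⟨φ, hφ, hφξ⟩ := exists_cutoff_mul_eq hξ.bddSupp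
  have hM := hu.nonneg
  have hER := hu.energy_R q hR
  have htR := hER.hasTrace hu.weight.2
  have htξ := hξ.hasTrace hu.weight.2
  have htφ := HasTrace.of_continuous hφ.contDiff.continuous
  have hfc := hu.contDiff.continuous
  have hmR := htR.aesm hER.contDiffOn.continuousOn
  have hmξ := hξ.aesm_bdry hu.weight.2
  have hβξ := integrable_bdry_mul_bdry hu.weight hER hξ
  -- the linear part
  let G : ℝ → Heis → ℝ := fun t x =>
    t⁻¹ * (f (bdry u x + t * bdry (R q u) x) - f (bdry u x)) * bdry ξ x
  have hGm : ∀ t, AEStronglyMeasurable (G t) (volume : Measure Heis) := fun t =>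
    (((hfc.comp_aestronglyMeasurable (hu.aesm_bdry.add (hmR.const_mul t))).sub
      (hfc.comp_aestronglyMeasurable hu.aesm_bdry)).const_mul t⁻¹).mul hmξ
  have hGb : ∀ t > 0, ∀ x, ‖G t x‖ ≤ M * |bdry (R q u) x * bdry ξ x| := by
    intro t ht x
    have h1 := hu.lipschitz (bdry u x + t * bdry (R q u) x) (bdry u x)
    rw [add_sub_cancel_left, abs_mul, abs_of_pos ht] at h1
    simp only [G, norm_mul, Real.norm_eq_abs, abs_mul, abs_inv, abs_of_pos ht]
    rw [← mul_assoc]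
    refine mul_le_mul_of_nonneg_right ?_ (abs_nonneg _)
    rw [inv_mul_le_iff₀ ht]
    linarith
  have hG : Tendsto (fun t => ∫ x, G t x) (𝓝[>] 0)
      (𝓝 (∫ x : Heis, deriv f (bdry u x) * bdry (R q u) x * bdry ξ x)) := by
    refine tendsto_integral_filter_of_dominated_convergence _ (Eventually.of_forall hGm)
      ?_ (hβξ.abs.const_mul M) (ae_of_all _ fun x => ?_)
    · filter_upwards [self_mem_nhdsWithin] with t ht using ae_of_all _ (hGb t ht)
    · have h1 : HasDerivAt (fun t => f (bdry u x + t * bdry (R q u) x))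
          (deriv f (bdry u x) * bdry (R q u) x) 0 := by
        have h2 : HasDerivAt (fun t : ℝ => bdry u x + t * bdry (R q u) x) (bdry (R q u) x) 0 := by
          simpa using ((hasDerivAt_id (0 : ℝ)).mul_const (bdry (R q u) x)).const_add (bdry u x)
        refine HasDerivAt.comp (h₂ := f) 0 ?_ h2
        simpa using (hu.contDiff.differentiable one_ne_zero (bdry u x)).hasDerivAt
      have h2 := h1.tendsto_slope_zero_right
      simp only [zero_add, zero_mul, add_zero, smul_eq_mul] at h2
      exact h2.mul_const _
  -- the remainder
  have hS := hu.tendsto_integral_bdry_sq q hR hφ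
  obtain ⟨C, -, hC⟩ := exists_trace_inequality hu.weight one_pos
  set N := Real.sqrt (∫ x, bdry ξ x ^ 2) with hN
  have hrem : Tendsto (fun t => (∫ x : Heis,
      t⁻¹ * (f (bdry u (flowBase q t x)) - f (bdry u x)) * bdry ξ x) - ∫ x, G t x)
      (𝓝[>] 0) (𝓝 0) := by
    have hb : Tendsto (fun t => M * (Real.sqrt (∫ x,
        bdry (fun Z => (Heisenberg.quot q t u Z - R q u Z) * φ Z) x ^ 2) * N)) (𝓝[>] 0) (𝓝 0) := by
      simpa using (hS.sqrt.mul_const N).const_mul M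
    refine squeeze_zero_norm' ?_ hb
    filter_upwards [self_mem_nhdsWithin] with t ht
    have ht : 0 < t := ht
    have i1 : Integrable fun x : Heis =>
        t⁻¹ * (f (bdry u (flowBase q t x)) - f (bdry u x)) * bdry ξ x := by
      have i3 := hu.integrable_comp_bdry_mul hξ q t
      have i4 : Integrable (fun x : Heis => f (bdry u x) * bdry ξ x) := by
        simpa [flowBase] using hu.integrable_comp_bdry_mul hξ q 0
      refine ((i3.sub i4).const_mul t⁻¹).congr (ae_of_all _ fun x => ?_)
      simp only [Pi.sub_apply]; ring
    have i2 : Integrable (G t) := (hβξ.abs.const_mul M).mono' (hGm t) (ae_of_all _ (hGb t ht))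
    rw [← integral_sub i1 i2]
    have hE : Energy a fun Z => Heisenberg.quot q t u Z - R q u Z :=
      (hu.energy.quot q t).sub hER
    have hm := (hC _ (hE.mul_contDiff hφ.contDiff) (hφ.bddSupp.mul_left _)).1
    have hmul := abs_integral_mul_le hm (hξ.memLp_bdry hu.weight)
    refine (norm_integral_le_of_norm_le
      (((hm.integrable_mul (hξ.memLp_bdry hu.weight)).abs).const_mul M) ?_).trans ?_
    · have htq := (hu.energy.quot q t).hasTrace hu.weight.2
      filter_upwards [bdry_quot hu.hasTrace q t, ((hE.hasTrace hu.weight.2).mul htφ).2,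
        (htξ.mul htφ).2, htq, htR] with x h1 h2 h3 h4 h5
      have h6 : bdry (fun Z => Heisenberg.quot q t u Z - R q u Z) x =
          bdry (Heisenberg.quot q t u) x - bdry (R q u) x := bdry_eq (h4.sub h5)
      rw [bdry_congr hφξ] at h3
      simp only [Pi.mul_apply]
      have h10 : ∀ c : ℝ, c * bdry φ x * bdry ξ x = c * bdry ξ x := fun c => by
        rw [mul_assoc, mul_comm (bdry φ x), ← h3]
      rw [h2, h6, h1, h10, abs_mul]
      have h7 := hu.lipschitz (bdry u (flowBase q t x)) (bdry u x + t * bdry (R q u) x)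
      have h8 : t⁻¹ * (f (bdry u (flowBase q t x)) - f (bdry u x)) * bdry ξ x - G t x =
          t⁻¹ * (f (bdry u (flowBase q t x)) - f (bdry u x + t * bdry (R q u) x)) * bdry ξ x := by
        simp only [G]; ring
      rw [h8, norm_mul, norm_mul, ← mul_assoc, Real.norm_eq_abs, Real.norm_eq_abs,
        Real.norm_eq_abs]
      refine mul_le_mul_of_nonneg_right ?_ (abs_nonneg _)
      have h9 : t⁻¹ * (bdry u (flowBase q t x) - bdry u x) - bdry (R q u) x =
          t⁻¹ * (bdry u (flowBase q t x) - (bdry u x + t * bdry (R q u) x)) := by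
        field_simp; ring
      rw [h9, abs_mul]
      have := mul_le_mul_of_nonneg_left h7 (abs_nonneg t⁻¹)
      linarith
    · rw [integral_const_mul]
      gcongr
      exact hmul
  have := hrem.add hG
  simpa using this

/-- The linearized equation satisfied by the derivatives along right-invariant fields. -/
lemma weak_R (hu : BoundarySolution a M f u) (q : Heis) (hR : LocSq a (R q u))
    (hξ : Admissible a ξ) : ∫ Z, dot (R q u) ξ Z ∂(μ a) =
      ∫ x : Heis, deriv f (bdry u x) * bdry (R q u) x * bdry ξ x := by
  refine tendsto_nhds_unique (hu.tendsto_integral_dot_quot q hR hξ) ?_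
  simp only [hu.weak_quot hξ q]
  exact hu.tendsto_integral_boundary q hR hξ

end BoundarySolution

end

end Heisenberg

namespace Heisenberg

noncomputable section

variable {a M : ℝ} {f : ℝ → ℝ} {u v w ξ φ ψ p c : Heis × ℝ → ℝ}

/-! ### The equations for the horizontal derivatives -/

lemma D_const_mul_coord_mul (hw : DifferentiableAt ℝ w Z) (hξ : DifferentiableAt ℝ ξ Z)
    (hc : DifferentiableAt ℝ c Z) {j : Fin 3} (hcj : ∀ i, D i c Z = if i = j then 1 else 0) :
    dot (fun Z => c Z * w Z) ξ Z = dot w (fun Z => ξ Z * c Z) Z - 2 * (ξ Z * D j w Z) +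
      D j (fun Z => w Z * ξ Z) Z := by
  have h1 : ∀ i, D i (fun Z => c Z * w Z) Z = c Z * D i w Z + D i c Z * w Z :=
    fun i => along_mul hc hw
  have h2 : ∀ i, D i (fun Z => ξ Z * c Z) Z = ξ Z * D i c Z + D i ξ Z * c Z :=
    fun i => along_mul hξ hc
  have h3 : D j (fun Z => w Z * ξ Z) Z = w Z * D j ξ Z + D j w Z * ξ Z := along_mul hw hξ
  rw [h3]
  simp only [dot, h1, h2, hcj]
  have e1 : ∑ i, (c Z * D i w Z + (if i = j then 1 else 0) * w Z) * D i ξ Z =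
      (∑ i, c Z * D i w Z * D i ξ Z) + w Z * D j ξ Z := by
    simp [add_mul, Finset.sum_add_distrib]
  have e2 : ∑ i, D i w Z * (ξ Z * (if i = j then 1 else 0) + D i ξ Z * c Z) =
      D j w Z * ξ Z + ∑ i, c Z * D i w Z * D i ξ Z := by
    simp only [mul_add, Finset.sum_add_distrib]
    congr 1
    · simp
    · exact Finset.sum_congr rfl fun i _ => by ring
  rw [e1, e2]
  ring

lemma dot_add_const_mul {σ : ℝ} (hv : DifferentiableAt ℝ v Z) (hw : DifferentiableAt ℝ w Z) :
    dot (fun Z => v Z + σ * w Z) ξ Z = dot v ξ Z + σ * dot w ξ Z := by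
  have h1 : ∀ i, D i (fun Z => v Z + σ * w Z) Z = D i v Z + σ * D i w Z := fun i => by
    have h2 := along_const_mul (V := frame i) σ hw
    have h3 := along_add (V := frame i) hv (hw.const_mul σ)
    exact h3.trans (by rw [h2]; rfl)
  simp only [dot, h1, Finset.mul_sum, ← Finset.sum_add_distrib]
  exact Finset.sum_congr rfl fun i _ => by ring

lemma locBdd_of_contDiff (hc : ContDiff ℝ 1 c) : LocBdd c := .of_continuous hc.continuous

namespace BoundarySolution

lemma integrable_deriv_mul (hu : BoundarySolution a M f u) (hw : Energy a w)
    (hξ : Admissible a ξ) :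
    Integrable fun x : Heis => deriv f (bdry u x) * bdry w x * bdry ξ x := by
  have hm : AEStronglyMeasurable (fun x : Heis => deriv f (bdry u x)) :=
    (hu.contDiff.continuous_deriv le_rfl).comp_aestronglyMeasurable hu.aesm_bdry
  refine ((integrable_bdry_mul_bdry hu.weight hw hξ).bdd_mul (c := M) hm
    (ae_of_all _ fun x => hu.deriv_le _)).congr (ae_of_all _ fun x => ?_)
  simp only
  ring

/-- A left-invariant derivative is a right-invariant one up to a multiple of the vertical
derivative. -/
structure Splitting (u : Heis × ℝ → ℝ) (k j : Fin 3) (q : Heis) (c : Heis × ℝ → ℝ) (σ : ℝ) :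
    Prop where
  contDiff : ContDiff ℝ 1 c
  D_coord : ∀ i Z, D i c Z = if i = j then 1 else 0
  ne : j ≠ 2
  eq : ∀ Z, D k u Z = R q u Z + σ * (c Z * R (0, 0, -4) u Z)

variable {k j : Fin 3} {q : Heis} {σ : ℝ}

lemma locSq_R_of_splitting (hu : BoundarySolution a M f u) (hs : Splitting u k j q c σ)
    (hT : LocSq a (R (0, 0, -4) u)) : LocSq a (R q u) :=
  ((hu.energy.locSq_D k).sub ((hT.bdd_mul (locBdd_of_contDiff hs.contDiff)).const_mul σ)).congr
    fun Z _ => by rw [hs.eq Z]; ring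

lemma energy_coord_mul (hw : Energy a w) (hc : ContDiff ℝ 1 c) : Energy a fun Z => c Z * w Z := by
  simpa only [mul_comm] using hw.mul_contDiff hc

lemma energy_D_of_splitting (hu : BoundarySolution a M f u) (hs : Splitting u k j q c σ)
    (hT : LocSq a (R (0, 0, -4) u)) : Energy a (D k u) := by
  have h := (hu.energy_R q (hu.locSq_R_of_splitting hs hT)).add
    ((energy_coord_mul (hu.energy_R _ hT) hs.contDiff).const_mul σ)
  rwa [← funext hs.eq] at h

lemma weak_D_of_splitting (hu : BoundarySolution a M f u) (hs : Splitting u k j q c σ)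
    (hT : LocSq a (R (0, 0, -4) u)) (hξ : Admissible a ξ) :
    ∫ Z, dot (D k u) ξ Z ∂(μ a) =
      (∫ x : Heis, deriv f (bdry u x) * bdry (D k u) x * bdry ξ x) -
        2 * σ * ∫ Z, ξ Z * D j (R (0, 0, -4) u) Z ∂(μ a) := by
  set τ := R (0, 0, -4) u with hτ
  have hR := hu.locSq_R_of_splitting hs hT
  have hER := hu.energy_R q hR
  have hEτ := hu.energy_R _ hT
  rw [← hτ] at hEτ
  have hξc := hξ.mul_contDiff hs.contDiff
  have i1 := hER.integrable_dot hξ.energy hξ.bddSupp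
  have i2 := hEτ.integrable_dot hξc.energy hξc.bddSupp
  have i3 : Integrable (fun Z => ξ Z * D j τ Z) (μ a) := by
    simpa only [mul_comm] using (hEτ.locSq_D j).integrable_mul hξ.energy.locSq hξ.bddSupp
  have i4 : Integrable (D j fun Z => τ Z * ξ Z) (μ a) := by
    refine ((hEτ.locSq.integrable_mul (hξ.energy.locSq_D j) (hξ.bddSupp.D j)).add
      ((hEτ.locSq_D j).integrable_mul hξ.energy.locSq hξ.bddSupp)).congr ?_
    filter_upwards [ae_mem_halfSpace a] with Z hZ
    exact (along_mul (hEτ.differentiableAt hZ) (hξ.energy.differentiableAt hZ)).symm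
  have e0 : ∫ Z, D j (fun Z => τ Z * ξ Z) Z ∂(μ a) = 0 :=
    integral_D_eq_zero (hEτ.contDiffOn.mul hξ.energy.contDiffOn) (hξ.bddSupp.mul_left τ) j hs.ne i4
  have e1 : ∫ Z, dot (D k u) ξ Z ∂(μ a) = ∫ Z, (dot (R q u) ξ Z +
      σ * (dot τ (fun Z => ξ Z * c Z) Z - 2 * (ξ Z * D j τ Z) +
        D j (fun Z => τ Z * ξ Z) Z)) ∂(μ a) := by
    refine integral_congr_ae ?_
    filter_upwards [ae_mem_halfSpace a] with Z hZ
    have hc := hs.contDiff.differentiable one_ne_zero Z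
    have hd := hEτ.differentiableAt hZ
    rw [← D_const_mul_coord_mul hd (hξ.energy.differentiableAt hZ) hc fun i => hs.D_coord i Z,
      ← dot_add_const_mul (w := fun Z => c Z * τ Z) (hER.differentiableAt hZ) (hc.mul hd),
      ← funext hs.eq]
  have i23 : Integrable (fun Z => dot τ (fun Z => ξ Z * c Z) Z - 2 * (ξ Z * D j τ Z)) (μ a) :=
    i2.sub (i3.const_mul 2)
  have i234 : Integrable (fun Z => dot τ (fun Z => ξ Z * c Z) Z - 2 * (ξ Z * D j τ Z) +
      D j (fun Z => τ Z * ξ Z) Z) (μ a) := i23.add i4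
  rw [e1, integral_add i1 (i234.const_mul σ), integral_const_mul, integral_add i23 i4, e0,
    integral_sub i2 (i3.const_mul 2),
    integral_const_mul, hu.weak_R q hR hξ, hτ, hu.weak_R _ hT hξc]
  have hb : ∫ x : Heis, deriv f (bdry u x) * bdry (D k u) x * bdry ξ x =
      ∫ x : Heis, (deriv f (bdry u x) * bdry (R q u) x * bdry ξ x +
        σ * (deriv f (bdry u x) * bdry τ x * bdry (fun Z => ξ Z * c Z) x)) := by
    have tc := HasTrace.of_continuous hs.contDiff.continuous
    have tR := hER.hasTrace hu.weight.2
    have tτ := hEτ.hasTrace hu.weight.2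
    refine integral_congr_ae ?_
    filter_upwards [((hξ.hasTrace hu.weight.2).mul tc).2, tc, tR, tτ] with x h1 h2 h3 h4
    have h5 : bdry (D k u) x = bdry (R q u) x + σ * (bdry c x * bdry τ x) := by
      rw [funext hs.eq]
      exact bdry_eq (h3.add ((h2.mul h4).const_mul σ))
    rw [h1, h5]; ring
  rw [hb, integral_add (hu.integrable_deriv_mul hER hξ)
    ((hu.integrable_deriv_mul hEτ hξc).const_mul σ), integral_const_mul]
  ring

end BoundarySolution

lemma splitting_zero (u : Heis × ℝ → ℝ) :
    BoundarySolution.Splitting u 0 1 (1, 0, 0) (fun Z => Z.1.2.1) (-1) where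
  contDiff := by fun_prop
  D_coord i Z := by
    have h : HasFDerivAt (fun Z : Heis × ℝ => Z.1.2.1) ((ContinuousLinearMap.fst ℝ ℝ ℝ).comp
        ((ContinuousLinearMap.snd ℝ ℝ (ℝ × ℝ)).comp (ContinuousLinearMap.fst ℝ Heis ℝ))) Z :=
      ((ContinuousLinearMap.fst ℝ ℝ ℝ).comp
        ((ContinuousLinearMap.snd ℝ ℝ (ℝ × ℝ)).comp (ContinuousLinearMap.fst ℝ Heis ℝ))).hasFDerivAt
    unfold D along
    rw [h.fderiv]
    fin_cases i <;> simp [frame, affineField]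
  ne := by decide
  eq Z := by
    unfold D R along
    rw [← smul_eq_mul, ← smul_eq_mul, ← map_smul, ← map_smul, ← map_add]
    congr 1
    ext <;> simp [frame, affineField, rightField]
    ring

lemma splitting_one (u : Heis × ℝ → ℝ) :
    BoundarySolution.Splitting u 1 0 (0, 1, 0) (fun Z => Z.1.1) 1 where
  contDiff := by fun_prop
  D_coord i Z := by
    have h : HasFDerivAt (fun Z : Heis × ℝ => Z.1.1) ((ContinuousLinearMap.fst ℝ ℝ (ℝ × ℝ)).comp
        (ContinuousLinearMap.fst ℝ Heis ℝ)) Z :=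
      ((ContinuousLinearMap.fst ℝ ℝ (ℝ × ℝ)).comp (ContinuousLinearMap.fst ℝ Heis ℝ)).hasFDerivAt
    unfold D along
    rw [h.fderiv]
    fin_cases i <;> simp [frame, affineField]
  ne := by decide
  eq Z := by
    unfold D R along
    rw [← smul_eq_mul, ← smul_eq_mul, ← map_smul, ← map_smul, ← map_add]
    congr 1
    ext <;> simp [frame, affineField, rightField]
    ring

/-! ### The geometric Poincaré inequality -/

/-- The squared length of the derivative of the direction of `(v, w)`, times `v² + w²`. -/
def curv (v w : Heis × ℝ → ℝ) (Z : Heis × ℝ) : ℝ :=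
  ∑ i, (D i v Z * w Z - D i w Z * v Z) ^ 2 / (v Z ^ 2 + w Z ^ 2)

/-- The regularized length of `(v, w)`. -/
def regNorm (ε : ℝ) (v w : Heis × ℝ → ℝ) (Z : Heis × ℝ) : ℝ :=
  Real.sqrt (v Z ^ 2 + w Z ^ 2 + ε)

lemma curv_nonneg (v w : Heis × ℝ → ℝ) (Z : Heis × ℝ) : 0 ≤ curv v w Z :=
  Finset.sum_nonneg fun _ _ => by positivity

lemma curv_le (v w : Heis × ℝ → ℝ) (Z : Heis × ℝ) : curv v w Z ≤ dot v v Z + dot w w Z := by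
  simp only [curv, dot, ← Finset.sum_add_distrib]
  refine Finset.sum_le_sum fun i _ => div_le_of_le_mul₀ (by positivity)
    (add_nonneg (mul_self_nonneg _) (mul_self_nonneg _)) ?_
  nlinarith [sq_nonneg (D i v Z * v Z + D i w Z * w Z)]

section RegNorm

variable {ε : ℝ}

lemma regNorm_pos (hε : 0 < ε) (v w : Heis × ℝ → ℝ) (Z : Heis × ℝ) : 0 < regNorm ε v w Z :=
  Real.sqrt_pos.2 (by positivity)

lemma regNorm_sq (hε : 0 < ε) (v w : Heis × ℝ → ℝ) (Z : Heis × ℝ) :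
    regNorm ε v w Z ^ 2 = v Z ^ 2 + w Z ^ 2 + ε := Real.sq_sqrt (by positivity)

lemma D_regNorm (hε : 0 < ε) (hv : DifferentiableAt ℝ v Z) (hw : DifferentiableAt ℝ w Z)
    (i : Fin 3) : D i (regNorm ε v w) Z = (v Z * D i v Z + w Z * D i w Z) / regNorm ε v w Z := by
  have h1 : DifferentiableAt ℝ (fun Z => v Z * v Z + w Z * w Z) Z := (hv.mul hv).add (hw.mul hw)
  have h2 : HasDerivAt (fun s => Real.sqrt (s + ε))
      (1 / (2 * Real.sqrt (v Z * v Z + w Z * w Z + ε))) (v Z * v Z + w Z * w Z) :=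
    ((hasDerivAt_id _).add_const ε).sqrt (by
      have := mul_self_nonneg (v Z); have := mul_self_nonneg (w Z); simp only [id]; positivity)
  have h3 := along_comp (V := frame i) h2 h1
  have h4 : (fun Z => Real.sqrt (v Z * v Z + w Z * w Z + ε)) = regNorm ε v w := by
    funext Z; simp only [regNorm, pow_two]
  rw [h4, along_add (u := fun Z => v Z * v Z) (w := fun Z => w Z * w Z) (hv.mul hv) (hw.mul hw),
    along_mul hv hv, along_mul hw hw] at h3
  unfold D
  rw [h3, show Real.sqrt (v Z * v Z + w Z * w Z + ε) = regNorm ε v w Z from congrFun h4 Z]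
  have := (regNorm_pos hε v w Z).ne'
  field_simp
  ring

lemma energy_regNorm (ha : -1 < a) (hε : 0 < ε) (hv : Energy a v) (hw : Energy a w)
    (hbv : LocBdd v) (hbw : LocBdd w) : Energy a (regNorm ε v w) ∧ LocBdd (regNorm ε v w) := by
  have hc : ContDiffOn ℝ 1 (regNorm ε v w) halfSpace :=
    (((hv.contDiffOn.pow 2).add (hw.contDiffOn.pow 2)).add contDiffOn_const).sqrt
      fun Z _ => by positivity
  have hb : LocBdd (regNorm ε v w) := by
    refine ⟨hc.continuousOn, fun r => ?_⟩
    obtain ⟨A, hA⟩ := hbv.bound r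
    obtain ⟨B, hB⟩ := hbw.bound r
    refine ⟨Real.sqrt (A ^ 2 + B ^ 2 + ε), fun Z hZ => ?_⟩
    rw [abs_of_pos (regNorm_pos hε v w Z)]
    refine Real.sqrt_le_sqrt ?_
    have h1 : v Z ^ 2 ≤ A ^ 2 := by rw [← sq_abs]; gcongr; exact hA Z hZ
    have h2 : w Z ^ 2 ≤ B ^ 2 := by rw [← sq_abs]; gcongr; exact hB Z hZ
    linarith
  refine ⟨⟨hc, hb.locSq ha, fun i => ?_⟩, hb⟩
  have habs : ∀ {g}, LocSq a g → LocSq a fun Z => |g Z| := fun hg =>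
    hg.mono hg.continuousOn.abs fun Z _ => by simp
  refine ((habs (hv.locSq_D i)).add (habs (hw.locSq_D i))).mono (continuousOn_D hc i) fun Z hZ => ?_
  rw [D_regNorm hε (hv.differentiableAt hZ) (hw.differentiableAt hZ), abs_div,
    abs_of_pos (regNorm_pos hε v w Z), div_le_iff₀ (regNorm_pos hε v w Z),
    abs_of_nonneg (a := |D i v Z| + |D i w Z|) (by positivity)]
  have h1 : |v Z| ≤ regNorm ε v w Z := Real.abs_le_sqrt (by nlinarith [sq_nonneg (w Z)])
  have h2 : |w Z| ≤ regNorm ε v w Z := Real.abs_le_sqrt (by nlinarith [sq_nonneg (v Z)])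
  refine (abs_add_le _ _).trans ?_
  rw [abs_mul, abs_mul, add_mul, mul_comm |D i v Z|, mul_comm |D i w Z|]
  gcongr

lemma dot_regNorm_mul_le (hε : 0 < ε) (hv : DifferentiableAt ℝ v Z) (hw : DifferentiableAt ℝ w Z)
    (hφ : DifferentiableAt ℝ φ Z) (hg : DifferentiableAt ℝ (regNorm ε v w) Z) :
    dot (fun Z => regNorm ε v w Z * φ Z) (fun Z => regNorm ε v w Z * φ Z) Z +
        φ Z ^ 2 * curv v w Z ≤
      dot v (fun Z => v Z * φ Z ^ 2) Z + dot w (fun Z => w Z * φ Z ^ 2) Z +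
        ((v Z ^ 2 + w Z ^ 2) * dot φ φ Z + ε * dot φ φ Z) := by
  have h2 : ∀ {g : Heis × ℝ → ℝ}, DifferentiableAt ℝ g Z → ∀ i,
      D i (fun Z => g Z * φ Z ^ 2) Z = g Z * (2 * φ Z * D i φ Z) + D i g Z * φ Z ^ 2 := by
    intro g hg i
    have e1 : D i (fun Z => φ Z ^ 2) Z = 2 * φ Z * D i φ Z := by
      have := along_mul (V := frame i) hφ hφ
      simp only [pow_two]; unfold D; rw [this]; ring
    exact (along_mul hg (hφ.pow 2)).trans (by rw [← e1]; rfl)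
  have h3 : ∀ i, D i (fun Z => regNorm ε v w Z * φ Z) Z =
      regNorm ε v w Z * D i φ Z + D i (regNorm ε v w) Z * φ Z := fun i => along_mul hg hφ
  simp only [dot, curv, Finset.mul_sum, ← Finset.sum_add_distrib]
  refine Finset.sum_le_sum fun i _ => ?_
  rw [h2 hv, h2 hw, h3, D_regNorm hε hv hw]
  set g := regNorm ε v w Z with hgdef
  have hg0 : 0 < g := regNorm_pos hε v w Z
  have hgsq : g ^ 2 = v Z ^ 2 + w Z ^ 2 + ε := regNorm_sq hε v w Z
  set N := v Z * D i v Z + w Z * D i w Z with hN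
  have key : (N / g) ^ 2 + (D i v Z * w Z - D i w Z * v Z) ^ 2 / (v Z ^ 2 + w Z ^ 2) ≤
      D i v Z ^ 2 + D i w Z ^ 2 := by
    rcases (add_nonneg (sq_nonneg (v Z)) (sq_nonneg (w Z))).eq_or_lt' with h0 | h0
    · have hv0 : v Z = 0 := by nlinarith [sq_nonneg (v Z), sq_nonneg (w Z)]
      have hw0 : w Z = 0 := by nlinarith [sq_nonneg (v Z), sq_nonneg (w Z)]
      simp [hN, hv0, hw0]; positivity
    · have h4 : (N / g) ^ 2 ≤ N ^ 2 / (v Z ^ 2 + w Z ^ 2) := by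
        rw [div_pow, hgsq]
        exact div_le_div_of_nonneg_left (sq_nonneg N) h0 (by linarith)
      have h5 : N ^ 2 / (v Z ^ 2 + w Z ^ 2) +
          (D i v Z * w Z - D i w Z * v Z) ^ 2 / (v Z ^ 2 + w Z ^ 2) =
          D i v Z ^ 2 + D i w Z ^ 2 := by rw [hN]; field_simp; ring
      linarith
  have e : (g * D i φ Z + N / g * φ Z) * (g * D i φ Z + N / g * φ Z) =
      g ^ 2 * D i φ Z ^ 2 + 2 * N * φ Z * D i φ Z + φ Z ^ 2 * (N / g) ^ 2 := by
    field_simp; ring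
  rw [e, hgsq]
  have := mul_le_mul_of_nonneg_left key (sq_nonneg (φ Z))
  rw [hN]
  rw [hN] at this
  nlinarith

end RegNorm

/-- The second variation is nonnegative on admissible functions. -/
def Stable (a : ℝ) (f : ℝ → ℝ) (u : Heis × ℝ → ℝ) : Prop :=
  ∀ ξ, Admissible a ξ →
    0 ≤ (∫ Z, dot ξ ξ Z ∂(μ a)) - ∫ x : Heis, deriv f (bdry u x) * bdry ξ x ^ 2

lemma integrable_sq_mul_curv (hv : Energy a v) (hw : Energy a w) (hφ : Cutoff φ) :
    Integrable (fun Z => φ Z ^ 2 * curv v w Z) (μ a) := by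
  have h1 : ∀ {g}, Energy a g → Integrable (fun Z => φ Z ^ 2 * dot g g Z) (μ a) := fun hg => by
    have : Integrable (fun Z => ∑ i, (D i _ Z * φ Z) ^ 2) (μ a) :=
      integrable_finsetSum _ fun i _ =>
        ((hg.locSq_D i).mul_bdd hφ.locBdd).integrable_sq (hφ.bddSupp.mul_left _)
    refine this.congr (ae_of_all _ fun Z => ?_)
    simp only [dot, Finset.mul_sum]
    exact Finset.sum_congr rfl fun i _ => by ring
  refine ((h1 hv).add (h1 hw)).mono' ?_ (ae_of_all _ fun Z => ?_)
  · refine (hφ.contDiff.continuous.aestronglyMeasurable.pow 2).mul ?_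
    refine AEMeasurable.aestronglyMeasurable (Finset.aemeasurable_fun_sum _ fun i _ => ?_)
    have hv' := hv.locSq.aesm.aemeasurable
    have hw' := hw.locSq.aesm.aemeasurable
    exact ((((hv.locSq_D i).aesm.aemeasurable.mul hw').sub
      ((hw.locSq_D i).aesm.aemeasurable.mul hv')).pow_const 2).div
      ((hv'.pow_const 2).add (hw'.pow_const 2))
  · rw [Real.norm_of_nonneg (mul_nonneg (sq_nonneg _) (curv_nonneg v w Z)), Pi.add_apply,
      ← mul_add]
    exact mul_le_mul_of_nonneg_left (curv_le v w Z) (sq_nonneg _)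

lemma BoundarySolution.poincare (hu : BoundarySolution a M f u) (hst : Stable a f u)
    (hb : ∀ i ≠ 2, LocBdd (D i u))
    (hS : ∀ Z ∈ halfSpace, 0 ≤ D 1 u Z * D 0 (R (0, 0, -4) u) Z - D 0 u Z * D 1 (R (0, 0, -4) u) Z)
    (hφ : Cutoff φ) :
    ∫ Z, φ Z ^ 2 * curv (D 0 u) (D 1 u) Z ∂(μ a) ≤
      ∫ Z, (D 0 u Z ^ 2 + D 1 u Z ^ 2) * dot φ φ Z ∂(μ a) := by
  have hT := hu.locSq_center hb
  have hEP := hu.energy_D_of_splitting (splitting_zero u) hT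
  have hEQ := hu.energy_D_of_splitting (splitting_one u) hT
  have hEτ := hu.energy_R _ hT
  have wP := hu.weak_D_of_splitting (splitting_zero u) hT
    (hEP.admissible_mul_cutoff (hb 0 (by decide)) hφ.sq)
  have wQ := hu.weak_D_of_splitting (splitting_one u) hT
    (hEQ.admissible_mul_cutoff (hb 1 (by decide)) hφ.sq)
  have aP := hEP.admissible_mul_cutoff (hb 0 (by decide)) hφ.sq
  have aQ := hEQ.admissible_mul_cutoff (hb 1 (by decide)) hφ.sq
  set P := D 0 u with hP
  set Q := D 1 u with hQ
  set τ := R (0, 0, -4) u with hτ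
  have tφ := HasTrace.of_continuous hφ.contDiff.continuous
  have tφ2 := HasTrace.of_continuous hφ.sq.contDiff.continuous
  have aφ : Admissible a φ :=
    ⟨.of_contDiff hu.weight.1 hφ.contDiff, hφ.bddSupp.exists_bound hφ.locBdd, hφ.bddSupp⟩
  have iK := integrable_sq_mul_curv hEP hEQ hφ
  have iφ := aφ.energy.integrable_dot aφ.energy aφ.bddSupp
  have iP := hEP.integrable_dot aP.energy aP.bddSupp
  have iQ := hEQ.integrable_dot aQ.energy aQ.bddSupp
  have iPQ : Integrable (fun Z => (P Z ^ 2 + Q Z ^ 2) * dot φ φ Z) (μ a) := by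
    refine ((integrable_sq_mul_dot hEP.locSq hφ).add (integrable_sq_mul_dot hEQ.locSq hφ)).congr
      (ae_of_all _ fun Z => ?_)
    simp only [Pi.add_apply]; ring
  have bP := hu.integrable_deriv_mul hEP aP
  have bQ := hu.integrable_deriv_mul hEQ aQ
  have bφ := hu.integrable_deriv_mul aφ.energy aφ
  set I := ∫ Z, (P Z ^ 2 + Q Z ^ 2) * dot φ φ Z ∂(μ a) with hI
  set A := ∫ Z, dot φ φ Z ∂(μ a) with hA
  set B := ∫ x : Heis, deriv f (bdry u x) * bdry φ x * bdry φ x with hB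
  have hsgn : 0 ≤ (∫ Z, Q Z * φ Z ^ 2 * D 0 τ Z ∂(μ a)) - ∫ Z, P Z * φ Z ^ 2 * D 1 τ Z ∂(μ a) := by
    have j1 : Integrable (fun Z => Q Z * φ Z ^ 2 * D 0 τ Z) (μ a) := by
      simpa only [mul_comm] using (hEτ.locSq_D 0).integrable_mul aQ.energy.locSq aQ.bddSupp
    have j2 : Integrable (fun Z => P Z * φ Z ^ 2 * D 1 τ Z) (μ a) := by
      simpa only [mul_comm] using (hEτ.locSq_D 1).integrable_mul aP.energy.locSq aP.bddSupp
    rw [← integral_sub j1 j2]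
    refine integral_nonneg_of_ae ?_
    filter_upwards [ae_mem_halfSpace a] with Z hZ
    have := mul_nonneg (sq_nonneg (φ Z)) (hS Z hZ)
    simp only [Pi.zero_apply]
    nlinarith
  have hε : ∀ ε > 0, ∫ Z, φ Z ^ 2 * curv P Q Z ∂(μ a) ≤ I + ε * (A - B) := by
    intro ε hε
    obtain ⟨hEg, hbg⟩ := energy_regNorm hu.weight.1 hε hEP hEQ (hb 0 (by decide)) (hb 1 (by decide))
    have ag := hEg.admissible_mul_cutoff hbg hφ
    have ig := ag.energy.integrable_dot ag.energy ag.bddSupp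
    have h1 := hst _ ag
    have iPQ1 : Integrable (fun Z => dot P (fun Z => P Z * φ Z ^ 2) Z +
        dot Q (fun Z => Q Z * φ Z ^ 2) Z) (μ a) := iP.add iQ
    have iPQ2 : Integrable (fun Z => (P Z ^ 2 + Q Z ^ 2) * dot φ φ Z + ε * dot φ φ Z) (μ a) :=
      iPQ.add (iφ.const_mul ε)
    have h2 : ∫ Z, (dot (fun Z => regNorm ε P Q Z * φ Z) (fun Z => regNorm ε P Q Z * φ Z) Z +
        φ Z ^ 2 * curv P Q Z) ∂(μ a) ≤
        ∫ Z, (dot P (fun Z => P Z * φ Z ^ 2) Z + dot Q (fun Z => Q Z * φ Z ^ 2) Z +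
        ((P Z ^ 2 + Q Z ^ 2) * dot φ φ Z + ε * dot φ φ Z)) ∂(μ a) := by
      refine integral_mono_ae (ig.add iK) (iPQ1.add iPQ2) ?_
      filter_upwards [ae_mem_halfSpace a] with Z hZ
      exact dot_regNorm_mul_le hε (hEP.differentiableAt hZ) (hEQ.differentiableAt hZ)
        (hφ.differentiableAt Z) (hEg.differentiableAt hZ)
    rw [integral_add ig iK, integral_add iPQ1 iPQ2,
      integral_add iP iQ, integral_add iPQ (iφ.const_mul ε), integral_const_mul, wP, wQ] at h2
    have h3 : ∫ x : Heis, deriv f (bdry u x) * bdry (fun Z => regNorm ε P Q Z * φ Z) x ^ 2 =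
        (∫ x : Heis, deriv f (bdry u x) * bdry P x * bdry (fun Z => P Z * φ Z ^ 2) x) +
        (∫ x : Heis, deriv f (bdry u x) * bdry Q x * bdry (fun Z => Q Z * φ Z ^ 2) x) + ε * B := by
      have bPQ : Integrable fun x : Heis =>
          deriv f (bdry u x) * bdry P x * bdry (fun Z => P Z * φ Z ^ 2) x +
          deriv f (bdry u x) * bdry Q x * bdry (fun Z => Q Z * φ Z ^ 2) x := bP.add bQ
      rw [hB, ← integral_add bP bQ, ← integral_const_mul, ← integral_add bPQ (bφ.const_mul ε)]
      have tP := hEP.hasTrace hu.weight.2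
      have tQ := hEQ.hasTrace hu.weight.2
      refine integral_congr_ae ?_
      filter_upwards [(tP.mul tφ2).2, (tQ.mul tφ2).2, tP, tQ, tφ] with x h4 h5 h6 h7 h8
      have h9 : bdry (fun Z => regNorm ε P Q Z * φ Z) x =
          Real.sqrt (bdry P x ^ 2 + bdry Q x ^ 2 + ε) * bdry φ x :=
        bdry_eq ((((h6.pow 2).add (h7.pow 2)).add_const ε).sqrt.mul h8)
      have h10 : bdry (fun Z => φ Z ^ 2) x = bdry φ x ^ 2 := bdry_eq (h8.pow 2)
      rw [h4, h5, h9, h10, mul_pow, Real.sq_sqrt (by positivity)]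
      ring
    rw [h3] at h1
    linarith
  have hlim : Tendsto (fun ε => I + ε * (A - B)) (𝓝[>] 0) (𝓝 (I + 0 * (A - B))) := by
    refine Tendsto.mono_left ?_ nhdsWithin_le_nhds
    exact (continuous_const.add (continuous_id.mul continuous_const)).tendsto 0
  rw [zero_mul, add_zero] at hlim
  exact ge_of_tendsto hlim (by filter_upwards [self_mem_nhdsWithin] with ε h using hε ε h)

end

end Heisenberg

namespace Heisenberg

noncomputable section

variable {a M : ℝ} {f : ℝ → ℝ} {u : Heis × ℝ → ℝ}

/-! ### Layer-cake formula -/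

lemma one_div_max_pow_four {r ρ τ₀ : ℝ} (hr : 0 < r) (hρ : ρ < τ₀) (h : r ≤ τ₀) :
    1 / max ρ r ^ 4 = 1 / τ₀ ^ 4 + ∫ τ in Ioc r τ₀, (Ioi ρ).indicator (fun τ => 4 / τ ^ 5) τ := by
  have hm : 0 < max ρ r := lt_max_of_lt_right hr
  have hmt : max ρ r ≤ τ₀ := max_le hρ.le h
  have hset : Ioc r τ₀ ∩ Ioi ρ = Ioc (max ρ r) τ₀ := by
    ext τ; simp only [mem_inter_iff, mem_Ioc, mem_Ioi, max_lt_iff]; tauto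
  rw [setIntegral_indicator measurableSet_Ioi, hset, ← intervalIntegral.integral_of_le hmt]
  have hpos : ∀ τ ∈ uIcc (max ρ r) τ₀, 0 < τ := fun τ hτ => by
    rw [uIcc_of_le hmt] at hτ; exact hm.trans_le hτ.1
  have hd : ∀ τ ∈ uIcc (max ρ r) τ₀, HasDerivAt (fun τ : ℝ => -(1 / τ ^ 4)) (4 / τ ^ 5) τ := by
    intro τ hτ
    have h0 := (hpos τ hτ).ne'
    have := ((hasDerivAt_pow 4 τ).inv (pow_ne_zero 4 h0)).neg
    simp only [one_div]
    refine this.congr_deriv ?_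
    field_simp
    norm_num
    ring
  have hi : IntervalIntegrable (fun τ : ℝ => 4 / τ ^ 5) volume (max ρ r) τ₀ :=
    ContinuousOn.intervalIntegrable fun τ hτ =>
      (ContinuousAt.div continuousAt_const (continuousAt_id.pow 5)
        (pow_ne_zero 5 (hpos τ hτ).ne')).continuousWithinAt
  rw [intervalIntegral.integral_eq_sub_of_hasDerivAt hd hi]
  ring

lemma integral_div_max_pow_four {α : Type*} [MeasurableSpace α] {ν : Measure α} [SFinite ν]
    {ρ G : α → ℝ} (hρ : Measurable ρ) {r τ₀ : ℝ} (hr : 0 < r) (h : r ≤ τ₀)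
    (hG : IntegrableOn G {z | ρ z < τ₀} ν) :
    ∫ z in {z | ρ z < τ₀}, G z * (1 / max (ρ z) r ^ 4) ∂ν =
      (∫ z in {z | ρ z < τ₀}, G z ∂ν) / τ₀ ^ 4 +
        4 * ∫ τ in r..τ₀, (∫ z in {z | ρ z < τ}, G z ∂ν) / τ ^ 5 := by
  have hm : ∀ τ, MeasurableSet {z | ρ z < τ} := fun τ => measurableSet_lt hρ measurable_const
  set ν' := ν.restrict {z | ρ z < τ₀} with hν'
  set k : α × ℝ → ℝ := fun p => G p.1 * (Ioi (ρ p.1)).indicator (fun τ => 4 / τ ^ 5) p.2 with hk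
  have hi5 : IntegrableOn (fun τ : ℝ => 4 / τ ^ 5) (Ioc r τ₀) := by
    refine (ContinuousOn.integrableOn_Icc (a := r) (b := τ₀) fun τ hτ => ?_).mono_set
      Ioc_subset_Icc_self
    exact (ContinuousAt.div continuousAt_const (continuousAt_id.pow 5)
      (pow_ne_zero 5 (hr.trans_le hτ.1).ne')).continuousWithinAt
  have hki : Integrable k (ν'.prod (volume.restrict (Ioc r τ₀))) := by
    have h1 : Integrable (fun p : α × ℝ => G p.1 * (4 / p.2 ^ 5))
      (ν'.prod (volume.restrict (Ioc r τ₀))) := Integrable.mul_prod hG hi5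
    have h2 : MeasurableSet {p : α × ℝ | ρ p.1 < p.2} :=
      measurableSet_lt (hρ.comp measurable_fst) measurable_snd
    refine (h1.indicator h2).congr (ae_of_all _ fun p => ?_)
    by_cases hp : ρ p.1 < p.2 <;> simp [hk, indicator, hp]
  have e1 : ∀ z ∈ {z | ρ z < τ₀}, G z * (1 / max (ρ z) r ^ 4) =
      G z / τ₀ ^ 4 + ∫ τ in Ioc r τ₀, k (z, τ) := fun z hz => by
    rw [one_div_max_pow_four hr hz h, mul_add, hk]
    simp only [integral_const_mul]
    ring
  rw [setIntegral_congr_fun (hm τ₀) e1, integral_add (hG.div_const _) hki.integral_prod_left,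
    integral_div, integral_integral_swap hki, intervalIntegral.integral_of_le h,
    ← integral_const_mul]
  congr 1
  refine setIntegral_congr_fun measurableSet_Ioc fun τ hτ => ?_
  have e2 : ∀ z, k (z, τ) = {z | ρ z < τ}.indicator G z * (4 / τ ^ 5) := fun z => by
    by_cases hz : ρ z < τ <;> simp [hk, indicator, hz]
  have e3 : {z | ρ z < τ₀} ∩ {z | ρ z < τ} = {z | ρ z < τ} :=
    inter_eq_right.2 fun z hz => lt_of_lt_of_le (show ρ z < τ from hz) hτ.2
  simp only [e2, integral_mul_const]
  rw [setIntegral_indicator (hm τ), e3]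
  ring

/-! ### The gauge -/

/-- The norm `(|x|² + y²)^{1/2}` on `ℍ × ℝ`. -/
def gaugeNorm (Z : Heis × ℝ) : ℝ := Real.sqrt (gauge Z.1 ^ 2 + Z.2 ^ 2)

/-- A smooth function that is slightly larger than `|x|² + y²`. -/
def gaugeReg (Z : Heis × ℝ) : ℝ :=
  Real.sqrt ((Z.1.1 ^ 2 + Z.1.2.1 ^ 2) ^ 2 + Z.1.2.2 ^ 2 + 1) + Z.2 ^ 2

lemma gauge_sq (x : Heis) :
    gauge x ^ 2 = Real.sqrt ((x.1 ^ 2 + x.2.1 ^ 2) ^ 2 + x.2.2 ^ 2) := by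
  rw [gauge, Real.sqrt_eq_rpow, ← Real.rpow_natCast, ← Real.rpow_mul (by positivity)]
  norm_num

lemma gaugeNorm_eq (Z : Heis × ℝ) : gaugeNorm Z =
    Real.sqrt (Real.sqrt ((Z.1.1 ^ 2 + Z.1.2.1 ^ 2) ^ 2 + Z.1.2.2 ^ 2) + Z.2 ^ 2) := by
  rw [gaugeNorm, gauge_sq]

lemma continuous_gaugeNorm : Continuous gaugeNorm := by
  rw [show gaugeNorm = _ from funext gaugeNorm_eq]
  fun_prop

lemma gaugeNorm_sq_lt (Z : Heis × ℝ) : gaugeNorm Z ^ 2 < gaugeReg Z := by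
  rw [gaugeNorm_eq, Real.sq_sqrt (by positivity), gaugeReg]
  have := Real.sqrt_lt_sqrt (x := (Z.1.1 ^ 2 + Z.1.2.1 ^ 2) ^ 2 + Z.1.2.2 ^ 2) (by positivity)
    (lt_add_one _)
  linarith

lemma gaugeReg_ge_one (Z : Heis × ℝ) : 1 ≤ gaugeReg Z := by
  have : 1 ≤ Real.sqrt ((Z.1.1 ^ 2 + Z.1.2.1 ^ 2) ^ 2 + Z.1.2.2 ^ 2 + 1) :=
    Real.one_le_sqrt.2 (by nlinarith [sq_nonneg (Z.1.1 ^ 2 + Z.1.2.1 ^ 2), sq_nonneg Z.1.2.2])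
  rw [gaugeReg]
  nlinarith [sq_nonneg Z.2]

lemma contDiff_gaugeReg {n : WithTop ℕ∞} : ContDiff ℝ n gaugeReg := by
  unfold gaugeReg
  exact (ContDiff.sqrt (by fun_prop) fun Z => by positivity).add (by fun_prop)

lemma dot_gaugeReg_le (Z : Heis × ℝ) :
    dot gaugeReg gaugeReg Z ≤ 4 * (Z.1.1 ^ 2 + Z.1.2.1 ^ 2 + Z.2 ^ 2) := by
  obtain ⟨⟨x, y, z⟩, w⟩ := Z
  have hx : HasFDerivAt (fun Z : Heis × ℝ => Z.1.1) ((ContinuousLinearMap.fst ℝ ℝ (ℝ × ℝ)).comp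
      (ContinuousLinearMap.fst ℝ Heis ℝ)) ((x, y, z), w) :=
    ((ContinuousLinearMap.fst ℝ ℝ (ℝ × ℝ)).comp (ContinuousLinearMap.fst ℝ Heis ℝ)).hasFDerivAt
  have hy : HasFDerivAt (fun Z : Heis × ℝ => Z.1.2.1) ((ContinuousLinearMap.fst ℝ ℝ ℝ).comp
      ((ContinuousLinearMap.snd ℝ ℝ (ℝ × ℝ)).comp (ContinuousLinearMap.fst ℝ Heis ℝ)))
      ((x, y, z), w) :=
    ((ContinuousLinearMap.fst ℝ ℝ ℝ).comp
      ((ContinuousLinearMap.snd ℝ ℝ (ℝ × ℝ)).comp (ContinuousLinearMap.fst ℝ Heis ℝ))).hasFDerivAt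
  have hz : HasFDerivAt (fun Z : Heis × ℝ => Z.1.2.2) ((ContinuousLinearMap.snd ℝ ℝ ℝ).comp
      ((ContinuousLinearMap.snd ℝ ℝ (ℝ × ℝ)).comp (ContinuousLinearMap.fst ℝ Heis ℝ)))
      ((x, y, z), w) :=
    ((ContinuousLinearMap.snd ℝ ℝ ℝ).comp
      ((ContinuousLinearMap.snd ℝ ℝ (ℝ × ℝ)).comp (ContinuousLinearMap.fst ℝ Heis ℝ))).hasFDerivAt
  have hw : HasFDerivAt (fun Z : Heis × ℝ => Z.2) (ContinuousLinearMap.snd ℝ Heis ℝ)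
      ((x, y, z), w) := (ContinuousLinearMap.snd ℝ Heis ℝ).hasFDerivAt
  have hN : (0 : ℝ) < (x ^ 2 + y ^ 2) ^ 2 + z ^ 2 + 1 := by positivity
  have h := (((((hx.pow 2).add (hy.pow 2)).pow 2).add (hz.pow 2)).add_const 1).sqrt hN.ne' |>.add
    (hw.pow 2)
  have h' : fderiv ℝ gaugeReg ((x, y, z), w) = _ := HasFDerivAt.fderiv (f := gaugeReg) h
  set S := Real.sqrt ((x ^ 2 + y ^ 2) ^ 2 + z ^ 2 + 1) with hS
  have hS0 : 0 < S := Real.sqrt_pos.2 hN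
  have hSS : S ^ 2 = (x ^ 2 + y ^ 2) ^ 2 + z ^ 2 + 1 := Real.sq_sqrt hN.le
  have d0 : D 0 gaugeReg ((x, y, z), w) = 2 * ((x ^ 2 + y ^ 2) * x + z * y) / S := by
    unfold D along
    rw [h']
    simp [frame, affineField, ← hS]
    field_simp
  have d1 : D 1 gaugeReg ((x, y, z), w) = 2 * ((x ^ 2 + y ^ 2) * y - z * x) / S := by
    unfold D along
    rw [h']
    simp [frame, affineField, ← hS]
    field_simp
    ring
  have d2 : D 2 gaugeReg ((x, y, z), w) = 2 * w := by
    unfold D along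
    rw [h']
    simp [frame, affineField, ← hS]
  rw [dot, Fin.sum_univ_three, d0, d1, d2]
  have e : 2 * ((x ^ 2 + y ^ 2) * x + z * y) / S * (2 * ((x ^ 2 + y ^ 2) * x + z * y) / S) +
      2 * ((x ^ 2 + y ^ 2) * y - z * x) / S * (2 * ((x ^ 2 + y ^ 2) * y - z * x) / S) =
      4 * ((x ^ 2 + y ^ 2) * (S ^ 2 - 1)) / S ^ 2 := by
    rw [div_mul_div_comm, div_mul_div_comm, ← add_div, ← pow_two S]
    congr 1
    rw [hSS]; ring
  have e' : 4 * ((x ^ 2 + y ^ 2) * (S ^ 2 - 1)) / S ^ 2 ≤ 4 * (x ^ 2 + y ^ 2) := by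
    rw [div_le_iff₀ (by positivity)]
    nlinarith [sq_nonneg x, sq_nonneg y]
  simp only
  linarith

/-- Sublevel sets of the gauge are bounded. -/
lemma exists_gaugeReg_sublevel (K : ℝ) : ∃ r > 0, ∀ Z : Heis × ℝ, gaugeNorm Z ^ 2 ≤ K →
    Z.1.1 ^ 2 + Z.1.2.1 ^ 2 + Z.1.2.2 ^ 2 + Z.2 ^ 2 < r ^ 2 := by
  refine ⟨2 * (|K| + 1), by positivity, fun Z hZ => ?_⟩
  rw [gaugeNorm_eq, Real.sq_sqrt (by positivity)] at hZ
  set S := Real.sqrt ((Z.1.1 ^ 2 + Z.1.2.1 ^ 2) ^ 2 + Z.1.2.2 ^ 2) with hS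
  have hS0 : 0 ≤ S := Real.sqrt_nonneg _
  have hSS : S ^ 2 = (Z.1.1 ^ 2 + Z.1.2.1 ^ 2) ^ 2 + Z.1.2.2 ^ 2 := Real.sq_sqrt (by positivity)
  have h1 : Z.1.1 ^ 2 + Z.1.2.1 ^ 2 ≤ S := Real.le_sqrt_of_sq_le (by nlinarith [sq_nonneg Z.1.2.2])
  have h2 : S ≤ |K| := by nlinarith [sq_nonneg Z.2, le_abs_self K]
  have h3 : Z.2 ^ 2 ≤ |K| := by nlinarith [le_abs_self K]
  have h4 : Z.1.2.2 ^ 2 ≤ |K| ^ 2 := by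
    nlinarith [sq_nonneg (Z.1.1 ^ 2 + Z.1.2.1 ^ 2), abs_nonneg K]
  nlinarith [abs_nonneg K]

/-! ### Logarithmic cutoffs -/

/-- The logarithmic cutoff, equal to `1` where `gaugeReg ≤ r` and to `0` where
`gaugeReg ≥ r²`. -/
def logCutoff (r : ℝ) (Z : Heis × ℝ) : ℝ :=
  Real.smoothTransition (2 - Real.log (gaugeReg Z) / Real.log r)

lemma exists_abs_deriv_smoothTransition_le : ∃ C, 0 ≤ C ∧ ∀ t,
    |deriv Real.smoothTransition t| ≤ C ∧ (t < 0 ∨ 1 < t → deriv Real.smoothTransition t = 0) := by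
  have h0 : ∀ t, t < 0 ∨ 1 < t → deriv Real.smoothTransition t = 0 := by
    rintro t (ht | ht)
    · rw [Filter.EventuallyEq.deriv_eq (f := fun _ => (0 : ℝ))]
      · simp
      · filter_upwards [Iio_mem_nhds ht] with s hs using Real.smoothTransition.zero_of_nonpos hs.le
    · rw [Filter.EventuallyEq.deriv_eq (f := fun _ => (1 : ℝ))]
      · simp
      · filter_upwards [Ioi_mem_nhds ht] with s hs using Real.smoothTransition.one_of_one_le hs.le
  have hc : HasCompactSupport (deriv Real.smoothTransition) :=
    HasCompactSupport.intro (isCompact_Icc (a := (0 : ℝ)) (b := 1)) fun t ht => h0 t (by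
      by_contra! h; exact ht ⟨h.1, h.2⟩)
  obtain ⟨C, hC⟩ := hc.exists_bound_of_continuous
    ((Real.smoothTransition.contDiff (n := 1)).continuous_deriv le_rfl)
  exact ⟨C, (norm_nonneg _).trans (hC 0), fun t => ⟨hC t, h0 t⟩⟩

section LogCutoff

variable {r : ℝ}

lemma logCutoff_eq_one (hr : 1 < r) {Z : Heis × ℝ} (hZ : gaugeReg Z ≤ r) : logCutoff r Z = 1 := by
  refine Real.smoothTransition.one_of_one_le ?_
  have h1 := Real.log_le_log (by linarith [gaugeReg_ge_one Z]) hZ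
  have := (div_le_one (Real.log_pos hr)).2 h1
  linarith

lemma logCutoff_eq_zero (hr : 1 < r) {Z : Heis × ℝ} (hZ : r ^ 2 ≤ gaugeReg Z) :
    logCutoff r Z = 0 := by
  refine Real.smoothTransition.zero_of_nonpos ?_
  have h1 := Real.log_le_log (by positivity) hZ
  rw [Real.log_pow] at h1
  have := (le_div_iff₀ (Real.log_pos hr)).2 h1
  push_cast at this
  linarith

lemma cutoff_logCutoff (hr : 1 < r) : Cutoff (logCutoff r) := by
  refine ⟨?_, ?_⟩
  · refine Real.smoothTransition.contDiff.comp (contDiff_const.sub (ContDiff.div_const ?_ _))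
    exact contDiff_gaugeReg.log fun Z => by linarith [gaugeReg_ge_one Z]
  · obtain ⟨K, -, hK⟩ := exists_gaugeReg_sublevel (r ^ 2)
    refine HasCompactSupport.intro (K := Metric.closedBall 0 |K|) (isCompact_closedBall _ _)
      fun Z hZ => logCutoff_eq_zero hr ?_
    by_contra! h
    have h1 := hK Z ((gaugeNorm_sq_lt Z).trans h).le
    refine hZ ?_
    rw [mem_closedBall_zero_iff]
    simp only [Prod.norm_def, Real.norm_eq_abs, max_le_iff]
    refine ⟨⟨?_, ?_, ?_⟩, ?_⟩ <;> refine (sq_lt_sq.1 ?_).le <;>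
      nlinarith [sq_nonneg Z.1.1, sq_nonneg Z.1.2.1, sq_nonneg Z.1.2.2, sq_nonneg Z.2]

lemma dot_logCutoff (hr : 1 < r) (Z : Heis × ℝ) :
    dot (logCutoff r) (logCutoff r) Z =
      deriv Real.smoothTransition (2 - Real.log (gaugeReg Z) / Real.log r) ^ 2 *
        dot gaugeReg gaugeReg Z / (gaugeReg Z ^ 2 * Real.log r ^ 2) := by
  have hg : 0 < gaugeReg Z := by linarith [gaugeReg_ge_one Z]
  have hl := Real.log_pos hr
  have h1 : HasDerivAt (fun s => Real.smoothTransition (2 - Real.log s / Real.log r))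
      (deriv Real.smoothTransition (2 - Real.log (gaugeReg Z) / Real.log r) *
        (-((gaugeReg Z)⁻¹ / Real.log r))) (gaugeReg Z) :=
    HasDerivAt.comp (gaugeReg Z)
      ((Real.smoothTransition.contDiff (n := 1)).differentiable one_ne_zero _).hasDerivAt
      (((Real.hasDerivAt_log hg.ne').div_const _).const_sub 2)
  have h2 : ∀ i, D i (logCutoff r) Z = _ := fun i => along_comp (V := frame i)
    (g := fun s => Real.smoothTransition (2 - Real.log s / Real.log r)) h1
    ((contDiff_gaugeReg (n := 1)).differentiable one_ne_zero Z)
  simp only [dot, h2, Finset.mul_sum, Finset.sum_div]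
  refine Finset.sum_congr rfl fun i _ => ?_
  unfold D
  field_simp

/-- The squared gradient of a logarithmic cutoff. -/
lemma exists_dot_logCutoff_le : ∃ C, 0 ≤ C ∧ ∀ r, 1 < r → ∀ Z : Heis × ℝ,
    dot (logCutoff r) (logCutoff r) Z ≤ {Z | gaugeNorm Z < r}.indicator (fun Z =>
      C / Real.log r ^ 2 * (4 * (Z.1.1 ^ 2 + Z.1.2.1 ^ 2 + Z.2 ^ 2) *
        (1 / max (gaugeNorm Z) (Real.sqrt r) ^ 4))) Z := by
  obtain ⟨C, hC0, hC⟩ := exists_abs_deriv_smoothTransition_le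
  refine ⟨C ^ 2, sq_nonneg _, fun r hr Z => ?_⟩
  have hl := Real.log_pos hr
  have hg : 0 < gaugeReg Z := by linarith [gaugeReg_ge_one Z]
  have hN : 0 ≤ gaugeNorm Z := Real.sqrt_nonneg _
  rw [dot_logCutoff hr]
  set t := 2 - Real.log (gaugeReg Z) / Real.log r with ht
  have hrhs : 0 ≤ {Z | gaugeNorm Z < r}.indicator (fun Z =>
      C ^ 2 / Real.log r ^ 2 * (4 * (Z.1.1 ^ 2 + Z.1.2.1 ^ 2 + Z.2 ^ 2) *
        (1 / max (gaugeNorm Z) (Real.sqrt r) ^ 4))) Z :=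
    indicator_nonneg (fun Z _ => by positivity) Z
  by_cases h : t < 0 ∨ 1 < t
  · rw [(hC t).2 h]; simpa using hrhs
  push Not at h
  have h1 : r ≤ gaugeReg Z := by
    have : 1 ≤ Real.log (gaugeReg Z) / Real.log r := by linarith [h.2]
    rw [le_div_iff₀ hl, one_mul] at this
    exact (Real.log_le_log_iff (by linarith) hg).1 this
  have h2 : gaugeReg Z ≤ r ^ 2 := by
    have : Real.log (gaugeReg Z) / Real.log r ≤ 2 := by linarith [h.1]
    rw [div_le_iff₀ hl, show 2 * Real.log r = Real.log (r ^ 2) by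
      rw [Real.log_pow]; norm_num] at this
    exact (Real.log_le_log_iff hg (by positivity)).1 this
  have h3 : gaugeNorm Z < r := lt_of_pow_lt_pow_left₀ 2 (by linarith)
    ((gaugeNorm_sq_lt Z).trans_le h2)
  rw [indicator_of_mem (show Z ∈ {Z | gaugeNorm Z < r} from h3)]
  have h4 : max (gaugeNorm Z) (Real.sqrt r) ^ 4 ≤ gaugeReg Z ^ 2 := by
    have : max (gaugeNorm Z) (Real.sqrt r) ^ 2 ≤ gaugeReg Z := by
      rcases max_cases (gaugeNorm Z) (Real.sqrt r) with h | h <;> rw [h.1]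
      · exact (gaugeNorm_sq_lt Z).le
      · rwa [Real.sq_sqrt (by linarith)]
    calc _ = (max (gaugeNorm Z) (Real.sqrt r) ^ 2) ^ 2 := by ring
      _ ≤ _ := by gcongr
  have hm : 0 < max (gaugeNorm Z) (Real.sqrt r) :=
    lt_max_of_lt_right (Real.sqrt_pos.2 (by linarith))
  have h5 : deriv Real.smoothTransition t ^ 2 ≤ C ^ 2 := by
    rw [← sq_abs]; gcongr; exact (hC t).1
  have h6 : 0 ≤ dot gaugeReg gaugeReg Z := Finset.sum_nonneg fun i _ => mul_self_nonneg _
  calc deriv Real.smoothTransition t ^ 2 * dot gaugeReg gaugeReg Z /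
        (gaugeReg Z ^ 2 * Real.log r ^ 2)
      ≤ C ^ 2 * (4 * (Z.1.1 ^ 2 + Z.1.2.1 ^ 2 + Z.2 ^ 2)) /
        (max (gaugeNorm Z) (Real.sqrt r) ^ 4 * Real.log r ^ 2) := by
        gcongr
        exact dot_gaugeReg_le Z
    _ = _ := by field_simp

end LogCutoff

/-! ### The energy estimate -/

lemma norm_gradH_sq (u : Heis × ℝ → ℝ) (Z : Heis × ℝ) :
    ‖gradH u Z‖ ^ 2 = D 0 u Z ^ 2 + D 1 u Z ^ 2 := by
  simp [gradH, EuclideanSpace.norm_sq_eq, D_zero, D_one, Fin.sum_univ_two]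

lemma gaugeBall_eq (τ : ℝ) : gaugeBall τ = halfSpace ∩ {Z | gaugeNorm Z < τ} := rfl

lemma weightedEnergy_eq (a : ℝ) (u : Heis × ℝ → ℝ) (τ : ℝ) :
    weightedEnergy a u τ = ∫ Z in {Z | gaugeNorm Z < τ}, (D 0 u Z ^ 2 + D 1 u Z ^ 2) *
      (4 * (Z.1.1 ^ 2 + Z.1.2.1 ^ 2 + Z.2 ^ 2)) ∂(μ a) := by
  have hm : MeasurableSet {Z | gaugeNorm Z < τ} :=
    measurableSet_lt continuous_gaugeNorm.measurable measurable_const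
  rw [← μ_restrict_halfSpace, Measure.restrict_restrict hm, inter_comm, ← gaugeBall_eq,
    setIntegral_μ a _ (by rw [gaugeBall_eq]; exact measurableSet_halfSpace.inter hm)
      fun Z hZ => hZ.1, weightedEnergy]
  refine integral_congr_ae (ae_of_all _ fun Z => ?_)
  simp only [norm_gradH_sq]
  ring

lemma integrableOn_weightedEnergy (h0 : LocSq a (D 0 u)) (h1 : LocSq a (D 1 u)) (τ : ℝ) :
    IntegrableOn (fun Z => (D 0 u Z ^ 2 + D 1 u Z ^ 2) *
      (4 * (Z.1.1 ^ 2 + Z.1.2.1 ^ 2 + Z.2 ^ 2))) {Z | gaugeNorm Z < τ} (μ a) := by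
  obtain ⟨r, hr, h⟩ := exists_gaugeReg_sublevel (τ ^ 2)
  have hm : MeasurableSet {Z | gaugeNorm Z < τ} :=
    measurableSet_lt continuous_gaugeNorm.measurable measurable_const
  have hsub : halfSpace ∩ {Z | gaugeNorm Z < τ} ⊆ halfBall r := fun Z hZ =>
    ⟨hZ.1, h Z (pow_le_pow_left₀ (Real.sqrt_nonneg _) (le_of_lt hZ.2) 2)⟩
  have h2 : IntegrableOn (fun Z => (D 0 u Z ^ 2 + D 1 u Z ^ 2) *
      (4 * (Z.1.1 ^ 2 + Z.1.2.1 ^ 2 + Z.2 ^ 2))) (halfBall r) (μ a) := by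
    have h3 : IntegrableOn (fun Z => D 0 u Z ^ 2 + D 1 u Z ^ 2) (halfBall r) (μ a) :=
      ((memLp_two_iff_integrable_sq (h0.memLp r).aestronglyMeasurable).1 (h0.memLp r)).add
        ((memLp_two_iff_integrable_sq (h1.memLp r).aestronglyMeasurable).1 (h1.memLp r))
    refine h3.mul_bdd (c := 4 * r ^ 2) (Continuous.aestronglyMeasurable (by fun_prop)) ?_
    filter_upwards [ae_restrict_mem (measurableSet_halfBall r)] with Z hZ
    rw [Real.norm_of_nonneg (by positivity)]
    nlinarith [hZ.2, sq_nonneg Z.1.2.2]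
  have h3 := h2.mono_set hsub
  rwa [IntegrableOn, inter_comm, ← Measure.restrict_restrict hm, μ_restrict_halfSpace] at h3

lemma exists_integral_sq_mul_dot_logCutoff_le : ∃ C, 0 < C ∧ ∀ {a : ℝ} {u : Heis × ℝ → ℝ},
    LocSq a (D 0 u) → LocSq a (D 1 u) → ∀ r, 1 < r →
    ∫ Z, (D 0 u Z ^ 2 + D 1 u Z ^ 2) * dot (logCutoff r) (logCutoff r) Z ∂(μ a) ≤
      C * (((∫ τ in Real.sqrt r..r, weightedEnergy a u τ / τ ^ 5) +
        weightedEnergy a u r / r ^ 4) / Real.log r ^ 2) := by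
  obtain ⟨C, hC0, hC⟩ := exists_dot_logCutoff_le
  refine ⟨4 * C + 1, by positivity, fun {a u} h0 h1 r hr => ?_⟩
  have hl := Real.log_pos hr
  have hm : MeasurableSet {Z | gaugeNorm Z < r} :=
    measurableSet_lt continuous_gaugeNorm.measurable measurable_const
  set G : Heis × ℝ → ℝ := fun Z => (D 0 u Z ^ 2 + D 1 u Z ^ 2) *
      (4 * (Z.1.1 ^ 2 + Z.1.2.1 ^ 2 + Z.2 ^ 2)) with hG
  have hGi := integrableOn_weightedEnergy h0 h1 r
  have hs : 0 < Real.sqrt r := Real.sqrt_pos.2 (by linarith)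
  have hsr : Real.sqrt r ≤ r := Real.sqrt_le_self_iff.2 (Or.inr hr.le)
  have key := integral_div_max_pow_four continuous_gaugeNorm.measurable hs hsr hGi
  have hη : ∀ τ, weightedEnergy a u τ = ∫ Z in {Z | gaugeNorm Z < τ}, G Z ∂(μ a) :=
    weightedEnergy_eq a u
  have hη0 : ∀ τ, 0 ≤ weightedEnergy a u τ := fun τ => by
    rw [hη]; exact integral_nonneg fun Z => by simp only [hG, Pi.zero_apply]; positivity
  have hi : Integrable (fun Z => {Z | gaugeNorm Z < r}.indicator (fun Z =>
      C / Real.log r ^ 2 * (G Z * (1 / max (gaugeNorm Z) (Real.sqrt r) ^ 4))) Z) (μ a) := by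
    refine IntegrableOn.integrable_indicator (Integrable.const_mul ?_ _) hm
    refine Integrable.mul_bdd (c := 1 / Real.sqrt r ^ 4) hGi ?_ (ae_of_all _ fun Z => ?_)
    · refine Measurable.aestronglyMeasurable ?_
      have := continuous_gaugeNorm.measurable
      fun_prop
    · rw [Real.norm_of_nonneg (by positivity)]
      gcongr
      exact le_max_right _ _
  calc ∫ Z, (D 0 u Z ^ 2 + D 1 u Z ^ 2) * dot (logCutoff r) (logCutoff r) Z ∂(μ a)
      ≤ ∫ Z, {Z | gaugeNorm Z < r}.indicator (fun Z =>
          C / Real.log r ^ 2 * (G Z * (1 / max (gaugeNorm Z) (Real.sqrt r) ^ 4))) Z ∂(μ a) := by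
        refine integral_mono_of_nonneg (ae_of_all _ fun Z => ?_) hi (ae_of_all _ fun Z => ?_)
        · exact mul_nonneg (by positivity) (Finset.sum_nonneg fun i _ => mul_self_nonneg _)
        · refine (mul_le_mul_of_nonneg_left (hC r hr Z) (by positivity)).trans_eq ?_
          by_cases hZ : gaugeNorm Z < r
          · simp only [indicator, mem_ofPred_eq, hZ, if_true, hG]; ring
          · simp [indicator, hZ]
    _ = C / Real.log r ^ 2 * (weightedEnergy a u r / r ^ 4 +
          4 * ∫ τ in Real.sqrt r..r, weightedEnergy a u τ / τ ^ 5) := by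
        rw [integral_indicator hm, integral_const_mul, key]
        simp only [hη, hG]
    _ ≤ _ := by
        have hI : 0 ≤ ∫ τ in Real.sqrt r..r, weightedEnergy a u τ / τ ^ 5 :=
          intervalIntegral.integral_nonneg hsr fun τ hτ =>
            div_nonneg (hη0 τ) (pow_nonneg (hs.le.trans hτ.1) 5)
        have hJ : 0 ≤ weightedEnergy a u r / r ^ 4 := div_nonneg (hη0 r) (by positivity)
        rw [div_mul_eq_mul_div, mul_div_assoc']
        refine div_le_div_of_nonneg_right ?_ (by positivity)
        nlinarith [mul_nonneg hC0 hI, mul_nonneg hC0 hJ]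

/-! ### Vanishing of the curvature term -/

lemma measure_pos_of_isOpen {U : Set (Heis × ℝ)} (hU : IsOpen U) (hne : U.Nonempty)
    (hs : U ⊆ halfSpace) : 0 < μ a U := by
  rw [pos_iff_ne_zero]
  intro h
  rw [μ_eq, withDensity_apply_eq_zero (by fun_prop)] at h
  have h1 : U ⊆ {Z : Heis × ℝ | ENNReal.ofReal (Z.2 ^ a) ≠ 0} ∩ U := fun Z hZ =>
    ⟨by simpa using Real.rpow_pos_of_pos (hs hZ) a, hZ⟩
  have h2 := measure_mono_null h1 h
  rw [Measure.restrict_apply hU.measurableSet, inter_eq_left.2 hs] at h2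
  exact (hU.measure_pos volume hne).ne' h2

lemma eq_zero_of_integral_curv_le {v w : Heis × ℝ → ℝ} (hv : Energy a v) (hw : Energy a w)
    (h : ∀ r > 0, ∫ Z in halfBall r, curv v w Z ∂(μ a) ≤ 0) {Z : Heis × ℝ} (hZ : Z ∈ halfSpace)
    (h0 : v Z ^ 2 + w Z ^ 2 ≠ 0) (i : Fin 3) : D i v Z * w Z - D i w Z * v Z = 0 := by
  by_contra hne
  obtain ⟨r, hr, hZr⟩ : ∃ r > 0, Z ∈ halfBall r := by
    refine ⟨1 + (Z.1.1 ^ 2 + Z.1.2.1 ^ 2 + Z.1.2.2 ^ 2 + Z.2 ^ 2), by positivity, hZ, ?_⟩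
    nlinarith [sq_nonneg Z.1.1, sq_nonneg Z.1.2.1, sq_nonneg Z.1.2.2, sq_nonneg Z.2]
  obtain ⟨φ, hφ, -, hφ1⟩ := exists_cutoff_halfBall r
  have hi : IntegrableOn (curv v w) (halfBall r) (μ a) :=
    (integrable_sq_mul_curv hv hw hφ).integrableOn.congr_fun
      (fun Z hZ => by simp [hφ1 Z hZ]) (measurableSet_halfBall r)
  have hint : ∫ Z in halfBall r, curv v w Z ∂(μ a) = 0 :=
    le_antisymm (h r hr) (integral_nonneg fun Z => curv_nonneg v w Z)
  rw [setIntegral_eq_zero_iff_of_nonneg_ae (ae_of_all _ fun Z => curv_nonneg v w Z) hi] at hint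
  have hc1 : ContinuousOn (fun Z => D i v Z * w Z - D i w Z * v Z) halfSpace :=
    ((continuousOn_D hv.contDiffOn i).mul hw.contDiffOn.continuousOn).sub
      ((continuousOn_D hw.contDiffOn i).mul hv.contDiffOn.continuousOn)
  have hc2 : ContinuousOn (fun Z => v Z ^ 2 + w Z ^ 2) halfSpace :=
    (hv.contDiffOn.continuousOn.pow 2).add (hw.contDiffOn.continuousOn.pow 2)
  set U := halfBall r ∩ ((halfSpace ∩ (fun Z => D i v Z * w Z - D i w Z * v Z) ⁻¹' {0}ᶜ) ∩
    (halfSpace ∩ (fun Z => v Z ^ 2 + w Z ^ 2) ⁻¹' {0}ᶜ)) with hU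
  have hUo : IsOpen U := (isOpen_halfBall r).inter
    ((hc1.isOpen_inter_preimage isOpen_halfSpace isOpen_compl_singleton).inter
      (hc2.isOpen_inter_preimage isOpen_halfSpace isOpen_compl_singleton))
  have hpos : 0 < μ a U :=
    measure_pos_of_isOpen hUo ⟨Z, hZr, ⟨hZ, hne⟩, hZ, h0⟩ fun W hW => hW.1.1
  refine hpos.ne' ?_
  have h3 : ∀ᵐ W ∂((μ a).restrict (halfBall r)), W ∉ U := by
    filter_upwards [hint] with W hW hWU
    have h4 : 0 < v W ^ 2 + w W ^ 2 := lt_of_le_of_ne (by positivity) (Ne.symm hWU.2.2.2)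
    have h5 : (D i v W * w W - D i w W * v W) ^ 2 / (v W ^ 2 + w W ^ 2) ≤ curv v w W :=
      Finset.single_le_sum (f := fun i => (D i v W * w W - D i w W * v W) ^ 2 /
        (v W ^ 2 + w W ^ 2)) (fun j _ => by positivity) (Finset.mem_univ i)
    have h6 : 0 < (D i v W * w W - D i w W * v W) ^ 2 / (v W ^ 2 + w W ^ 2) :=
      div_pos (sq_pos_of_ne_zero hWU.2.1.2) h4
    simp only [Pi.zero_apply] at hW
    linarith
  rw [ae_iff, Measure.restrict_apply (by simpa using hUo.measurableSet)] at h3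
  refine measure_mono_null (fun W hW => ?_) h3
  exact ⟨by simpa using hW, hW.1⟩

/-- The direction of the horizontal gradient of a stable solution of slow growth is locally
constant. -/
lemma BoundarySolution.direction_const (hu : BoundarySolution a M f u) (hst : Stable a f u)
    (hb : ∀ i ≠ 2, LocBdd (D i u))
    (hS : ∀ Z ∈ halfSpace, 0 ≤ D 1 u Z * D 0 (R (0, 0, -4) u) Z - D 0 u Z * D 1 (R (0, 0, -4) u) Z)
    (hgrowth : ∀ ε > 0, ∃ᶠ r in atTop, ((∫ τ in Real.sqrt r..r, weightedEnergy a u τ / τ ^ 5) +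
      weightedEnergy a u r / r ^ 4) / Real.log r ^ 2 < ε)
    {Z : Heis × ℝ} (hZ : Z ∈ halfSpace) (h0 : D 0 u Z ^ 2 + D 1 u Z ^ 2 ≠ 0) (i : Fin 3) :
    D i (D 0 u) Z * D 1 u Z - D i (D 1 u) Z * D 0 u Z = 0 := by
  have hT := hu.locSq_center hb
  have hE0 := hu.energy_D_of_splitting (splitting_zero u) hT
  have hE1 := hu.energy_D_of_splitting (splitting_one u) hT
  refine eq_zero_of_integral_curv_le hE0 hE1 (fun ρ hρ => ?_) hZ h0 i
  obtain ⟨C, hC0, hC⟩ := exists_integral_sq_mul_dot_logCutoff_le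
  obtain ⟨K, hK⟩ := (LocBdd.of_continuous
    (contDiff_gaugeReg (n := 0)).continuous).bound ρ
  refine le_of_forall_pos_le_add fun ε hε => ?_
  obtain ⟨r, hr, hr1, hrK⟩ := ((hgrowth (ε / C) (by positivity)).and_eventually
    ((eventually_gt_atTop 1).and (eventually_ge_atTop K))).exists
  have h1 := hC hE0.locSq hE1.locSq r hr1
  have h2 := hu.poincare hst hb hS (cutoff_logCutoff hr1)
  have h3 : ∫ Z in halfBall ρ, curv (D 0 u) (D 1 u) Z ∂(μ a) ≤
      ∫ Z, logCutoff r Z ^ 2 * curv (D 0 u) (D 1 u) Z ∂(μ a) := by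
    refine le_trans (le_of_eq ?_) (setIntegral_le_integral (s := halfBall ρ)
      (integrable_sq_mul_curv hE0 hE1 (cutoff_logCutoff hr1))
      (ae_of_all _ fun Z => mul_nonneg (sq_nonneg _) (curv_nonneg _ _ _)))
    refine setIntegral_congr_fun (measurableSet_halfBall ρ) fun Z hZ => ?_
    rw [logCutoff_eq_one hr1 ((le_abs_self _).trans ((hK Z hZ).trans hrK)), one_pow, one_mul]
  have h4 := mul_lt_mul_of_pos_left hr hC0
  rw [mul_div_cancel₀ _ hC0.ne'] at h4
  linarith

end

end Heisenberg

namespace Heisenberg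

noncomputable section

variable {a M : ℝ} {f : ℝ → ℝ} {u : Heis × ℝ → ℝ} {Z : Heis × ℝ}

/-! ### Truncation of the nonlinearity -/

/-- A `C¹` function agrees on a bounded interval with one of bounded derivative. -/
lemma exists_contDiff_eqOn (hf : ContDiff ℝ 1 f) {B : ℝ} (hB : 0 ≤ B) :
    ∃ g : ℝ → ℝ, ∃ M, ContDiff ℝ 1 g ∧ (∀ s, |deriv g s| ≤ M) ∧
      ∀ s, |s| ≤ B → g s = f s ∧ deriv g s = deriv f s := by
  have hc := hf.continuous_deriv le_rfl
  have hBB : -B ≤ B := by linarith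
  set k : ℝ → ℝ := fun s => deriv f (projIcc (-B) B hBB s) with hk
  have hkc : Continuous k := hc.comp (continuous_subtype_val.comp continuous_projIcc)
  have hd : ∀ s, HasDerivAt (fun s => f 0 + ∫ t in (0 : ℝ)..s, k t) (k s) s := fun s =>
    (hkc.integral_hasStrictDerivAt 0 s).hasDerivAt.const_add _
  have hdg : deriv (fun s => f 0 + ∫ t in (0 : ℝ)..s, k t) = k := funext fun s => (hd s).deriv
  have hks : ∀ s, |s| ≤ B → k s = deriv f s := fun s hs => by
    simp only [hk, projIcc_of_mem hBB (abs_le.1 hs)]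
  obtain ⟨M, hM⟩ := isCompact_Icc (a := -B) (b := B) |>.exists_bound_of_continuousOn hc.continuousOn
  refine ⟨fun s => f 0 + ∫ t in (0 : ℝ)..s, k t, M, ?_, fun s => ?_, fun s hs => ⟨?_, ?_⟩⟩
  · exact contDiff_one_iff_deriv.2 ⟨fun s => (hd s).differentiableAt, by rwa [hdg]⟩
  · rw [hdg]; exact hM _ (projIcc (-B) B hBB s).2
  · have h1 : ∫ t in (0 : ℝ)..s, k t = ∫ t in (0 : ℝ)..s, deriv f t := by
      refine intervalIntegral.integral_congr fun t ht => hks t ?_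
      have h0 : (0 : ℝ) ∈ Icc (-B) B := ⟨by linarith, hB⟩
      exact abs_le.2 (uIcc_subset_Icc h0 (abs_le.1 hs) ht)
    simp only [h1]
    rw [intervalIntegral.integral_deriv_eq_sub
      (fun t _ => hf.differentiable one_ne_zero t) (hc.intervalIntegrable _ _)]
    ring
  · rw [hdg, hks s hs]

/-! ### From the weak formulation to `BoundarySolution` -/

lemma energy_of_isWeakSolution (ha : -1 < a) (hs : ContDiffOn ℝ 2 u halfSpace)
    (hb : ∃ B, ∀ Z ∈ halfSpace, |u Z| ≤ B) (hw : IsWeakSolution a f u) : Energy a u := by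
  have h1 : ContDiffOn ℝ 1 u halfSpace := hs.of_le (by norm_num)
  obtain ⟨B, hB⟩ := hb
  refine ⟨h1, LocBdd.locSq ha ⟨h1.continuousOn, fun r => ⟨B, fun Z hZ => hB Z hZ.1⟩⟩, fun i =>
    locSq_of_integrableOn (continuousOn_D h1 i) fun r hr => ?_⟩
  refine (hw.energy r hr).mono' ?_ ?_
  · have h2 : ContinuousOn (fun Z => D i u Z ^ 2) (halfBall r) :=
      ((continuousOn_D h1 i).pow 2).mono (halfBall_subset r)
    exact (Measurable.aestronglyMeasurable (by fun_prop)).mul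
      (h2.aestronglyMeasurable (measurableSet_halfBall r))
  · filter_upwards [ae_restrict_mem (measurableSet_halfBall r)] with Z hZ
    have h3 := Real.rpow_nonneg (le_of_lt hZ.1) a
    rw [Real.norm_of_nonneg (by positivity), norm_gradHbar_sq]
    exact mul_le_mul_of_nonneg_left (sq_D_le_dot u Z i) h3

lemma exists_boundarySolution (ha : a ∈ Ioo (-1 : ℝ) 1) (hf : ContDiff ℝ 1 f)
    (hs : ContDiffOn ℝ 2 u halfSpace) (hb : ∃ B, ∀ Z ∈ halfSpace, |u Z| ≤ B)
    (hw : IsWeakSolution a f u) (hst : IsStable a f u) :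
    ∃ M g, BoundarySolution a M g u ∧ Stable a g u := by
  have hE := energy_of_isWeakSolution ha.1 hs hb hw
  obtain ⟨B, hB⟩ := id hb
  obtain ⟨g, M, hg, hM, hfg⟩ := exists_contDiff_eqOn hf (abs_nonneg B)
  have hae : ∀ᵐ x : Heis, |bdry u x| ≤ |B| :=
    (hE.hasTrace ha.2).ae_abs_le fun Z hZ => (hB Z hZ).trans (le_abs_self B)
  refine ⟨M, g, ⟨ha, hg, hM, hs, hb, hE, fun ξ hξ => ?_⟩, fun ξ hξ => ?_⟩
  · have h1 := hw.weak ξ hξ.isTestFunction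
    simp only [inner_gradHbar] at h1
    rw [integral_μ, h1]
    refine integral_congr_ae ?_
    filter_upwards [hae] with x hx
    rw [(hfg _ hx).1]
  · have h1 := hst ξ hξ.isTestFunction
    simp only [norm_gradHbar_sq] at h1
    rw [integral_μ]
    refine h1.trans_eq ?_
    congr 1
    refine integral_congr_ae ?_
    filter_upwards [hae] with x hx
    rw [(hfg _ hx).2]

lemma locBdd_D_of_norm_gradH (hs : ContDiffOn ℝ 2 u halfSpace)
    (h : ∀ r > 0, ∃ C : ℝ, ∀ Z ∈ halfBall r, ‖gradH u Z‖ ≤ C) (i : Fin 3) (hi : i ≠ 2) :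
    LocBdd (D i u) := by
  refine ⟨(contDiffOn_D hs i).continuousOn, fun r => ?_⟩
  obtain ⟨C, hC⟩ := h (|r| + 1) (by positivity)
  refine ⟨C, fun Z hZ => ?_⟩
  have h1 : Z ∈ halfBall (|r| + 1) := ⟨hZ.1, hZ.2.trans_le (by
    rw [← sq_abs r]; gcongr; linarith)⟩
  refine le_trans (abs_le_of_sq_le_sq ?_ (norm_nonneg _)) (hC Z h1)
  rw [norm_gradH_sq]
  fin_cases i
  · simpa using sq_nonneg (D 1 u Z)
  · simpa using sq_nonneg (D 0 u Z)
  · exact absurd rfl hi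

/-! ### Derivatives of the normal -/

lemma norm_gradH (u : Heis × ℝ → ℝ) (Z : Heis × ℝ) :
    ‖gradH u Z‖ = Real.sqrt (D 0 u Z ^ 2 + D 1 u Z ^ 2) := by
  rw [← norm_gradH_sq, Real.sqrt_sq (norm_nonneg _)]

lemma gradH_ne_zero_iff : gradH u Z ≠ 0 ↔ D 0 u Z ^ 2 + D 1 u Z ^ 2 ≠ 0 := by
  rw [← norm_gradH_sq, ne_eq, ne_eq, sq_eq_zero_iff, norm_eq_zero]

/-- The derivative of a component of `(v, w) / |(v, w)|`. -/
lemma along_div_norm {V : Heis × ℝ → Heis × ℝ} {v w : Heis × ℝ → ℝ}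
    (hv : DifferentiableAt ℝ v Z) (hw : DifferentiableAt ℝ w Z) (h : v Z ^ 2 + w Z ^ 2 ≠ 0) :
    along V (fun Z => (Real.sqrt (v Z ^ 2 + w Z ^ 2))⁻¹ * v Z) Z =
      w Z * (w Z * along V v Z - v Z * along V w Z) / Real.sqrt (v Z ^ 2 + w Z ^ 2) ^ 3 := by
  have hpos : 0 < v Z ^ 2 + w Z ^ 2 := lt_of_le_of_ne (by positivity) (Ne.symm h)
  have hS := Real.sqrt_pos.2 hpos
  have hSS := Real.sq_sqrt hpos.le
  have hq : DifferentiableAt ℝ (fun Z => v Z * v Z + w Z * w Z) Z := (hv.mul hv).add (hw.mul hw)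
  have h1 : HasDerivAt (fun s : ℝ => (Real.sqrt s)⁻¹)
      (-(1 / (2 * Real.sqrt (v Z * v Z + w Z * w Z))) / Real.sqrt (v Z * v Z + w Z * w Z) ^ 2)
      (v Z * v Z + w Z * w Z) :=
    (Real.hasDerivAt_sqrt (by rw [← pow_two, ← pow_two]; exact h)).inv
      (by rw [← pow_two, ← pow_two]; exact hS.ne')
  have h2 := along_comp (V := V) (u := fun Z => v Z * v Z + w Z * w Z) h1 hq
  have h3 : DifferentiableAt ℝ (fun Z => (Real.sqrt (v Z * v Z + w Z * w Z))⁻¹) Z :=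
    
    DifferentiableAt.comp (g := fun s : ℝ => (Real.sqrt s)⁻¹) Z h1.differentiableAt hq
  have h4 := along_mul (V := V) h3 hv
  rw [h2, along_add (u := fun Z => v Z * v Z) (w := fun Z => w Z * w Z) (hv.mul hv) (hw.mul hw),
    along_mul hv hv, along_mul hw hw] at h4
  simp only [← pow_two] at h4
  rw [h4]
  set S := Real.sqrt (v Z ^ 2 + w Z ^ 2)
  field_simp
  rw [hSS]
  ring

lemma gradH_apply_zero (u : Heis × ℝ → ℝ) (Z : Heis × ℝ) : gradH u Z 0 = D 0 u Z := by
  simp [gradH, D_zero]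

lemma gradH_apply_one (u : Heis × ℝ → ℝ) (Z : Heis × ℝ) : gradH u Z 1 = D 1 u Z := by
  simp [gradH, D_one]

lemma normal_zero (u : Heis × ℝ → ℝ) : (fun W => normal u W 0) =
    fun W => (Real.sqrt (D 0 u W ^ 2 + D 1 u W ^ 2))⁻¹ * D 0 u W := by
  funext W
  rw [normal, PiLp.smul_apply, gradH_apply_zero, norm_gradH, smul_eq_mul]

lemma normal_one (u : Heis × ℝ → ℝ) : (fun W => normal u W 1) =
    fun W => (Real.sqrt (D 1 u W ^ 2 + D 0 u W ^ 2))⁻¹ * D 1 u W := by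
  funext W
  rw [normal, PiLp.smul_apply, gradH_apply_one, norm_gradH, smul_eq_mul, add_comm]

section Geometry

lemma along_normal_zero (hs : ContDiffOn ℝ 2 u halfSpace) (hZ : Z ∈ halfSpace)
    (h : gradH u Z ≠ 0) (V : Heis × ℝ → Heis × ℝ) : along V (fun W => normal u W 0) Z =
      D 1 u Z * (D 1 u Z * along V (D 0 u) Z - D 0 u Z * along V (D 1 u) Z) / ‖gradH u Z‖ ^ 3 := by
  rw [normal_zero, norm_gradH]
  exact along_div_norm (differentiableAt_of_mem (contDiffOn_D hs 0) hZ)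
    (differentiableAt_of_mem (contDiffOn_D hs 1) hZ) (gradH_ne_zero_iff.1 h)

lemma along_normal_one (hs : ContDiffOn ℝ 2 u halfSpace) (hZ : Z ∈ halfSpace)
    (h : gradH u Z ≠ 0) (V : Heis × ℝ → Heis × ℝ) : along V (fun W => normal u W 1) Z =
      D 0 u Z * (D 0 u Z * along V (D 1 u) Z - D 1 u Z * along V (D 0 u) Z) / ‖gradH u Z‖ ^ 3 := by
  rw [normal_one, norm_gradH, add_comm (D 0 u Z ^ 2)]
  exact along_div_norm (differentiableAt_of_mem (contDiffOn_D hs 1) hZ)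
    (differentiableAt_of_mem (contDiffOn_D hs 0) hZ) (by
      rw [add_comm]; exact gradH_ne_zero_iff.1 h)

/-- The sign condition `⟨Tν, v⟩ ≥ 0` in terms of the derivatives of `u`. -/
lemma inner_Tnormal_tangent (hs : ContDiffOn ℝ 2 u halfSpace) (hZ : Z ∈ halfSpace)
    (h : gradH u Z ≠ 0) : inner ℝ (Tnormal u Z) (tangent u Z) =
      (D 1 u Z * D 0 (R (0, 0, -4) u) Z - D 0 u Z * D 1 (R (0, 0, -4) u) Z) / ‖gradH u Z‖ ^ 2 := by
  have hn : 0 < ‖gradH u Z‖ := norm_pos_iff.2 h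
  have hsq := norm_gradH_sq u Z
  have e0 : T (fun W => normal u W 0) Z = _ :=
    (congrFun (R_center _) Z).symm.trans (along_normal_zero hs hZ h _)
  have e1 : T (fun W => normal u W 1) Z = _ :=
    (congrFun (R_center _) Z).symm.trans (along_normal_one hs hZ h _)
  rw [D_R_comm hs hZ, D_R_comm hs hZ]
  simp only [Tnormal, tangent, PiLp.inner_apply, Fin.sum_univ_two, e0, e1, ← D_zero, ← D_one, R]
  simp
  field_simp
  rw [hsq]
  ring

lemma meanCurvature_eq (hs : ContDiffOn ℝ 2 u halfSpace) (hZ : Z ∈ halfSpace)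
    (h : gradH u Z ≠ 0) : meanCurvature u Z =
      (D 1 u Z * (D 0 (D 0 u) Z * D 1 u Z - D 0 (D 1 u) Z * D 0 u Z) -
        D 0 u Z * (D 1 (D 0 u) Z * D 1 u Z - D 1 (D 1 u) Z * D 0 u Z)) / ‖gradH u Z‖ ^ 3 := by
  have e0 : X (fun W => normal u W 0) Z = _ :=
    (congrFun (D_zero _) Z).symm.trans (along_normal_zero hs hZ h _)
  have e1 : Y (fun W => normal u W 1) Z = _ :=
    (congrFun (D_one _) Z).symm.trans (along_normal_one hs hZ h _)
  rw [meanCurvature, e0, e1]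
  simp only [D]
  ring

lemma inner_hessTangent_normal (h : gradH u Z ≠ 0) :
    inner ℝ (hessTangent u Z) (normal u Z) * ‖gradH u Z‖ ^ 2 =
      D 0 u Z * (D 0 (D 0 u) Z * D 1 u Z - D 1 (D 0 u) Z * D 0 u Z) +
        D 1 u Z * (D 0 (D 1 u) Z * D 1 u Z - D 1 (D 1 u) Z * D 0 u Z) := by
  have hn : 0 < ‖gradH u Z‖ := norm_pos_iff.2 h
  simp only [hessTangent, normal, tangent, hessH, PiLp.inner_apply, Fin.sum_univ_two, ← D_zero,
    ← D_one, Matrix.mulVec, dotProduct, PiLp.smul_apply, gradH_apply_zero, gradH_apply_one]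
  simp
  field_simp
  ring

/-- If the horizontal direction of the gradient is stationary along `X` and `Y`, then the level set
is minimal and its imaginary curvature is determined by the Hessian. -/
lemma curvature_of_direction_const (hs : ContDiffOn ℝ 2 u halfSpace) (hZ : Z ∈ halfSpace)
    (h : gradH u Z ≠ 0)
    (hK : ∀ i, D i (D 0 u) Z * D 1 u Z - D i (D 1 u) Z * D 0 u Z = 0) :
    meanCurvature u Z = 0 ∧ imagCurvature u Z =
      -(inner ℝ (hessTangent u Z) (normal u Z) / ‖gradH u Z‖) := by
  have hn : 0 < ‖gradH u Z‖ := norm_pos_iff.2 h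
  refine ⟨by rw [meanCurvature_eq hs hZ h, hK 0, hK 1]; simp, ?_⟩
  have h1 := inner_hessTangent_normal h
  have h2 := commutator_X_Y hs hZ
  rw [R_center] at h2
  have h3 : inner ℝ (hessTangent u Z) (normal u Z) = T u Z := by
    refine mul_right_cancel₀ (pow_ne_zero 2 hn.ne') (h1.trans ?_)
    rw [← h2, norm_gradH_sq]
    linear_combination D 0 u Z * hK 0 + D 1 u Z * hK 1
  rw [imagCurvature, h3, neg_div]

end Geometry

end

end Heisenberg

theorem theorem2 (s : ℝ) (hs : s ∈ Ioo (0 : ℝ) 1)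
    (γ : ℝ≥0) (hγ : max 0 (1 - 2 * s) < (γ : ℝ))
    (f : ℝ → ℝ) (hf : IsC1Holder γ f)
    (u : Heis × ℝ → ℝ)
    (hu_smooth : ContDiffOn ℝ 2 u halfSpace)
    (hu_bounded : ∃ M : ℝ, ∀ Z ∈ halfSpace, |u Z| ≤ M)
    (hu_weak : IsWeakSolution (1 - 2 * s) f u)
    (hu_stable : IsStable (1 - 2 * s) f u)
    (hu_grad : ∀ R > 0, ∃ C : ℝ, ∀ Z ∈ halfBall R, ‖gradH u Z‖ ≤ C)
    (hsign : ∀ Z ∈ halfSpace, gradH u Z ≠ 0 →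
      0 ≤ inner ℝ (Tnormal u Z) (tangent u Z))
    (hgrowth : liminf (fun R : ℝ =>
      ((((∫ τ in Real.sqrt R..R, weightedEnergy (1 - 2 * s) u τ / τ ^ 5) +
          weightedEnergy (1 - 2 * s) u R / R ^ 4) / Real.log R ^ 2 : ℝ) : EReal)) atTop = 0) :
    ∀ y > 0, ∀ c : ℝ, ∀ x ∈ regularLevelSet u y c,
      meanCurvature u (x, y) = 0 ∧
      imagCurvature u (x, y) =
        -(inner ℝ (hessTangent u (x, y)) (normal u (x, y)) / ‖gradH u (x, y)‖) := by
  obtain ⟨M, g, hu, hst⟩ := exists_boundarySolution (a := 1 - 2 * s)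
    ⟨by linarith [hs.2], by linarith [hs.1]⟩ hf.1 hu_smooth hu_bounded hu_weak hu_stable
  have hS : ∀ Z ∈ halfSpace,
      0 ≤ D 1 u Z * D 0 (R (0, 0, -4) u) Z - D 0 u Z * D 1 (R (0, 0, -4) u) Z := by
    intro Z hZ
    by_cases h : gradH u Z = 0
    · have h0 : D 0 u Z ^ 2 + D 1 u Z ^ 2 = 0 := by rw [← norm_gradH_sq, h]; simp
      have h1 : D 0 u Z = 0 := by nlinarith [sq_nonneg (D 0 u Z), sq_nonneg (D 1 u Z)]
      have h2 : D 1 u Z = 0 := by nlinarith [sq_nonneg (D 0 u Z), sq_nonneg (D 1 u Z)]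
      simp [h1, h2]
    · have h1 := hsign Z hZ h
      rw [inner_Tnormal_tangent hu_smooth hZ h] at h1
      have hn : 0 < ‖gradH u Z‖ ^ 2 := pow_pos (norm_pos_iff.2 h) 2
      exact by simpa [div_mul_cancel₀ _ hn.ne'] using mul_nonneg h1 hn.le
  have hfreq : ∀ ε > 0, ∃ᶠ r in atTop,
      ((∫ τ in Real.sqrt r..r, weightedEnergy (1 - 2 * s) u τ / τ ^ 5) +
        weightedEnergy (1 - 2 * s) u r / r ^ 4) / Real.log r ^ 2 < ε := by
    intro ε hε
    refine (frequently_lt_of_liminf_lt (b := (ε : EReal)) (by isBoundedDefault) ?_).mono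
      fun r hr => EReal.coe_lt_coe_iff.1 hr
    rw [hgrowth]
    exact_mod_cast hε
  intro y hy c x hx
  refine curvature_of_direction_const hu_smooth hy hx.2 fun i => ?_
  exact hu.direction_const hst (locBdd_D_of_norm_gradH hu_smooth hu_grad) hS hfreq hy
    (gradH_ne_zero_iff.1 hx.2) i
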